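/- All graphs are finite and simple, and MSO$_1$ is monadic second-order logic over the vocabulary $\{\mathrm{edge}\}$ of graphs, with quantification over vertices and vertex sets. For labels $1,\dots,\gamma$, a $\gamma$-expression is an algebraic expression built from the operations: create a new vertex with label $i$; take the disjoint union of two labeled graphs; add all edges between vertices of label $i$ and vertices of label $j$; relabel all vertices of label $i$ to label $j$. A (one-dimensional) MSO$_1$ interpretation $I=(\nu(x),\eta(x,y))$ assigns to a graph $T$ the structure $T^I$ with domain $\{a\mid T\models\nu(a)\}$ and edge relation given by $\eta$; it translates a formula $\psi$ to the formula $\psi^I$ obtained by relativizing all vertex quantifiers to $\nu$ and all set quantifiers to subsets of $\nu$, and by replacing every atom $\mathrm{edge}(x,y)$ by $\eta(x,y)$. **Lemma.** Let $G$ be a graph given along with a $\gamma$-expression $\Gamma$ constructing $G$, and let $\psi$ be an MSO$_1$ formula with one free vertex-set variable. One can compute, in time $\mathcal{O}_\gamma(|V(G)|+|\Gamma|+|\psi|)$, an (uncolored, unrooted) tree $T$ and an MSO$_1$ formula $\varphi$ with one free vertex-set variable such that $V(G)\subseteq V(T)$ and, for every $X\subseteq V(T)$, $$T\models\varphi(X)\quad\text{iff}\quad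 X\subseteq V(G)\ \text{ and }\ G\models\psi(X).$$ Moreover, $T$ does not depend on $\psi$, and the construction is an MSO$_1$ interpretation of $G$ in $T$: there is an interpretation $I=(\nu,\eta)$, depending only on $\gamma$, such that $T^I=G$ and $\varphi(X)$ is the formula $\forall y\,(y\in X\to\nu(y))\wedge\psi^I(X)$. Here one and the same algorithm, a program of a unit-cost random access machine, works for all inputs $(\gamma,G,\Gamma,\psi)$; $V(G)=\{0,\dots,n-1\}$, the input consists of $n$, $\gamma$ and of $\Gamma$ and $\psi$ written as words, $|\Gamma|$ and $|\psi|$ are their numbers of symbols, the output consists of an edge list of $T$ and of $\varphi$ written as a word, and the constant in $\mathcal{O}_\gamma$ depends only on $\gamma$. -/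

import Mathlib

/-! ## Monadic second order logic over graphs (vertices and vertex sets) -/

/-- MSO₁ formulas over the vocabulary of graphs with `p` free vertex variables and `q` free
vertex-set variables. Bound variables are de Bruijn indices (separately for the two sorts): under a
quantifier, variable `0` is the one that has just been bound, and the older ones move up by one. -/
inductive MSO1 : ℕ → ℕ → Type where
  /-- `x = y` -/
  | eq {p q : ℕ} (x y : Fin p) : MSO1 p q
  /-- `edge(x, y)` -/
  | edge {p q : ℕ} (x y : Fin p) : MSO1 p q
  /-- `x ∈ X` -/
  | mem {p q : ℕ} (x : Fin p) (X : Fin q) : MSO1 p q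
  | not {p q : ℕ} (φ : MSO1 p q) : MSO1 p q
  | and {p q : ℕ} (φ χ : MSO1 p q) : MSO1 p q
  | or {p q : ℕ} (φ χ : MSO1 p q) : MSO1 p q
  | imp {p q : ℕ} (φ χ : MSO1 p q) : MSO1 p q
  | iff {p q : ℕ} (φ χ : MSO1 p q) : MSO1 p q
  /-- `∃ x, φ` for a vertex variable `x` -/
  | exV {p q : ℕ} (φ : MSO1 (p + 1) q) : MSO1 p q
  /-- `∀ x, φ` for a vertex variable `x` -/
  | allV {p q : ℕ} (φ : MSO1 (p + 1) q) : MSO1 p q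
  /-- `∃ X, φ` for a vertex-set variable `X` -/
  | exS {p q : ℕ} (φ : MSO1 p (q + 1)) : MSO1 p q
  /-- `∀ X, φ` for a vertex-set variable `X` -/
  | allS {p q : ℕ} (φ : MSO1 p (q + 1)) : MSO1 p q

namespace MSO1

/-- `Sat G φ a A`: the graph `G` satisfies `φ` under the assignment `a` of vertices to the free
vertex variables and `A` of vertex sets to the free set variables. -/
def Sat {V : Type*} (G : SimpleGraph V) :
    {p q : ℕ} → MSO1 p q → (Fin p → V) → (Fin q → Set V) → Prop
  | _, _, .eq x y, a, _ => a x = a y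
  | _, _, .edge x y, a, _ => G.Adj (a x) (a y)
  | _, _, .mem x X, a, A => a x ∈ A X
  | _, _, .not φ, a, A => ¬ Sat G φ a A
  | _, _, .and φ χ, a, A => Sat G φ a A ∧ Sat G χ a A
  | _, _, .or φ χ, a, A => Sat G φ a A ∨ Sat G χ a A
  | _, _, .imp φ χ, a, A => Sat G φ a A → Sat G χ a A
  | _, _, .iff φ χ, a, A => (Sat G φ a A ↔ Sat G χ a A)
  | _, _, .exV φ, a, A => ∃ v : V, Sat G φ (Fin.cons v a : Fin (_ + 1) → V) A
  | _, _, .allV φ, a, A => ∀ v : V, Sat G φ (Fin.cons v a : Fin (_ + 1) → V) A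
  | _, _, .exS φ, a, A => ∃ S : Set V, Sat G φ a (Fin.cons S A : Fin (_ + 1) → Set V)
  | _, _, .allS φ, a, A => ∀ S : Set V, Sat G φ a (Fin.cons S A : Fin (_ + 1) → Set V)

/-- `G ⊨ φ(X)` for a formula `φ` whose only free variable is one vertex-set variable. -/
def Models {V : Type*} (G : SimpleGraph V) (φ : MSO1 0 1) (X : Set V) : Prop :=
  Sat G φ Fin.elim0 (fun _ => X)

/-- Extend a renaming of variables below one more quantifier. -/
def liftVar {p p' : ℕ} (ρ : Fin p → Fin p') : Fin (p + 1) → Fin (p' + 1) :=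
  Fin.cons 0 (fun i => (ρ i).succ)

/-- Substitute variables for the free variables of a formula (without capture). -/
def rename : {p q p' q' : ℕ} → (Fin p → Fin p') → (Fin q → Fin q') → MSO1 p q → MSO1 p' q'
  | _, _, _, _, ρ, _, .eq x y => .eq (ρ x) (ρ y)
  | _, _, _, _, ρ, _, .edge x y => .edge (ρ x) (ρ y)
  | _, _, _, _, ρ, σ, .mem x X => .mem (ρ x) (σ X)
  | _, _, _, _, ρ, σ, .not φ => .not (rename ρ σ φ)
  | _, _, _, _, ρ, σ, .and φ χ => .and (rename ρ σ φ) (rename ρ σ χ)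
  | _, _, _, _, ρ, σ, .or φ χ => .or (rename ρ σ φ) (rename ρ σ χ)
  | _, _, _, _, ρ, σ, .imp φ χ => .imp (rename ρ σ φ) (rename ρ σ χ)
  | _, _, _, _, ρ, σ, .iff φ χ => .iff (rename ρ σ φ) (rename ρ σ χ)
  | _, _, _, _, ρ, σ, .exV φ => .exV (rename (liftVar ρ) σ φ)
  | _, _, _, _, ρ, σ, .allV φ => .allV (rename (liftVar ρ) σ φ)
  | _, _, _, _, ρ, σ, .exS φ => .exS (rename ρ (liftVar σ) φ)
  | _, _, _, _, ρ, σ, .allS φ => .allS (rename ρ (liftVar σ) φ)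

/-- The formula written as a word of symbols, in Polish notation: a symbol is a number, namely
one of the twelve operation symbols or the index of a variable. Its length is the size `|φ|`. -/
def code : {p q : ℕ} → MSO1 p q → List ℕ
  | _, _, .eq x y => [0, x, y]
  | _, _, .edge x y => [1, x, y]
  | _, _, .mem x X => [2, x, X]
  | _, _, .not φ => 3 :: φ.code
  | _, _, .and φ χ => 4 :: (φ.code ++ χ.code)
  | _, _, .or φ χ => 5 :: (φ.code ++ χ.code)
  | _, _, .imp φ χ => 6 :: (φ.code ++ χ.code)
  | _, _, .iff φ χ => 7 :: (φ.code ++ χ.code)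
  | _, _, .exV φ => 8 :: φ.code
  | _, _, .allV φ => 9 :: φ.code
  | _, _, .exS φ => 10 :: φ.code
  | _, _, .allS φ => 11 :: φ.code

end MSO1

/-! ## One-dimensional MSO interpretations of graphs in graphs -/

/-- A one-dimensional MSO₁ interpretation of graphs in graphs: the formulas `ν(x)` and
`η(x, y)`. -/
structure GraphInterpretation where
  /-- `ν(x)`, defining the domain -/
  dom : MSO1 1 0
  /-- `η(x, y)`, defining the edge relation -/
  edge : MSO1 2 0

namespace GraphInterpretation

/-- `ν(x)`, written for a variable `x` of a larger context. -/
def domAt (I : GraphInterpretation) {p q : ℕ} (x : Fin p) : MSO1 p q :=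
  I.dom.rename (fun _ => x) Fin.elim0

/-- `η(x, y)`, written for variables `x, y` of a larger context. -/
def edgeAt (I : GraphInterpretation) {p q : ℕ} (x y : Fin p) : MSO1 p q :=
  I.edge.rename ![x, y] Fin.elim0

/-- The formula `∀ y (y ∈ X → ν(y))`. -/
def setInDom (I : GraphInterpretation) {p q : ℕ} (X : Fin q) : MSO1 p q :=
  .allV (.imp (.mem 0 X) (I.domAt 0))

/-- The translation `ψ ↦ ψ^I`: quantifiers are relativized to the domain `ν` and edge atoms are
replaced by `η`. -/
def translate (I : GraphInterpretation) : {p q : ℕ} → MSO1 p q → MSO1 p q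
  | _, _, .eq x y => .eq x y
  | _, _, .edge x y => I.edgeAt x y
  | _, _, .mem x X => .mem x X
  | _, _, .not φ => .not (I.translate φ)
  | _, _, .and φ χ => .and (I.translate φ) (I.translate χ)
  | _, _, .or φ χ => .or (I.translate φ) (I.translate χ)
  | _, _, .imp φ χ => .imp (I.translate φ) (I.translate χ)
  | _, _, .iff φ χ => .iff (I.translate φ) (I.translate χ)
  | _, _, .exV φ => .exV (.and (I.domAt 0) (I.translate φ))
  | _, _, .allV φ => .allV (.imp (I.domAt 0) (I.translate φ))
  | _, _, .exS φ => .exS (.and (I.setInDom 0) (I.translate φ))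
  | _, _, .allS φ => .allS (.imp (I.setInDom 0) (I.translate φ))

/-- The structure `T^I`, whose domain is `{a | T ⊨ ν(a)}` and whose edge relation is given by
`T ⊨ η(a, b)`, is the graph `G`, where the vertex set of `G` is regarded as a subset of the vertex
set of `T` along `ι`. -/
def Interprets (I : GraphInterpretation) {V W : Type*} (T : SimpleGraph W) (G : SimpleGraph V)
    (ι : V ↪ W) : Prop :=
  {w : W | I.dom.Sat T ![w] Fin.elim0} = Set.range ι ∧
    ∀ u v : V, I.edge.Sat T ![ι u, ι v] Fin.elim0 ↔ G.Adj u v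

end GraphInterpretation

/-! ## Clique-width expressions -/

/-- `k`-expressions over labels `Fin k`; every vertex that is created is named by an element
of `V`. -/
inductive CWExpr (k : ℕ) (V : Type*) where
  /-- create the vertex `v` with label `i` -/
  | vertex (v : V) (i : Fin k) : CWExpr k V
  /-- disjoint union -/
  | union (Γ Δ : CWExpr k V) : CWExpr k V
  /-- add all edges between vertices of label `i` and vertices of label `j` -/
  | join (i j : Fin k) (Γ : CWExpr k V) : CWExpr k V
  /-- relabel all vertices with label `i` to have label `j` -/
  | relabel (i j : Fin k) (Γ : CWExpr k V) : CWExpr k V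

namespace CWExpr

variable {k : ℕ} {V : Type*}

/-- The vertices of the labeled graph constructed by an expression. -/
def verts : CWExpr k V → Set V
  | .vertex v _ => {v}
  | .union Γ Δ => Γ.verts ∪ Δ.verts
  | .join _ _ Γ => Γ.verts
  | .relabel _ _ Γ => Γ.verts

/-- All unions taken in the expression are disjoint, so that each vertex is created once. -/
def WellFormed : CWExpr k V → Prop
  | .vertex _ _ => True
  | .union Γ Δ => Γ.WellFormed ∧ Δ.WellFormed ∧ Disjoint Γ.verts Δ.verts
  | .join _ _ Γ => Γ.WellFormed
  | .relabel _ _ Γ => Γ.WellFormed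

/-- `Γ.HasLabel u l`: the vertex `u` has label `l` in the labeled graph constructed by `Γ`. -/
def HasLabel : CWExpr k V → V → Fin k → Prop
  | .vertex v i, u, l => u = v ∧ l = i
  | .union Γ Δ, u, l => Γ.HasLabel u l ∨ Δ.HasLabel u l
  | .join _ _ Γ, u, l => Γ.HasLabel u l
  | .relabel i j Γ, u, l => ∃ l', Γ.HasLabel u l' ∧ l = if l' = i then j else l'

/-- The adjacency of the labeled graph constructed by an expression. The graphs are simple, so
that `join i i` makes the vertices of label `i` pairwise adjacent without adding loops. -/
def Adj : CWExpr k V → V → V → Prop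
  | .vertex _ _, _, _ => False
  | .union Γ Δ, u, w => Γ.Adj u w ∨ Δ.Adj u w
  | .join i j Γ, u, w => Γ.Adj u w ∨
      (u ≠ w ∧ ((Γ.HasLabel u i ∧ Γ.HasLabel w j) ∨ (Γ.HasLabel u j ∧ Γ.HasLabel w i)))
  | .relabel _ _ Γ, u, w => Γ.Adj u w

/-- The expression `Γ` constructs (a labeling of) the graph `G`. -/
def Constructs (Γ : CWExpr k V) (G : SimpleGraph V) : Prop :=
  Γ.WellFormed ∧ Γ.verts = Set.univ ∧ ∀ u w, G.Adj u w ↔ Γ.Adj u w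

/-- The expression, over vertices `0, …, n - 1`, written as a word of symbols in Polish notation:
a symbol is a number, namely one of the four operation symbols, a label or a vertex. Its length is
the size `|Γ|`. -/
def code {n : ℕ} : CWExpr k (Fin n) → List ℕ
  | .vertex v i => [0, v, i]
  | .union Γ Δ => 1 :: (Γ.code ++ Δ.code)
  | .join i j Γ => 2 :: i :: j :: Γ.code
  | .relabel i j Γ => 3 :: i :: j :: Γ.code

end CWExpr

/-! ## Graphs as edge lists -/

/-- `L` is a list of the edges of `T`. -/
def IsEdgeList {N : ℕ} (T : SimpleGraph (Fin N)) (L : List (Fin N × Fin N)) : Prop :=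
  ∀ u v : Fin N, T.Adj u v ↔ (u, v) ∈ L ∨ (v, u) ∈ L

/-- The graph with vertices `0, …, N - 1` and list of edges `L` as a word: a record `1 u v` for
every edge, then the end mark `0` and the number of vertices. -/
def edgeListCode (N : ℕ) (L : List (Fin N × Fin N)) : List ℕ :=
  L.flatMap (fun e => [1, (e.1 : ℕ), (e.2 : ℕ)]) ++ [0, N]

/-! ## Random access machines

A unit-cost random access machine with a read-only input tape, a write-only output tape and memory
cells that hold natural numbers. Its only arithmetic operations are successor and predecessor, so
that numbers cannot grow by more than one per step. -/

namespace RAM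

/-- Programs. Below, `[a]` is the content of the memory cell `a`. -/
inductive Prog where
  /-- `[a] := c` -/
  | const (a c : ℕ) : Prog
  /-- `[a] := [b]` -/
  | copy (a b : ℕ) : Prog
  /-- `[a] := [a] + 1` -/
  | inc (a : ℕ) : Prog
  /-- `[a] := [a] - 1` (and `0` if `[a] = 0`) -/
  | dec (a : ℕ) : Prog
  /-- indirect addressing, `[a] := [[b]]` -/
  | load (a b : ℕ) : Prog
  /-- indirect addressing, `[[a]] := [b]` -/
  | store (a b : ℕ) : Prog
  /-- move the next number from the input tape to the cell `a` (`0` after the end of the input) -/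
  | read (a : ℕ) : Prog
  /-- append `[a]` to the output tape -/
  | write (a : ℕ) : Prog
  /-- first `P`, then `Q` -/
  | seq (P Q : Prog) : Prog
  /-- if `[a] ≠ 0` then `P` else `Q` -/
  | ifNZ (a : ℕ) (P Q : Prog) : Prog
  /-- while `[a] ≠ 0` do `P` -/
  | whileNZ (a : ℕ) (P : Prog) : Prog

/-- States of the machine. -/
structure State where
  /-- the memory -/
  mem : ℕ → ℕ
  /-- the unread part of the input -/
  inp : List ℕ
  /-- the output written so far -/
  out : List ℕ

/-- Write the number `c` into the memory cell `a`. -/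
def State.set (s : State) (a c : ℕ) : State :=
  { s with mem := Function.update s.mem a c }

/-- `Exec P s t s'`: started in state `s`, the program `P` halts after exactly `t` steps, in
state `s'`. Each elementary instruction and each test of a condition is one step. -/
inductive Exec : Prog → State → ℕ → State → Prop where
  | const (a c : ℕ) (s : State) : Exec (.const a c) s 1 (s.set a c)
  | copy (a b : ℕ) (s : State) : Exec (.copy a b) s 1 (s.set a (s.mem b))
  | inc (a : ℕ) (s : State) : Exec (.inc a) s 1 (s.set a (s.mem a + 1))
  | dec (a : ℕ) (s : State) : Exec (.dec a) s 1 (s.set a (s.mem a - 1))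
  | load (a b : ℕ) (s : State) : Exec (.load a b) s 1 (s.set a (s.mem (s.mem b)))
  | store (a b : ℕ) (s : State) : Exec (.store a b) s 1 (s.set (s.mem a) (s.mem b))
  | read (a : ℕ) (s : State) :
      Exec (.read a) s 1 { s.set a (s.inp.headD 0) with inp := s.inp.tail }
  | write (a : ℕ) (s : State) : Exec (.write a) s 1 { s with out := s.out ++ [s.mem a] }
  | seq {P Q : Prog} {s s' s'' : State} {t t' : ℕ} :
      Exec P s t s' → Exec Q s' t' s'' → Exec (.seq P Q) s (t + t') s''
  | ifTrue {a : ℕ} {P Q : Prog} {s s' : State} {t : ℕ} :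
      s.mem a ≠ 0 → Exec P s t s' → Exec (.ifNZ a P Q) s (t + 1) s'
  | ifFalse {a : ℕ} {P Q : Prog} {s s' : State} {t : ℕ} :
      s.mem a = 0 → Exec Q s t s' → Exec (.ifNZ a P Q) s (t + 1) s'
  | whileDone {a : ℕ} {P : Prog} {s : State} :
      s.mem a = 0 → Exec (.whileNZ a P) s 1 s
  | whileStep {a : ℕ} {P : Prog} {s s' s'' : State} {t t' : ℕ} :
      s.mem a ≠ 0 → Exec P s t s' → Exec (.whileNZ a P) s' t' s'' →
        Exec (.whileNZ a P) s (t + 1 + t') s''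

/-- On input `x` the program `P`, started with an all-zero memory, halts after at most `b` steps
with output `y`. -/
def ComputesWithin (P : Prog) (x y : List ℕ) (b : ℕ) : Prop :=
  ∃ (t : ℕ) (s : State), Exec P ⟨fun _ => 0, x, []⟩ t s ∧ s.out = y ∧ t ≤ b

end RAM

/-! The tree is the parse tree of the expression, with operations stretched to paths and annotated
by pendant leaves. A join or a relabeling for `i, j` becomes a gadget, a path of two blocks of `γ +
1` nodes each. In either block, node `l + 2` stands for label `l`: in the lower block before the
operation, in the upper block after it. Node 1 of a block is spare. A union is a branching, and a
vertex created with label `i` hangs at depth `i + 2`. The upper node of `j` gets two leaves; the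
lower node of `i` gets three for a join and four for a relabeling; the root gets five. Leaves used
as marks therefore always have a sibling leaf, while a vertex of the graph is the only leaf at its
neighbour. This defines the domain. The spare nodes matter here: a vertex never hangs directly from
a node that other branches share.

Adjacency is read off by tokens. A token starts at a vertex and climbs `γ + 1` nodes at a time. This
stride leads from the lower to the upper node of the same label, and from there to the lower node of
that label in the next gadget above. At a node with four leaves the token jumps instead to the
nearest node above with at least two leaves, which is the upper node of the new label. So within a
gadget a token visits only the two nodes for the current label of its vertex, and two distinct
vertices are adjacent iff in some join gadget one token visits the lower mark and the other the
upper mark. The induction over the expression is `Tracks.of_represents`, and its outcome is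
`Represents.adj_iff`.

All of this is definable by formulas depending only on `γ`. The root is the only node with five
leaves, which makes the ancestor relation definable (`sat_ancF`), and reachability by tokens is
membership in all closed sets (`sat_meetF`). `CWExpr.dom_iff` and `CWExpr.adj_iff_tree` verify the
concrete tree, and `sat_translate` is the usual relativization argument.

For the algorithm, Polish notation allows one pass over the input. A stack of attachment points
suffices for the expression (`runs_tree`). The formula needs only a counter, since the translation
replaces every symbol, or every atom, by a word that is fixed up to variable indices
(`translates_code`). The work per symbol is bounded in terms of `γ`. -/

namespace MSO1

/-! ### ### The formulas of the interpretation -/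

variable {V : Type*}

/-- `x` has at most one neighbour. -/
def leafF {p q : ℕ} (x : Fin p) : MSO1 p q :=
  .allV (.allV (.imp (.and (.edge x.succ.succ (Fin.succ 0)) (.edge x.succ.succ 0))
    (.eq (Fin.succ 0) 0)))

/-- `x` has at least `k` neighbours that are leaves and differ from the variables in `xs`. -/
def geF : (k : ℕ) → {p q : ℕ} → (x : Fin p) → (xs : List (Fin p)) → MSO1 p q
  | 0, _, _, x, _ => .eq x x
  | k + 1, _, _, x, xs => .exV (.and (.and (.edge x.succ 0) (leafF 0))
      (xs.foldr (fun z φ => .and (.not (.eq 0 z.succ)) φ) (geF k x.succ (0 :: xs.map Fin.succ))))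

/-- `y` is an ancestor of `x` (or `x` itself), where the root is the vertex with five leaves. -/
def ancF {p q : ℕ} (x y : Fin p) : MSO1 p q :=
  .exS (.and (.mem x 0) (.allV (.imp (.mem 0 0) (.or (.eq 0 y.succ)
    (.and (.not (geF 5 0 [])) (.allV (.imp (.edge (Fin.succ 0) 0) (.mem 0 0))))))))

/-- `y` is the parent of `x`. -/
def parF {p q : ℕ} (x y : Fin p) : MSO1 p q := .and (.edge x y) (ancF x y)

/-- `b` is the nearest proper ancestor of `a` with at least two leaves. -/
def nearF {p q : ℕ} (a b : Fin p) : MSO1 p q :=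
  .and (geF 2 b []) (.and (.not (.eq a b)) (.and (ancF a b)
    (.allV (.imp (.and (geF 2 0 []) (.and (.not (.eq a.succ 0)) (ancF a.succ 0)))
      (ancF b.succ 0)))))

/-- The `k`-th ancestor of the vertex variable `0`, if any, lies in the set variable `0`. -/
def climbF : (k p q : ℕ) → MSO1 (p + 1) (q + 1)
  | 0, _, _ => .mem 0 0
  | k + 1, p, q => .allV (.imp (parF (Fin.succ 0) 0) (climbF k (p + 1) q))

/-- The set variable `0` is closed under token steps of stride `M`. -/
def closedF (M p q : ℕ) : MSO1 p (q + 1) :=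
  .and (.allV (.imp (.and (.mem 0 0) (.not (geF 4 0 []))) (climbF M p q)))
    (.allV (.allV (.imp (.and (.mem (Fin.succ 0) 0) (.and (geF 4 (Fin.succ 0) [])
      (nearF (Fin.succ 0) 0))) (.mem 0 0))))

/-- The tokens of `x` and `y` reach the lower and the upper node of a join gadget. -/
def meetF (M : ℕ) {p q : ℕ} (x y : Fin p) : MSO1 p q :=
  .exV (.exV (.and (.and (geF 3 (Fin.succ 0) []) (.not (geF 4 (Fin.succ 0) [])))
    (.and (nearF (Fin.succ 0) 0) (.allS (.imp (closedF M (p + 2) q)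
      (.and (.imp (.mem x.succ.succ 0) (.mem (Fin.succ 0) 0))
        (.imp (.mem y.succ.succ 0) (.mem 0 0))))))))

/-- The edge formula. -/
def etaF (M : ℕ) {p q : ℕ} (x y : Fin p) : MSO1 p q :=
  .and (.not (.eq x y)) (.exV (.exV (.and
    (.or (.and (.eq (Fin.succ 0) x.succ.succ) (.eq 0 y.succ.succ))
      (.and (.eq (Fin.succ 0) y.succ.succ) (.eq 0 x.succ.succ)))
    (meetF M (Fin.succ 0) 0))))

/-- `x` is a leaf, and its neighbour has no other leaf. -/
def domF {p q : ℕ} (x : Fin p) : MSO1 p q :=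
  .and (leafF x) (.allV (.allV (.imp (.and (.edge x.succ.succ (Fin.succ 0))
    (.and (.edge (Fin.succ 0) 0) (leafF 0))) (.eq 0 x.succ.succ))))

end MSO1

/-! ### ### Leaves, rooted trees and tokens -/

/-- `l` has at most one neighbour in `T`. -/
def SimpleGraph.IsLeaf {V : Type*} (T : SimpleGraph V) (l : V) : Prop :=
  ∀ u v, T.Adj l u → T.Adj l v → u = v

/-- The number of leaves adjacent to `a`. -/
noncomputable def SimpleGraph.leafCount {V : Type*} (T : SimpleGraph V) (a : V) : ℕ :=
  {l | T.Adj a l ∧ T.IsLeaf l}.ncard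

/-- `T` is the tree with root `r` in which `E p w` says that `p` is the parent of `w`. -/
structure IsRootedTree {V : Type*} (T : SimpleGraph V) (E : V → V → Prop) (r : V) : Prop where
  adj_iff : ∀ u v, T.Adj u v ↔ E u v ∨ E v u
  unique : ∀ p p' w, E p w → E p' w → p = p'
  not_parent_root : ∀ p, ¬ E p r
  exists_parent : ∀ w, w ≠ r → ∃ p, E p w
  wf : WellFounded E

/-- `b` is the `k`-th ancestor of `a`. -/
def UpN {V : Type*} (E : V → V → Prop) : ℕ → V → V → Prop
  | 0, a, b => a = b
  | k + 1, a, b => ∃ c, E c a ∧ UpN E k c b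

open Relation in
/-- `b` is the nearest proper ancestor of `a` with `lc b ≥ 2`. -/
def Near {V : Type*} (E : V → V → Prop) (lc : V → ℕ) (a b : V) : Prop :=
  2 ≤ lc b ∧ a ≠ b ∧ ReflTransGen E b a ∧
    ∀ c, 2 ≤ lc c → a ≠ c → ReflTransGen E c a → ReflTransGen E c b

/-- One step of a token: up by `M`, or from a node with four leaves to the nearest mark above. -/
def TokenStep {V : Type*} (E : V → V → Prop) (lc : V → ℕ) (M : ℕ) (a b : V) : Prop :=
  (¬ 4 ≤ lc a ∧ UpN E M a b) ∨ (4 ≤ lc a ∧ Near E lc a b)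

/-! ### ### Meaning of the formulas that count leaves -/

namespace MSO1
open Relation

variable {V : Type*} {T : SimpleGraph V} {p q : ℕ} {a : Fin p → V} {A : Fin q → Set V}

theorem sat_leafF {x : Fin p} : (leafF x).Sat T a A ↔ T.IsLeaf (a x) := by
  simp only [leafF, Sat, Fin.cons_succ, Fin.cons_zero, SimpleGraph.IsLeaf]
  exact ⟨fun h u v hu hv => h u v ⟨hu, hv⟩, fun h u v hu => h u v hu.1 hu.2⟩

theorem sat_foldr_ne {x : V} (xs : List (Fin p)) (φ : MSO1 (p + 1) q) :
    (xs.foldr (fun z φ => .and (.not (.eq 0 z.succ)) φ) φ).Sat T (Fin.cons x a : Fin (p + 1) → V) A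
      ↔ (∀ z ∈ xs, x ≠ a z) ∧ φ.Sat T (Fin.cons x a : Fin (p + 1) → V) A := by
  induction xs with
  | nil => simp
  | cons z xs ih => simp [Sat, ih, and_assoc]

/-- The list `xs` holds the leaves chosen so far, so each quantifier removes one new element from
the set that is being counted. Finiteness makes `ncard` drop by exactly one. -/
theorem sat_geF [Finite V] {k : ℕ} {x : Fin p} {xs : List (Fin p)} :
    (geF k x xs).Sat T a A ↔
      k ≤ ({l | T.Adj (a x) l ∧ T.IsLeaf l} \ {l | ∃ z ∈ xs, l = a z}).ncard := by
  induction k generalizing p with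
  | zero => simp [geF, Sat]
  | succ k ih =>
    simp only [geF, Sat, sat_foldr_ne, ih, sat_leafF, Fin.cons_succ, Fin.cons_zero,
      List.mem_cons, List.mem_map]
    have key : ∀ v : V, (v ∈ ({l | T.Adj (a x) l ∧ T.IsLeaf l} \ {l | ∃ z ∈ xs, l = a z})) →
      ({l | T.Adj (a x) l ∧ T.IsLeaf l} \ {l | ∃ z, (z = 0 ∨ ∃ b ∈ xs, b.succ = z) ∧
        l = (Fin.cons v a : Fin (p + 1) → V) z}).ncard + 1 =
      ({l | T.Adj (a x) l ∧ T.IsLeaf l} \ {l | ∃ z ∈ xs, l = a z}).ncard := by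
      intro v hv
      rw [← Set.ncard_sdiff_singleton_add_one hv (Set.toFinite _), Set.sdiff_sdiff]
      congr 3
      ext l
      simp only [Set.mem_ofPred_eq, Set.mem_union, Set.mem_singleton_iff]
      constructor
      · rintro ⟨z, rfl | ⟨b, hb, rfl⟩, rfl⟩
        · right; simp
        · left; exact ⟨b, hb, by simp⟩
      · rintro (⟨b, hb, rfl⟩ | rfl)
        · exact ⟨b.succ, Or.inr ⟨b, hb, rfl⟩, by simp⟩
        · exact ⟨0, Or.inl rfl, by simp⟩
    constructor
    · rintro ⟨v, ⟨h1, h2⟩, h3, h4⟩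
      rw [← key v ⟨⟨h1, h2⟩, fun ⟨z, hz, e⟩ => h3 z hz e⟩]
      omega
    · intro h
      obtain ⟨v, hv⟩ := (Set.ncard_pos (Set.toFinite _)).1 (lt_of_lt_of_le (Nat.succ_pos k) h)
      refine ⟨v, hv.1, fun z hz e => hv.2 ⟨z, hz, e⟩, ?_⟩
      have := key v hv
      omega

theorem sat_geF_nil [Finite V] {k : ℕ} {x : Fin p} :
    (geF k x []).Sat T a A ↔ k ≤ T.leafCount (a x) := by
  rw [sat_geF]; simp [SimpleGraph.leafCount]

theorem sat_domF {x : Fin p} : (domF x).Sat T a A ↔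
    T.IsLeaf (a x) ∧ ∀ z y, T.Adj (a x) z → T.Adj z y → T.IsLeaf y → y = a x := by
  simp only [domF, Sat, sat_leafF, Fin.cons_succ, Fin.cons_zero]
  simp only [and_imp]

end MSO1

/-! ### ### Meaning of the formulas in a rooted tree -/

namespace IsRootedTree
open Relation MSO1

variable {V : Type*} {T : SimpleGraph V} {E : V → V → Prop} {r : V} (h : IsRootedTree T E r)
include h

theorem anc_root (x : V) : ReflTransGen E r x := by
  induction x using h.wf.induction with
  | _ x ih =>
    by_cases hx : x = r
    · rw [hx]
    · obtain ⟨p, hp⟩ := h.exists_parent x hx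
      exact (ih p hp).tail hp

theorem not_transGen_self (x : V) : ¬ TransGen E x x :=
  fun hx => h.wf.transGen.irrefl.irrefl x hx

theorem anc_antisymm {x y : V} (h1 : ReflTransGen E x y) (h2 : ReflTransGen E y x) : x = y := by
  rcases reflTransGen_iff_eq_or_transGen.1 h1 with e | h1
  · exact e.symm
  · exact absurd (h1.trans_left h2) (h.not_transGen_self x)

theorem anc_of_anc_of_parent {x y p : V} (hp : E p x) (hxy : ReflTransGen E y x) (hne : x ≠ y) :
    ReflTransGen E y p := by
  rcases hxy.cases_tail with e | ⟨c, hc, hcx⟩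
  · exact absurd e hne
  · rwa [h.unique p c x hp hcx]

/-- The quantified set contains all neighbours of each of its elements other than `y`, and it avoids
the root unless `y` is the root. Climbing from an element by parents therefore stays in the set and
can only end at `y`. -/
theorem sat_ancF [Finite V] (hr : ∀ a, 5 ≤ T.leafCount a ↔ a = r) {p q : ℕ} {a : Fin p → V}
    {A : Fin q → Set V} {x y : Fin p} :
    (ancF x y).Sat T a A ↔ ReflTransGen E (a y) (a x) := by
  simp only [ancF, Sat, sat_geF_nil, Fin.cons_succ, Fin.cons_zero, hr]
  constructor
  · rintro ⟨S, hx, hS⟩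
    have : ∀ z, z ∈ S → ReflTransGen E (a y) z := by
      intro z
      induction z using h.wf.induction with
      | _ z ih =>
        intro hz
        rcases hS z hz with e | ⟨hzr, hn⟩
        · rw [e]
        · obtain ⟨p, hp⟩ := h.exists_parent z hzr
          exact (ih p hp (hn p ((h.adj_iff _ _).2 (Or.inr hp)))).tail hp
    exact this _ hx
  · intro hxy
    -- The subtree of `y` can be left through `y` only.
    refine ⟨{z | ReflTransGen E (a y) z}, hxy, fun z hz => ?_⟩
    by_cases e : z = a y
    · exact Or.inl e
    refine Or.inr ⟨?_, fun w hw => ?_⟩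
    · rintro rfl
      exact e (h.anc_antisymm (h.anc_root _) hz)
    · rcases (h.adj_iff _ _).1 hw with hw | hw
      · exact ReflTransGen.tail hz hw
      · exact h.anc_of_anc_of_parent hw hz e

theorem sat_parF [Finite V] (hr : ∀ a, 5 ≤ T.leafCount a ↔ a = r) {p q : ℕ} {a : Fin p → V}
    {A : Fin q → Set V} {x y : Fin p} : (parF x y).Sat T a A ↔ E (a y) (a x) := by
  simp only [parF, Sat, h.sat_ancF hr, h.adj_iff]
  refine ⟨?_, fun hE => ⟨Or.inr hE, ReflTransGen.single hE⟩⟩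
  rintro ⟨hE | hE, h2⟩
  · exact absurd (TransGen.head' hE h2) (h.not_transGen_self _)
  · exact hE

theorem sat_nearF [Finite V] (hr : ∀ a, 5 ≤ T.leafCount a ↔ a = r) {p q : ℕ} {a : Fin p → V}
    {A : Fin q → Set V} {x y : Fin p} :
    (nearF x y).Sat T a A ↔ Near E T.leafCount (a x) (a y) := by
  simp only [nearF, Sat, h.sat_ancF hr, sat_geF_nil, Fin.cons_succ, Fin.cons_zero, Near, and_imp]

theorem sat_climbF [Finite V] (hr : ∀ a, 5 ≤ T.leafCount a ↔ a = r) {k p q : ℕ}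
    {a : Fin (p + 1) → V} {A : Fin (q + 1) → Set V} :
    (climbF k p q).Sat T a A ↔ ∀ b, UpN E k (a 0) b → b ∈ A 0 := by
  induction k generalizing p with
  | zero => simp [climbF, Sat, UpN]
  | succ k ih =>
    simp only [climbF, Sat, ih, h.sat_parF hr, UpN, Fin.cons_succ, Fin.cons_zero]
    exact ⟨fun H b ⟨c, hc, hb⟩ => H c hc b hb, fun H c hc b hb => H b ⟨c, hc, hb⟩⟩

theorem sat_closedF [Finite V] (hr : ∀ a, 5 ≤ T.leafCount a ↔ a = r) {M p q : ℕ}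
    {a : Fin p → V} {A : Fin (q + 1) → Set V} :
    (closedF M p q).Sat T a A ↔
      ∀ b c, TokenStep E T.leafCount M b c → b ∈ A 0 → c ∈ A 0 := by
  simp only [closedF, Sat, h.sat_climbF hr, h.sat_nearF hr, sat_geF_nil, Fin.cons_succ,
    Fin.cons_zero, TokenStep]
  constructor
  · rintro ⟨h1, h2⟩ b c (⟨h3, h4⟩ | ⟨h3, h4⟩) hb
    · exact h1 b ⟨hb, h3⟩ c h4
    · exact h2 b c ⟨hb, h3, h4⟩
  · exact fun H => ⟨fun b hb c hc => H b c (Or.inl ⟨hb.2, hc⟩) hb.1,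
      fun b c hb => H b c (Or.inr hb.2) hb.1⟩

/-- The set of all nodes that a token reaches is itself closed, hence lying in every closed set that
contains the start is the same as being reached. One set quantifier serves both tokens, because each
occurs in an implication of its own. -/
theorem sat_meetF [Finite V] (hr : ∀ a, 5 ≤ T.leafCount a ↔ a = r) {M p q : ℕ}
    {a : Fin p → V} {A : Fin q → Set V} {x y : Fin p} :
    (meetF M x y).Sat T a A ↔ ∃ b c, T.leafCount b = 3 ∧ Near E T.leafCount b c ∧
      ReflTransGen (TokenStep E T.leafCount M) (a x) b ∧
      ReflTransGen (TokenStep E T.leafCount M) (a y) c := by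
  simp only [meetF, Sat, h.sat_closedF hr, h.sat_nearF hr, sat_geF_nil, Fin.cons_succ,
    Fin.cons_zero]
  refine exists_congr fun b => exists_congr fun c => ?_
  have e : (3 ≤ T.leafCount b ∧ ¬ 4 ≤ T.leafCount b) ↔ T.leafCount b = 3 := by omega
  rw [e]
  refine and_congr_right fun _ => and_congr_right fun _ => ?_
  have clos : ∀ {S : Set V}, (∀ b c, TokenStep E T.leafCount M b c → b ∈ S → c ∈ S) →
      ∀ {u v}, ReflTransGen (TokenStep E T.leafCount M) u v → u ∈ S → v ∈ S := by
    intro S hS u v huv hu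
    induction huv with
    | refl => exact hu
    | tail _ hbc ih => exact hS _ _ hbc ih
  constructor
  · intro H
    exact ⟨(H {z | ReflTransGen (TokenStep E T.leafCount M) (a x) z}
        fun b c hbc hb => ReflTransGen.tail hb hbc).1 ReflTransGen.refl,
      (H {z | ReflTransGen (TokenStep E T.leafCount M) (a y) z}
        fun b c hbc hb => ReflTransGen.tail hb hbc).2 ReflTransGen.refl⟩
  · exact fun H S hS => ⟨clos hS H.1, clos hS H.2⟩

/-- The two additional variables hold `x` and `y` in either order. Thus one copy of `meetF`, always
with the same indices, covers both orientations of an edge. -/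
theorem sat_etaF [Finite V] (hr : ∀ a, 5 ≤ T.leafCount a ↔ a = r) {M p q : ℕ}
    {a : Fin p → V} {A : Fin q → Set V} {x y : Fin p} :
    (etaF M x y).Sat T a A ↔ a x ≠ a y ∧ ∃ b c, T.leafCount b = 3 ∧ Near E T.leafCount b c ∧
      ((ReflTransGen (TokenStep E T.leafCount M) (a x) b ∧
        ReflTransGen (TokenStep E T.leafCount M) (a y) c) ∨
      (ReflTransGen (TokenStep E T.leafCount M) (a y) b ∧
        ReflTransGen (TokenStep E T.leafCount M) (a x) c)) := by
  simp only [etaF, Sat, h.sat_meetF hr, Fin.cons_succ, Fin.cons_zero]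
  refine and_congr_right fun _ => ⟨?_, ?_⟩
  · rintro ⟨u, v, ⟨rfl, rfl⟩ | ⟨rfl, rfl⟩, b, c, h1, h2, h3, h4⟩
    · exact ⟨b, c, h1, h2, Or.inl ⟨h3, h4⟩⟩
    · exact ⟨b, c, h1, h2, Or.inr ⟨h3, h4⟩⟩
  · rintro ⟨b, c, h1, h2, h3 | h3⟩
    · exact ⟨_, _, Or.inl ⟨rfl, rfl⟩, b, c, h1, h2, h3⟩
    · exact ⟨_, _, Or.inr ⟨rfl, rfl⟩, b, c, h1, h2, h3⟩

theorem connected : T.Connected := by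
  have : Nonempty V := ⟨r⟩
  have : ∀ x, T.Reachable r x := by
    intro x
    induction h.anc_root x with
    | refl => exact SimpleGraph.Reachable.refl _
    | tail _ hbc ih =>
      exact ih.trans (SimpleGraph.Adj.reachable ((h.adj_iff _ _).2 (Or.inl hbc)))
  exact ⟨fun u v => (this u).symm.trans (this v)⟩

/-- A connected graph with fewer edges than vertices is a tree. Every edge joins some node other
than the root to its parent, so there are at most as many edges as such nodes. -/
theorem isTree [Finite V] : T.IsTree := by
  rw [SimpleGraph.isTree_iff_connected_and_card]
  refine ⟨h.connected, le_antisymm ?_ h.connected.card_vert_le_card_edgeSet_add_one⟩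
  choose! pa hpa using h.exists_parent
  have hsurj : Function.Surjective (fun w : {w : V // w ≠ r} =>
      (⟨s(pa w, w), (h.adj_iff _ _).2 (Or.inl (hpa w w.2))⟩ : T.edgeSet)) := by
    have key : ∀ u v, E u v → ∃ hv : v ≠ r, s(pa v, v) = s(u, v) := fun u v huv => by
      have hv : v ≠ r := fun e => h.not_parent_root u (e ▸ huv)
      exact ⟨hv, by rw [h.unique _ _ _ (hpa v hv) huv]⟩
    rintro ⟨e, he⟩
    induction e with
    | _ u v =>
      rcases (h.adj_iff _ _).1 he with huv | huv
      · obtain ⟨hv, e⟩ := key u v huv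
        exact ⟨⟨v, hv⟩, Subtype.ext e⟩
      · obtain ⟨hv, e⟩ := key v u huv
        exact ⟨⟨u, hv⟩, Subtype.ext (e.trans Sym2.eq_swap)⟩
  have h1 : Nat.card T.edgeSet ≤ _ := Nat.card_le_card_of_surjective _ hsurj
  have h2 : Nat.card {w : V // w ≠ r} + 1 = Nat.card V := by
    have := Set.ncard_add_ncard_compl ({r} : Set V)
    rw [Set.ncard_singleton] at this
    rw [← this, add_comm]
    rfl
  exact h2 ▸ Nat.succ_le_succ h1

/-- In a rooted tree whose root is not a leaf, the leaves are the nodes without children. -/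
theorem isLeaf_iff (hr : ¬ T.IsLeaf r) (x : V) : T.IsLeaf x ↔ ∀ w, ¬ E x w := by
  constructor
  · intro hx w hw
    have hxr : x ≠ r := fun e => hr (e ▸ hx)
    obtain ⟨p, hp⟩ := h.exists_parent x hxr
    have := hx p w ((h.adj_iff _ _).2 (Or.inr hp)) ((h.adj_iff _ _).2 (Or.inl hw))
    subst this
    exact h.not_transGen_self p ((TransGen.single hp).tail hw)
  · intro hx u v hu hv
    rcases (h.adj_iff _ _).1 hu with hu | hu
    · exact absurd hu (hx u)
    rcases (h.adj_iff _ _).1 hv with hv | hv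
    · exact absurd hv (hx v)
    exact h.unique _ _ _ hu hv

theorem leafCount_eq (hr : ¬ T.IsLeaf r) (x : V) :
    T.leafCount x = {l | E x l ∧ ∀ w, ¬ E l w}.ncard := by
  unfold SimpleGraph.leafCount
  congr 1
  ext l
  simp only [Set.mem_ofPred_eq, h.isLeaf_iff hr, h.adj_iff]
  exact ⟨fun ⟨h1, h2⟩ => ⟨h1.resolve_right (h2 x), h2⟩, fun ⟨h1, h2⟩ => ⟨Or.inl h1, h2⟩⟩

end IsRootedTree

open Relation

/-! ### ### Ancestors along chains -/

section Up

variable {V : Type*} {E : V → V → Prop}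

theorem UpN.anc {k : ℕ} {a b : V} (h : UpN E k a b) : ReflTransGen E b a := by
  induction k generalizing a with
  | zero => rw [show a = b from h]
  | succ k ih => obtain ⟨c, hc, h⟩ := h; exact (ih h).tail hc

theorem upN_add {s t : ℕ} {a b : V} : UpN E (s + t) a b ↔ ∃ c, UpN E s a c ∧ UpN E t c b := by
  induction s generalizing a with
  | zero => simp [UpN]
  | succ s ih =>
    rw [Nat.succ_add]
    simp only [UpN, ih]
    exact ⟨fun ⟨c, hc, d, h1, h2⟩ => ⟨d, ⟨c, hc, h1⟩, h2⟩, fun ⟨d, ⟨c, hc, h1⟩, h2⟩ => ⟨c, hc, d, h1, h2⟩⟩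

theorem upN_chain {e : ℕ → V} {m : ℕ} (he : ∀ s < m, E (e s) (e (s + 1))) {s t : ℕ}
    (hst : t + s ≤ m) : UpN E s (e (t + s)) (e t) := by
  induction s with
  | zero => rfl
  | succ s ih => exact ⟨e (t + s), he _ (by omega), ih (by omega)⟩

theorem anc_chain {e : ℕ → V} {m : ℕ} (he : ∀ s < m, E (e s) (e (s + 1))) {s t : ℕ}
    (hst : s ≤ t) (ht : t ≤ m) : ReflTransGen E (e s) (e t) := by
  obtain ⟨d, rfl⟩ := Nat.exists_eq_add_of_le hst
  exact (upN_chain he ht).anc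

theorem transGen_chain {e : ℕ → V} {m : ℕ} (he : ∀ s < m, E (e s) (e (s + 1))) {s t : ℕ}
    (hst : s < t) (ht : t ≤ m) : TransGen E (e s) (e t) :=
  TransGen.head' (he s (by omega)) (anc_chain he hst ht)

end Up

namespace IsRootedTree

variable {V : Type*} {T : SimpleGraph V} {E : V → V → Prop} {r : V} (h : IsRootedTree T E r)
include h

theorem upN_unique {k : ℕ} {a b c : V} (hb : UpN E k a b) (hc : UpN E k a c) : b = c := by
  induction k generalizing a with
  | zero => exact (show a = b from hb).symm.trans hc
  | succ k ih =>
    obtain ⟨x, hx, hb⟩ := hb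
    obtain ⟨y, hy, hc⟩ := hc
    rw [h.unique y x a hy hx] at hc
    exact ih hb hc

theorem chain_injective {e : ℕ → V} {m : ℕ} (he : ∀ s < m, E (e s) (e (s + 1))) {s t : ℕ}
    (hs : s ≤ m) (ht : t ≤ m) (hst : e s = e t) : s = t := by
  rcases lt_trichotomy s t with hlt | heq | hlt
  · exact absurd (hst ▸ transGen_chain he hlt ht) (h.not_transGen_self _)
  · exact heq
  · exact absurd (hst ▸ transGen_chain he hlt hs) (h.not_transGen_self _)

/-- By uniqueness of parents, the climb must pass through the top of the chain. This is how a token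
is handed from one gadget to what lies above it. -/
theorem upN_chain_iff {e : ℕ → V} {m : ℕ} (he : ∀ s < m, E (e s) (e (s + 1))) {s t : ℕ}
    (hs : s ≤ m) {b : V} : UpN E (s + t) (e s) b ↔ UpN E t (e 0) b := by
  have h0 : UpN E s (e s) (e 0) := by
    have := upN_chain he (s := s) (t := 0) (by omega)
    rwa [Nat.zero_add] at this
  rw [upN_add]
  exact ⟨fun ⟨c, hc, hb⟩ => h.upN_unique hc h0 ▸ hb, fun hb => ⟨_, h0, hb⟩⟩

theorem anc_of_anc_chain {e : ℕ → V} {m : ℕ} (he : ∀ s < m, E (e s) (e (s + 1))) {s : ℕ}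
    (hs : s ≤ m) {y : V} (hy : ReflTransGen E y (e s)) :
    (∃ t, 1 ≤ t ∧ t ≤ s ∧ y = e t) ∨ ReflTransGen E y (e 0) := by
  induction s with
  | zero => exact Or.inr hy
  | succ s ih =>
    by_cases hne : e (s + 1) = y
    · exact Or.inl ⟨s + 1, by omega, le_rfl, hne.symm⟩
    · rcases ih (by omega) (h.anc_of_anc_of_parent (he s (by omega)) hy hne) with ⟨t, h1, h2, h3⟩ | h4
      · exact Or.inl ⟨t, h1, by omega, h3⟩
      · exact Or.inr h4

theorem near_unique {lc : V → ℕ} {a b c : V} (hb : Near E lc a b) (hc : Near E lc a c) : b = c :=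
  h.anc_antisymm (hc.2.2.2 b hb.1 hb.2.1 hb.2.2.1) (hb.2.2.2 c hc.1 hc.2.1 hc.2.2.1)

end IsRootedTree

/-- Tokens move only towards the root; this keeps the tokens of different branches apart. -/
theorem TokenStep.anc {V : Type*} {E : V → V → Prop} {lc : V → ℕ} {M : ℕ} {a b : V}
    (h : ReflTransGen (TokenStep E lc M) a b) : ReflTransGen E b a := by
  induction h with
  | refl => exact ReflTransGen.refl
  | tail _ hbc ih =>
    rcases hbc with ⟨_, h⟩ | ⟨_, h⟩
    · exact h.anc.trans ih
    · exact h.2.2.1.trans ih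

/-! ### ### Gadgets, represented expressions and the paths of tokens -/

/-- The nodes `e 1, …, e (2 (γ + 1))` form a path below `e 0` that carries the marks of a gadget
for the labels `i` and `j`: two leaves at the upper and `m` leaves at the lower marked node. -/
structure IsGadget {V : Type*} (E : V → V → Prop) (lc : V → ℕ) (γ : ℕ) (e : ℕ → V)
    (i j m : ℕ) : Prop where
  chain : ∀ s < 2 * (γ + 1), E (e s) (e (s + 1))
  count : ∀ s, 1 ≤ s → s ≤ 2 * (γ + 1) →
    lc (e s) = if s = j + 2 then 2 else if s = γ + i + 3 then m else 0

/-- The nodes `e 1, …, e m`. -/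
def pathNodes {V : Type*} (e : ℕ → V) (m : ℕ) : Set V := {x | ∃ s, 1 ≤ s ∧ s ≤ m ∧ x = e s}

/-- The expression is represented below the node `c` by the nodes in `D` (and by the leaves that
mark them). -/
def Represents {V U : Type*} {γ : ℕ} (E : V → V → Prop) (lc : V → ℕ) (ι : U → V) :
    CWExpr γ U → V → Set V → Prop
  | .vertex v i, c, D => ∃ e : ℕ → V, e 0 = c ∧ e (i + 2) = ι v ∧
      (∀ s < (i : ℕ) + 2, E (e s) (e (s + 1))) ∧
      (∀ s, 1 ≤ s → s ≤ (i : ℕ) + 2 → lc (e s) ≤ 1) ∧ D = pathNodes e (i + 2)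
  | .union Γ Δ, c, D => ∃ D₁ D₂, Represents E lc ι Γ c D₁ ∧ Represents E lc ι Δ c D₂ ∧
      Disjoint D₁ D₂ ∧ D = D₁ ∪ D₂
  | .join i j Γ, c, D => ∃ (e : ℕ → V) (D' : Set V), e 0 = c ∧ IsGadget E lc γ e i j 3 ∧
      Represents E lc ι Γ (e (2 * (γ + 1))) D' ∧ D = pathNodes e (2 * (γ + 1)) ∪ D'
  | .relabel i j Γ, c, D => ∃ (e : ℕ → V) (D' : Set V), e 0 = c ∧ IsGadget E lc γ e i j 4 ∧
      Represents E lc ι Γ (e (2 * (γ + 1))) D' ∧ D = pathNodes e (2 * (γ + 1)) ∪ D'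

/-- The tokens of the vertices of an expression represented below `c` by `D` behave correctly. -/
structure Tracks {V U : Type*} {γ : ℕ} (E : V → V → Prop) (lc : V → ℕ) (ι : U → V)
    (Γ : CWExpr γ U) (c : V) (D : Set V) : Prop where
  desc : ∀ x ∈ D, TransGen E c x
  fwd : ∀ v l, Γ.HasLabel v l → ∀ b, UpN E (γ - 1 - l) c b →
    ReflTransGen (TokenStep E lc (γ + 1)) (ι v) b
  bwd : ∀ v l, Γ.HasLabel v l → ∀ a, ReflTransGen (TokenStep E lc (γ + 1)) (ι v) a →
    a ∈ D ∨ ∃ b, UpN E (γ - 1 - l) c b ∧ ReflTransGen (TokenStep E lc (γ + 1)) b a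
  adj : ∀ u ∈ Γ.verts, ∀ v ∈ Γ.verts, (Γ.Adj u v ↔ u ≠ v ∧ ∃ a ∈ D, ∃ b, lc a = 3 ∧ Near E lc a b ∧
    ((ReflTransGen (TokenStep E lc (γ + 1)) (ι u) a ∧
        ReflTransGen (TokenStep E lc (γ + 1)) (ι v) b) ∨
      (ReflTransGen (TokenStep E lc (γ + 1)) (ι v) a ∧
        ReflTransGen (TokenStep E lc (γ + 1)) (ι u) b)))
  near_mem : ∀ a ∈ D, 3 ≤ lc a → ∀ b, Near E lc a b → b ∈ D

namespace CWExpr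

variable {γ : ℕ} {U : Type*}

theorem exists_hasLabel (Γ : CWExpr γ U) {v : U} (hv : v ∈ Γ.verts) : ∃ l, Γ.HasLabel v l := by
  induction Γ with
  | vertex w i => exact ⟨i, hv, rfl⟩
  | union Γ Δ ih1 ih2 =>
    rcases hv with hv | hv
    · exact (ih1 hv).imp fun _ => Or.inl
    · exact (ih2 hv).imp fun _ => Or.inr
  | join i j Γ ih => exact ih hv
  | relabel i j Γ ih => obtain ⟨l, hl⟩ := ih hv; exact ⟨_, l, hl, rfl⟩

theorem HasLabel.mem_verts {Γ : CWExpr γ U} {v : U} {l : Fin γ} (h : Γ.HasLabel v l) :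
    v ∈ Γ.verts := by
  induction Γ generalizing l with
  | vertex w i => exact h.1
  | union Γ Δ ih1 ih2 => exact h.imp ih1 ih2
  | join i j Γ ih => exact ih h
  | relabel i j Γ ih => obtain ⟨l', hl, _⟩ := h; exact ih hl

theorem Adj.mem_verts {Γ : CWExpr γ U} {u v : U} (h : Γ.Adj u v) :
    u ∈ Γ.verts ∧ v ∈ Γ.verts := by
  induction Γ with
  | vertex w i => exact h.elim
  | union Γ Δ ih1 ih2 =>
    rcases h with h | h
    · exact ⟨Or.inl (ih1 h).1, Or.inl (ih1 h).2⟩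
    · exact ⟨Or.inr (ih2 h).1, Or.inr (ih2 h).2⟩
  | join i j Γ ih =>
    rcases h with h | ⟨_, h | h⟩
    · exact ih h
    · exact ⟨h.1.mem_verts, h.2.mem_verts⟩
    · exact ⟨h.1.mem_verts, h.2.mem_verts⟩
  | relabel i j Γ ih => exact ih h

end CWExpr

namespace IsGadget

variable {V : Type*} {T : SimpleGraph V} {E : V → V → Prop} {r : V} {lc : V → ℕ} {γ : ℕ}
  {e : ℕ → V} {i j m : ℕ} (hg : IsGadget E lc γ e i j m) (h : IsRootedTree T E r)
include hg h

/-- The two marks are the only nodes of the gadget with at least two leaves, and the mark for `j`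
lies in the upper block, hence above the mark for `i`, even if `i < j`. -/
theorem near_iff (hi : i < γ) (hj : j < γ) {b : V} :
    Near E lc (e (γ + i + 3)) b ↔ b = e (j + 2) := by
  have key : Near E lc (e (γ + i + 3)) (e (j + 2)) := by
    refine ⟨?_, ?_, anc_chain hg.chain (by omega) (by omega), ?_⟩
    · rw [hg.count _ (by omega) (by omega)]; simp
    · intro e'
      have := h.chain_injective hg.chain (by omega) (by omega) e'
      omega
    · intro c hc hne hanc
      rcases h.anc_of_anc_chain hg.chain (by omega) hanc with ⟨t, h1, h2, rfl⟩ | h4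
      -- A marked ancestor on the path is one of the two marks, and it is not the starting node.
      · rw [hg.count _ h1 (by omega)] at hc
        split_ifs at hc with h5 h6
        · rw [h5]
        · exact absurd (by rw [h6]) hne
        · omega
      · exact h4.trans (anc_chain hg.chain (by omega) (by omega))
  exact ⟨fun hb => h.near_unique hb key, fun hb => hb ▸ key⟩

/-- Three leaves are below the threshold for a jump, so the mark of a join does not divert tokens.
In a relabeling gadget only the label `i` is diverted. -/
theorem step_lower {l : ℕ} (hl : l < γ) (hj : j < γ) (hm : l ≠ i ∨ m ≤ 3) {b : V} :
    TokenStep E lc (γ + 1) (e (γ + l + 3)) b ↔ b = e (l + 2) := by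
  have hlc : ¬ 4 ≤ lc (e (γ + l + 3)) := by
    rw [hg.count _ (by omega) (by omega)]
    split_ifs <;> omega
  have hup := upN_chain hg.chain (s := γ + 1) (t := l + 2) (by omega)
  rw [show l + 2 + (γ + 1) = γ + l + 3 by omega] at hup
  constructor
  · rintro (⟨_, h1⟩ | ⟨h1, _⟩)
    · exact h.upN_unique h1 hup
    · exact absurd h1 hlc
  · rintro rfl
    exact Or.inl ⟨hlc, hup⟩

/-- Of the `γ + 1` nodes of a stride, `l + 2` are spent inside the gadget, and the remaining `γ - 1
- l` lead upwards from `e 0`. The upper block has no node with four leaves. -/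
theorem step_upper {l : ℕ} (hl : l < γ) {b : V} :
    TokenStep E lc (γ + 1) (e (l + 2)) b ↔ UpN E (γ - 1 - l) (e 0) b := by
  have hlc : ¬ 4 ≤ lc (e (l + 2)) := by
    rw [hg.count _ (by omega) (by omega)]
    split_ifs <;> omega
  rw [← h.upN_chain_iff hg.chain (s := l + 2) (by omega),
    show l + 2 + (γ - 1 - l) = γ + 1 by omega]
  exact ⟨fun h1 => (h1.resolve_right fun h2 => hlc h2.1).2, fun h1 => Or.inl ⟨hlc, h1⟩⟩

theorem step_relabel (hi : i < γ) (hj : j < γ) (hm : 4 ≤ m) {b : V} :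
    TokenStep E lc (γ + 1) (e (γ + i + 3)) b ↔ b = e (j + 2) := by
  have hlc : 4 ≤ lc (e (γ + i + 3)) := by
    rw [hg.count _ (by omega) (by omega), if_neg (by omega), if_pos rfl]
    exact hm
  rw [← hg.near_iff h hi hj]
  exact ⟨fun h1 => (h1.resolve_left fun h2 => h2.1 hlc).2, fun h1 => Or.inr ⟨hlc, h1⟩⟩

variable {U : Type*} {ι : U → V} {Γ : CWExpr γ U} {D : Set V}
  (ht : Tracks E lc ι Γ (e (2 * (γ + 1))) D)
include ht

omit ht in
-- A token that arrives from below with label `l` lands on the lower node of `l`: the offset `γ - 1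
-- - l` is counted from the last node of the lower block.
theorem upN_bottom {l : ℕ} (hl : l < γ) {b : V} :
    UpN E (γ - 1 - l) (e (2 * (γ + 1))) b ↔ b = e (γ + l + 3) := by
  have hup := upN_chain hg.chain (s := γ - 1 - l) (t := γ + l + 3) (by omega)
  rw [show γ + l + 3 + (γ - 1 - l) = 2 * (γ + 1) by omega] at hup
  exact ⟨fun hb => h.upN_unique hb hup, fun hb => hb ▸ hup⟩

/-- Here `l'` is the label after the operation. The hypothesis `hs` isolates the only respect in
which tokens behave differently in a join and in a relabeling gadget. -/
theorem fwd {v : U} {l : Fin γ} {l' : ℕ} (hl' : l' < γ) (hv : Γ.HasLabel v l)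
    (hs : ∀ b, TokenStep E lc (γ + 1) (e (γ + l + 3)) b ↔ b = e (l' + 2)) {b : V} :
    ReflTransGen (TokenStep E lc (γ + 1)) (ι v) (e (γ + l + 3)) ∧
    ReflTransGen (TokenStep E lc (γ + 1)) (ι v) (e (l' + 2)) ∧
    (UpN E (γ - 1 - l') (e 0) b → ReflTransGen (TokenStep E lc (γ + 1)) (ι v) b) := by
  have h1 := ht.fwd v l hv _ ((hg.upN_bottom h l.2).2 rfl)
  have h2 := h1.tail ((hs _).2 rfl)
  exact ⟨h1, h2, fun hb => h2.tail ((hg.step_upper h hl').2 hb)⟩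

theorem bwd {v : U} {l : Fin γ} {l' : ℕ} (hl' : l' < γ) (hv : Γ.HasLabel v l)
    (hs : ∀ b, TokenStep E lc (γ + 1) (e (γ + l + 3)) b ↔ b = e (l' + 2)) {a : V}
    (ha : ReflTransGen (TokenStep E lc (γ + 1)) (ι v) a) :
    a ∈ D ∨ a = e (γ + l + 3) ∨ a = e (l' + 2) ∨
      ∃ b, UpN E (γ - 1 - l') (e 0) b ∧ ReflTransGen (TokenStep E lc (γ + 1)) b a := by
  rcases ht.bwd v l hv a ha with h1 | ⟨b, hb, hba⟩
  · exact Or.inl h1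
  rw [hg.upN_bottom h l.2] at hb
  subst hb
  rcases hba.cases_head with h1 | ⟨c, hc, hca⟩
  · exact Or.inr (Or.inl h1.symm)
  rw [hs] at hc
  subst hc
  rcases hca.cases_head with h1 | ⟨d, hd, hda⟩
  · exact Or.inr (Or.inr (Or.inl h1.symm))
  exact Or.inr (Or.inr (Or.inr ⟨d, (hg.step_upper h hl').1 hd, hda⟩))

omit h in
theorem desc {x : V} (hx : x ∈ pathNodes e (2 * (γ + 1)) ∪ D) : TransGen E (e 0) x := by
  rcases hx with ⟨s, h1, h2, rfl⟩ | hx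
  · exact transGen_chain hg.chain h1 h2
  · exact (transGen_chain hg.chain (by omega) le_rfl).trans (ht.desc x hx)

theorem not_mem {s : ℕ} (hs : s ≤ 2 * (γ + 1)) : e s ∉ D := fun hx =>
  h.not_transGen_self _ ((ht.desc _ hx).trans_left (anc_chain hg.chain hs le_rfl))

/-- Inside a gadget a token visits only the node of its old label and that of its new label: `D`
lies strictly below the gadget, and after the second visit the token is at `e 0` or above. -/
theorem eq_of_reaches {v : U} {l : Fin γ} {l' : ℕ} (hl' : l' < γ) (hv : Γ.HasLabel v l)
    (hs : ∀ b, TokenStep E lc (γ + 1) (e (γ + l + 3)) b ↔ b = e (l' + 2)) {s : ℕ} (h1 : 1 ≤ s)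
    (h2 : s ≤ 2 * (γ + 1)) (ha : ReflTransGen (TokenStep E lc (γ + 1)) (ι v) (e s)) :
    s = γ + l + 3 ∨ s = l' + 2 := by
  rcases hg.bwd h ht hl' hv hs ha with h3 | h3 | h3 | ⟨b, hb, hba⟩
  · exact absurd h3 (hg.not_mem h ht h2)
  · exact Or.inl (h.chain_injective hg.chain h2 (by omega) h3)
  · exact Or.inr (h.chain_injective hg.chain h2 (by omega) h3)
  · exact absurd ((transGen_chain hg.chain h1 h2).trans_left ((TokenStep.anc hba).trans hb.anc))
      (h.not_transGen_self _)

theorem near_mem (hi : i < γ) (hj : j < γ) {a : V}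
    (ha : a ∈ pathNodes e (2 * (γ + 1)) ∪ D) (hlc : 3 ≤ lc a) {b : V} (hb : Near E lc a b) :
    b ∈ pathNodes e (2 * (γ + 1)) ∪ D := by
  rcases ha with ⟨s, h1, h2, rfl⟩ | ha
  · rw [hg.count s h1 h2] at hlc
    split_ifs at hlc with h3 h4
    · omega
    · rw [h4, hg.near_iff h hi hj] at hb
      exact Or.inl ⟨j + 2, by omega, by omega, hb⟩
    · omega
  · exact Or.inr (ht.near_mem a ha hlc b hb)

end IsGadget

namespace Tracks

variable {V U : Type*} {T : SimpleGraph V} {E : V → V → Prop} {r : V} {lc : V → ℕ} {γ : ℕ}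
  {ι : U → V} (h : IsRootedTree T E r)
include h

/-- The token of a vertex of `Δ` stays in `D₂` or is at `c` or above, and `D₁` is disjoint from
both. -/
theorem mem_verts_of_union {Γ Δ : CWExpr γ U} {c : V} {D₁ D₂ : Set V} (h1 : Tracks E lc ι Γ c D₁)
    (h2 : Tracks E lc ι Δ c D₂) (hD : Disjoint D₁ D₂) {v : U} (hv : v ∈ Γ.verts ∪ Δ.verts) {a : V}
    (ha : ReflTransGen (TokenStep E lc (γ + 1)) (ι v) a) (haD : a ∈ D₁) : v ∈ Γ.verts := by
  rcases hv with hv | hv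
  · exact hv
  obtain ⟨l, hl⟩ := Δ.exists_hasLabel hv
  rcases h2.bwd v l hl a ha with h3 | ⟨b, hb, hba⟩
  · exact absurd h3 (Set.disjoint_left.1 hD haD)
  · exact absurd ((h1.desc a haD).trans_left ((TokenStep.anc hba).trans hb.anc))
      (h.not_transGen_self _)

theorem vertex {v : U} {i : Fin γ} {c : V} {D : Set V}
    (hR : Represents E lc ι (.vertex v i) c D) : Tracks E lc ι (.vertex v i) c D := by
  obtain ⟨e, rfl, hv, he, hlc, rfl⟩ := hR
  have hstep : ∀ b, TokenStep E lc (γ + 1) (ι v) b ↔ UpN E (γ - 1 - i) (e 0) b := by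
    intro b
    -- A vertex at depth `i + 2` is placed like the upper node of label `i` in a gadget.
    rw [← h.upN_chain_iff he le_rfl, hv, show (i : ℕ) + 2 + (γ - 1 - i) = γ + 1 by omega]
    have : ¬ 4 ≤ lc (ι v) := by
      have := hlc (i + 2) (by omega) le_rfl
      rw [hv] at this
      omega
    exact ⟨fun h1 => (h1.resolve_right fun h2 => this h2.1).2, fun h1 => Or.inl ⟨this, h1⟩⟩
  refine ⟨?_, ?_, ?_, ?_, ?_⟩
  · rintro x ⟨s, h1, h2, rfl⟩
    exact transGen_chain he h1 h2
  · rintro _ _ ⟨rfl, rfl⟩ b hb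
    exact ReflTransGen.single ((hstep b).2 hb)
  · rintro _ _ ⟨rfl, rfl⟩ a ha
    rcases ha.cases_head with h1 | ⟨b, hb, hba⟩
    · exact Or.inl ⟨_, by omega, le_rfl, h1.symm.trans hv.symm⟩
    · exact Or.inr ⟨b, (hstep b).1 hb, hba⟩
  · rintro u hu w hw
    exact ⟨False.elim, fun h1 => h1.1 (hu.trans hw.symm)⟩
  · rintro a ⟨s, h1, h2, rfl⟩ h3
    have := hlc s h1 h2
    omega

theorem union {Γ Δ : CWExpr γ U} {c : V} {D₁ D₂ : Set V}
    (h1 : Tracks E lc ι Γ c D₁) (h2 : Tracks E lc ι Δ c D₂) (hD : Disjoint D₁ D₂) :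
    Tracks E lc ι (.union Γ Δ) c (D₁ ∪ D₂) := by
  refine ⟨?_, ?_, ?_, ?_, ?_⟩
  · rintro x (hx | hx)
    · exact h1.desc x hx
    · exact h2.desc x hx
  · rintro v l (hv | hv)
    · exact h1.fwd v l hv
    · exact h2.fwd v l hv
  · rintro v l (hv | hv) a ha
    · exact (h1.bwd v l hv a ha).imp_left Or.inl
    · exact (h2.bwd v l hv a ha).imp_left Or.inr
  · intro u hu v hv
    constructor
    · rintro (hA | hA)
      · obtain ⟨h3, a, ha, h4⟩ := (h1.adj u hA.mem_verts.1 v hA.mem_verts.2).1 hA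
        exact ⟨h3, a, Or.inl ha, h4⟩
      · obtain ⟨h3, a, ha, h4⟩ := (h2.adj u hA.mem_verts.1 v hA.mem_verts.2).1 hA
        exact ⟨h3, a, Or.inr ha, h4⟩
    · rintro ⟨hne, a, ha | ha, b, h3, h4, h5⟩
      -- Both meeting points belong to the same side, hence so do both vertices.
      · have hb := h1.near_mem a ha h3.ge b h4
        have huv : u ∈ Γ.verts ∧ v ∈ Γ.verts := by
          rcases h5 with ⟨h5, h6⟩ | ⟨h5, h6⟩
          · exact ⟨mem_verts_of_union h h1 h2 hD hu h5 ha, mem_verts_of_union h h1 h2 hD hv h6 hb⟩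
          · exact ⟨mem_verts_of_union h h1 h2 hD hu h6 hb, mem_verts_of_union h h1 h2 hD hv h5 ha⟩
        exact Or.inl ((h1.adj u huv.1 v huv.2).2 ⟨hne, a, ha, b, h3, h4, h5⟩)
      · have hb := h2.near_mem a ha h3.ge b h4
        have huv : u ∈ Δ.verts ∧ v ∈ Δ.verts := by
          rcases h5 with ⟨h5, h6⟩ | ⟨h5, h6⟩
          · exact ⟨mem_verts_of_union h h2 h1 hD.symm hu.symm h5 ha,
              mem_verts_of_union h h2 h1 hD.symm hv.symm h6 hb⟩
          · exact ⟨mem_verts_of_union h h2 h1 hD.symm hu.symm h6 hb,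
              mem_verts_of_union h h2 h1 hD.symm hv.symm h5 ha⟩
        exact Or.inr ((h2.adj u huv.1 v huv.2).2 ⟨hne, a, ha, b, h3, h4, h5⟩)
  · rintro a (ha | ha) h3 b hb
    · exact Or.inl (h1.near_mem a ha h3 b hb)
    · exact Or.inr (h2.near_mem a ha h3 b hb)

theorem join {Γ : CWExpr γ U} {i j : Fin γ} {e : ℕ → V} {D : Set V}
    (hg : IsGadget E lc γ e i j 3) (ht : Tracks E lc ι Γ (e (2 * (γ + 1))) D) :
    Tracks E lc ι (.join i j Γ) (e 0) (pathNodes e (2 * (γ + 1)) ∪ D) := by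
  have hs : ∀ (l : Fin γ) b, TokenStep E lc (γ + 1) (e (γ + l + 3)) b ↔ b = e (l + 2) :=
    fun l b => hg.step_lower h l.2 j.2 (Or.inr le_rfl)
  -- A meeting in this gadget reveals the labels: the node with three leaves must be the lower node
  -- of `i`, and its partner is the upper node of `j`.
  have hlab : ∀ {u v : U}, u ∈ Γ.verts → v ∈ Γ.verts → ∀ {s : ℕ}, 1 ≤ s → s ≤ 2 * (γ + 1) →
      lc (e s) = 3 → ∀ {b : V}, Near E lc (e s) b →
      ReflTransGen (TokenStep E lc (γ + 1)) (ι u) (e s) →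
      ReflTransGen (TokenStep E lc (γ + 1)) (ι v) b → Γ.HasLabel u i ∧ Γ.HasLabel v j := by
    intro u v hu hv s h1 h2 h3 b hb hua hvb
    rw [hg.count s h1 h2] at h3
    have h5 : s = γ + i + 3 := by split_ifs at h3 <;> omega
    subst h5
    rw [hg.near_iff h i.2 j.2] at hb
    subst hb
    obtain ⟨lu, hlu⟩ := Γ.exists_hasLabel hu
    obtain ⟨lv, hlv⟩ := Γ.exists_hasLabel hv
    have e1 : lu = i := by
      rcases hg.eq_of_reaches h ht lu.2 hlu (hs lu) h1 h2 hua with h6 | h6 <;> omega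
    have e2 : lv = j := by
      rcases hg.eq_of_reaches h ht lv.2 hlv (hs lv) (by omega) (by omega) hvb with h6 | h6 <;> omega
    exact ⟨e1 ▸ hlu, e2 ▸ hlv⟩
  have hreach : ∀ {u v : U}, Γ.HasLabel u i → Γ.HasLabel v j →
      ReflTransGen (TokenStep E lc (γ + 1)) (ι u) (e (γ + i + 3)) ∧
      ReflTransGen (TokenStep E lc (γ + 1)) (ι v) (e (j + 2)) := fun hu hv =>
    -- The value of `b` is a dummy; it occurs only in the component of `fwd` that is dropped.
    ⟨(hg.fwd h ht (b := r) i.2 hu (hs i)).1, (hg.fwd h ht (b := r) j.2 hv (hs j)).2.1⟩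
  have hmark : lc (e (γ + i + 3)) = 3 := by
    rw [hg.count _ (by omega) (by omega), if_neg (by omega), if_pos rfl]
  have hmem : e (γ + i + 3) ∈ pathNodes e (2 * (γ + 1)) ∪ D :=
    Or.inl ⟨_, by omega, by omega, rfl⟩
  refine ⟨fun x hx => hg.desc ht hx, fun v l hl b => (hg.fwd h ht l.2 hl (hs l)).2.2, ?_, ?_,
    fun a ha h3 b hb => hg.near_mem h ht i.2 j.2 ha h3 hb⟩
  · intro v l hl a ha
    rcases hg.bwd h ht l.2 hl (hs l) ha with h1 | h1 | h1 | h1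
    · exact Or.inl (Or.inr h1)
    · exact Or.inl (Or.inl ⟨_, by omega, by omega, h1⟩)
    · exact Or.inl (Or.inl ⟨_, by omega, by omega, h1⟩)
    · exact Or.inr h1
  · intro u hu v hv
    constructor
    · rintro (hA | ⟨hne, ⟨hA, hB⟩ | ⟨hA, hB⟩⟩)
      · obtain ⟨h3, a, ha, h4⟩ := (ht.adj u hA.mem_verts.1 v hA.mem_verts.2).1 hA
        exact ⟨h3, a, Or.inr ha, h4⟩
      · exact ⟨hne, _, hmem, _, hmark, (hg.near_iff h i.2 j.2).2 rfl,
          Or.inl (hreach hA hB)⟩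
      · exact ⟨hne, _, hmem, _, hmark, (hg.near_iff h i.2 j.2).2 rfl,
          Or.inr (hreach hB hA)⟩
    · rintro ⟨hne, a, ⟨s, h1, h2, rfl⟩ | ha, b, h3, h4, h5⟩
      · rcases h5 with ⟨h5, h6⟩ | ⟨h5, h6⟩
        · exact Or.inr ⟨hne, Or.inl (hlab hu hv h1 h2 h3 h4 h5 h6)⟩
        · exact Or.inr ⟨hne, Or.inr (hlab hv hu h1 h2 h3 h4 h5 h6).symm⟩
      · exact Or.inl ((ht.adj u hu v hv).2 ⟨hne, a, ha, b, h3, h4, h5⟩)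

theorem relabel {Γ : CWExpr γ U} {i j : Fin γ} {e : ℕ → V} {D : Set V}
    (hg : IsGadget E lc γ e i j 4) (ht : Tracks E lc ι Γ (e (2 * (γ + 1))) D) :
    Tracks E lc ι (.relabel i j Γ) (e 0) (pathNodes e (2 * (γ + 1)) ∪ D) := by
  have hs : ∀ (l : Fin γ) b, TokenStep E lc (γ + 1) (e (γ + l + 3)) b ↔
      b = e ((if l = i then j else l : Fin γ) + 2) := by
    intro l b
    split_ifs with hl
    · rw [hl]
      exact hg.step_relabel h i.2 j.2 le_rfl
    · exact hg.step_lower h l.2 j.2 (Or.inl fun e' => hl (Fin.ext e'))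
  refine ⟨fun x hx => hg.desc ht hx, ?_, ?_, ?_,
    fun a ha h3 b hb => hg.near_mem h ht i.2 j.2 ha h3 hb⟩
  · rintro v _ ⟨l, hl, rfl⟩ b
    exact (hg.fwd h ht (Fin.is_lt _) hl (hs l)).2.2
  · rintro v _ ⟨l, hl, rfl⟩ a ha
    rcases hg.bwd h ht (Fin.is_lt _) hl (hs l) ha with h1 | h1 | h1 | h1
    · exact Or.inl (Or.inr h1)
    · exact Or.inl (Or.inl ⟨_, by omega, by omega, h1⟩)
    · exact Or.inl (Or.inl ⟨_, by omega, by omega, h1⟩)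
    · exact Or.inr h1
  · intro u hu v hv
    refine (ht.adj u hu v hv).trans (and_congr_right fun _ => ⟨?_, ?_⟩)
    · rintro ⟨a, ha, h1⟩
      exact ⟨a, Or.inr ha, h1⟩
    · rintro ⟨a, ⟨s, h1, h2, rfl⟩ | ha, b, h3, h4⟩
      -- A relabeling gadget has no node with exactly three leaves, so it creates no adjacency.
      · rw [hg.count s h1 h2] at h3
        split_ifs at h3 <;> omega
      · exact ⟨a, ha, b, h3, h4⟩

theorem of_represents {Γ : CWExpr γ U} {c : V} {D : Set V}
    (hR : Represents E lc ι Γ c D) : Tracks E lc ι Γ c D := by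
  induction Γ generalizing c D with
  | vertex v i => exact vertex h hR
  | union Γ Δ ih1 ih2 =>
    obtain ⟨D₁, D₂, h1, h2, hD, rfl⟩ := hR
    exact union h (ih1 h1) (ih2 h2) hD
  | join i j Γ ih =>
    obtain ⟨e, D', rfl, hg, h1, rfl⟩ := hR
    exact join h hg (ih h1)
  | relabel i j Γ ih =>
    obtain ⟨e, D', rfl, hg, h1, rfl⟩ := hR
    exact relabel h hg (ih h1)

end Tracks

/-- In the tree that represents an expression below its root, tokens detect the adjacency. -/
theorem Represents.adj_iff {V U : Type*} {T : SimpleGraph V} {E : V → V → Prop} {r : V}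
    {lc : V → ℕ} {γ : ℕ} {ι : U → V} (h : IsRootedTree T E r) {Γ : CWExpr γ U}
    {D : Set V} (hR : Represents E lc ι Γ r D) {u v : U} (hu : u ∈ Γ.verts)
    (hv : v ∈ Γ.verts) :
    Γ.Adj u v ↔ u ≠ v ∧ ∃ a b, lc a = 3 ∧ Near E lc a b ∧
    ((ReflTransGen (TokenStep E lc (γ + 1)) (ι u) a ∧
        ReflTransGen (TokenStep E lc (γ + 1)) (ι v) b) ∨
      (ReflTransGen (TokenStep E lc (γ + 1)) (ι v) a ∧
        ReflTransGen (TokenStep E lc (γ + 1)) (ι u) b)) := by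
  have ht := Tracks.of_represents h hR
  rw [ht.adj u hu v hv]
  refine and_congr_right fun _ => ⟨fun ⟨a, _, b, h1⟩ => ⟨a, b, h1⟩, ?_⟩
  rintro ⟨a, b, h1, h2, h3⟩
  refine ⟨a, ?_, b, h1, h2, h3⟩
  have key : ∀ w ∈ Γ.verts, ReflTransGen (TokenStep E lc (γ + 1)) (ι w) a → a ∈ D := by
    intro w hw hwa
    obtain ⟨l, hl⟩ := Γ.exists_hasLabel hw
    refine (ht.bwd w l hl a hwa).resolve_right ?_
    rintro ⟨c, hc, hca⟩
    -- The expression hangs from the root, so a meeting point outside `D` would be the root itself,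
    -- which has no proper ancestor to serve as partner.
    have ha : a = r := h.anc_antisymm ((TokenStep.anc hca).trans hc.anc) (h.anc_root a)
    subst ha
    exact h2.2.1 (h.anc_antisymm (h.anc_root b) h2.2.2.1)
  rcases h3 with h3 | h3
  · exact key u hu h3.1
  · exact key v hv h3.1

/-! ### ### The concrete tree and its numbering -/

open Relation

/-- A path of `m` new nodes `k, k + 1, …` that hangs from `c`, as a list of pairs of a parent and
a child. -/
def chainEdges : (c k m : ℕ) → List (ℕ × ℕ)
  | _, _, 0 => []
  | c, k, m + 1 => (c, k) :: chainEdges k (k + 1) m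

/-- `m` new nodes `k, k + 1, …`, children of `a`. -/
def leafEdges : (a k m : ℕ) → List (ℕ × ℕ)
  | _, _, 0 => []
  | a, k, m + 1 => (a, k) :: leafEdges a (k + 1) m

/-- A path of `γ + 1` nodes below `c`, of which node `j + 2` gets `m` leaves. -/
def blockEdges (γ c k j m : ℕ) : List (ℕ × ℕ) :=
  chainEdges c k (γ + 1) ++ leafEdges (k + j + 1) (k + γ + 1) m

/-- The gadget for an operation on the labels `i` and `j`. -/
def gadgetEdges (γ c k i j m : ℕ) : List (ℕ × ℕ) :=
  blockEdges γ c k j 2 ++ blockEdges γ (k + γ) (k + γ + 3) i m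

namespace CWExpr

variable {γ n : ℕ}

/-- The number of nodes used to represent an expression, not counting its vertices. -/
def nodeCount : CWExpr γ (Fin n) → ℕ
  | .vertex _ i => i + 1
  | .union Γ Δ => Γ.nodeCount + Δ.nodeCount
  | .join _ _ Γ => 2 * γ + 4 + 3 + Γ.nodeCount
  | .relabel _ _ Γ => 2 * γ + 4 + 4 + Γ.nodeCount

/-- The tree below `c` that represents an expression; its new nodes are `k, k + 1, …`. -/
def treeEdges : CWExpr γ (Fin n) → (c k : ℕ) → List (ℕ × ℕ)
  | .vertex v i, c, k => chainEdges c k (i + 1) ++ [(k + i, (v : ℕ))]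
  | .union Γ Δ, c, k => Γ.treeEdges c k ++ Δ.treeEdges c (k + Γ.nodeCount)
  | .join i j Γ, c, k => gadgetEdges γ c k i j 3 ++
      Γ.treeEdges (k + 2 * γ + 3) (k + (2 * γ + 4 + 3))
  | .relabel i j Γ, c, k => gadgetEdges γ c k i j 4 ++
      Γ.treeEdges (k + 2 * γ + 3) (k + (2 * γ + 4 + 4))

end CWExpr

theorem mem_chainEdges {c k m p w : ℕ} : (p, w) ∈ chainEdges c k m ↔
    k ≤ w ∧ w < k + m ∧ ((w = k ∧ p = c) ∨ (k < w ∧ p + 1 = w)) := by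
  induction m generalizing c k with
  | zero => simp [chainEdges]; omega
  | succ m ih => simp only [chainEdges, List.mem_cons, Prod.mk.injEq, ih]; omega

theorem mem_leafEdges {a k m p w : ℕ} : (p, w) ∈ leafEdges a k m ↔
    p = a ∧ k ≤ w ∧ w < k + m := by
  induction m generalizing k with
  | zero => simp [leafEdges]
  | succ m ih => simp only [leafEdges, List.mem_cons, Prod.mk.injEq, ih]; omega

theorem mem_blockEdges {γ c k j m p w : ℕ} : (p, w) ∈ blockEdges γ c k j m ↔
    (k ≤ w ∧ w < k + γ + 1 ∧ ((w = k ∧ p = c) ∨ (k < w ∧ p + 1 = w))) ∨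
    (p = k + j + 1 ∧ k + γ + 1 ≤ w ∧ w < k + γ + 1 + m) := by
  rw [blockEdges, List.mem_append, mem_chainEdges, mem_leafEdges, add_assoc k γ 1]

theorem mem_gadgetEdges {γ c k i j m p w : ℕ} : (p, w) ∈ gadgetEdges γ c k i j m ↔
    ((k ≤ w ∧ w < k + γ + 1 ∧ ((w = k ∧ p = c) ∨ (k < w ∧ p + 1 = w))) ∨
    (p = k + j + 1 ∧ k + γ + 1 ≤ w ∧ w < k + γ + 3)) ∨
    ((k + γ + 3 ≤ w ∧ w < k + 2 * γ + 4 ∧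
      ((w = k + γ + 3 ∧ p = k + γ) ∨ (k + γ + 3 < w ∧ p + 1 = w))) ∨
    (p = k + γ + i + 4 ∧ k + 2 * γ + 4 ≤ w ∧ w < k + 2 * γ + 4 + m)) := by
  rw [gadgetEdges, List.mem_append, mem_blockEdges, mem_blockEdges]
  omega

namespace CWExpr

variable {γ n : ℕ}

/-- New nodes are numbered consecutively from `k`, parents before children; the vertices keep their
numbers below `n ≤ c`. These intervals separate the parts of the tree in all later arguments. -/
theorem treeEdges_bounds (Γ : CWExpr γ (Fin n)) {c k p w : ℕ} (hnc : n ≤ c) (hck : c < k)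
    (h : (p, w) ∈ Γ.treeEdges c k) : (p = c ∨ k ≤ p ∧ p < k + Γ.nodeCount) ∧
      ((k ≤ w ∧ w < k + Γ.nodeCount ∧ p < w) ∨ ∃ v ∈ Γ.verts, (v : ℕ) = w) := by
  -- The common induction step for joins and relabelings, which differ only in the number `m` of
  -- leaves.
  have gad : ∀ {i j : Fin γ} {m : ℕ} {Γ : CWExpr γ (Fin n)},
      (∀ {c k p w : ℕ}, n ≤ c → c < k → (p, w) ∈ Γ.treeEdges c k →
        (p = c ∨ k ≤ p ∧ p < k + Γ.nodeCount) ∧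
        ((k ≤ w ∧ w < k + Γ.nodeCount ∧ p < w) ∨ ∃ v ∈ Γ.verts, (v : ℕ) = w)) →
      ∀ {c k p w : ℕ}, n ≤ c → c < k → ((p, w) ∈ gadgetEdges γ c k i j m ∨
        (p, w) ∈ Γ.treeEdges (k + 2 * γ + 3) (k + (2 * γ + 4 + m))) →
        (p = c ∨ k ≤ p ∧ p < k + (2 * γ + 4 + m + Γ.nodeCount)) ∧
        ((k ≤ w ∧ w < k + (2 * γ + 4 + m + Γ.nodeCount) ∧ p < w) ∨
          ∃ v ∈ Γ.verts, (v : ℕ) = w) := by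
    intro i j m Γ ih c k p w hnc hck h
    rcases h with h | h
    · rw [mem_gadgetEdges] at h
      refine ⟨by omega, Or.inl (by omega)⟩
    · obtain ⟨h1, h2⟩ := ih (by omega) (by omega) h
      exact ⟨by clear h2; omega, h2.imp_left fun h2 => by omega⟩
  induction Γ generalizing c k p w with
  | vertex v i =>
    simp only [treeEdges, List.mem_append, mem_chainEdges, List.mem_singleton, Prod.mk.injEq,
      nodeCount] at h ⊢
    rcases h with h | ⟨h1, h2⟩
    · exact ⟨by omega, Or.inl (by omega)⟩
    · exact ⟨by omega, Or.inr ⟨v, rfl, h2.symm⟩⟩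
  | union Γ Δ ih1 ih2 =>
    simp only [treeEdges, List.mem_append, nodeCount] at h ⊢
    rcases h with h | h
    · obtain ⟨h1, h2⟩ := ih1 hnc hck h
      refine ⟨by clear h2; omega, h2.imp (fun h2 => by omega) fun ⟨v, hv, e⟩ => ⟨v, Or.inl hv, e⟩⟩
    · obtain ⟨h1, h2⟩ := ih2 hnc (by omega) h
      refine ⟨by clear h2; omega, h2.imp (fun h2 => by omega) fun ⟨v, hv, e⟩ => ⟨v, Or.inr hv, e⟩⟩
  | join i j Γ ih => exact gad ih hnc hck (List.mem_append.1 h)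
  | relabel i j Γ ih => exact gad ih hnc hck (List.mem_append.1 h)

theorem treeEdges_unique (Γ : CWExpr γ (Fin n)) (hwf : Γ.WellFormed) {c k p p' w : ℕ}
    (hnc : n ≤ c) (hck : c < k) (h : (p, w) ∈ Γ.treeEdges c k) (h' : (p', w) ∈ Γ.treeEdges c k) :
    p = p' := by
  have gad : ∀ {i j : Fin γ} {m : ℕ} {Γ : CWExpr γ (Fin n)},
      (∀ {c k p p' w : ℕ}, n ≤ c → c < k → (p, w) ∈ Γ.treeEdges c k → (p', w) ∈ Γ.treeEdges c k →
        p = p') →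
      ∀ {c k p p' w : ℕ}, n ≤ c → c < k → ((p, w) ∈ gadgetEdges γ c k i j m ∨
        (p, w) ∈ Γ.treeEdges (k + 2 * γ + 3) (k + (2 * γ + 4 + m))) →
        ((p', w) ∈ gadgetEdges γ c k i j m ∨
        (p', w) ∈ Γ.treeEdges (k + 2 * γ + 3) (k + (2 * γ + 4 + m))) → p = p' := by
    intro i j m Γ ih c k p p' w hnc hck h h'
    have key : ∀ {p p'}, (p, w) ∈ gadgetEdges γ c k i j m →
        (p', w) ∈ Γ.treeEdges (k + 2 * γ + 3) (k + (2 * γ + 4 + m)) → False := by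
      intro p p' h h'
      rw [mem_gadgetEdges] at h
      rcases (Γ.treeEdges_bounds (by omega) (by omega) h').2 with h2 | ⟨v, _, h2⟩ <;> omega
    rcases h with h | h <;> rcases h' with h' | h'
    · rw [mem_gadgetEdges] at h h'
      omega
    · exact (key h h').elim
    · exact (key h' h).elim
    · exact ih (by omega) (by omega) h h'
  induction Γ generalizing c k p p' w with
  | vertex v i =>
    simp only [treeEdges, List.mem_append, mem_chainEdges, List.mem_singleton, Prod.mk.injEq]
      at h h'
    omega
  | union Γ Δ ih1 ih2 =>
    have key : ∀ {p p'}, (p, w) ∈ Γ.treeEdges c k →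
        (p', w) ∈ Δ.treeEdges c (k + Γ.nodeCount) → False := by
      intro p p' h h'
      rcases (Γ.treeEdges_bounds hnc hck h).2 with h1 | ⟨v, hv, h1⟩ <;>
      rcases (Δ.treeEdges_bounds hnc (by omega) h').2 with h2 | ⟨u, hu, h2⟩
      · omega
      · omega
      · omega
      -- A child shared by the two subtrees could only be a vertex, which disjointness of the union
      -- excludes.
      · have : v = u := Fin.ext (h1.trans h2.symm)
        exact Set.disjoint_left.1 hwf.2.2 hv (this ▸ hu)
    rcases List.mem_append.1 h with h | h <;> rcases List.mem_append.1 h' with h' | h'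
    · exact ih1 hwf.1 hnc hck h h'
    · exact (key h h').elim
    · exact (key h' h).elim
    · exact ih2 hwf.2.1 hnc (by omega) h h'
  | join i j Γ ih => exact gad (ih hwf) hnc hck (List.mem_append.1 h) (List.mem_append.1 h')
  | relabel i j Γ ih => exact gad (ih hwf) hnc hck (List.mem_append.1 h) (List.mem_append.1 h')

theorem exists_treeEdge (Γ : CWExpr γ (Fin n)) {c k w : ℕ}
    (h : (k ≤ w ∧ w < k + Γ.nodeCount) ∨ ∃ v ∈ Γ.verts, (v : ℕ) = w) :
    ∃ p, (p, w) ∈ Γ.treeEdges c k := by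
  have gad : ∀ {i j : Fin γ} {m : ℕ} {Γ : CWExpr γ (Fin n)},
      (∀ {c k w : ℕ}, (k ≤ w ∧ w < k + Γ.nodeCount) ∨ (∃ v ∈ Γ.verts, (v : ℕ) = w) →
        ∃ p, (p, w) ∈ Γ.treeEdges c k) →
      ∀ {c k w : ℕ}, (k ≤ w ∧ w < k + (2 * γ + 4 + m + Γ.nodeCount)) ∨
        (∃ v ∈ Γ.verts, (v : ℕ) = w) → ∃ p, (p, w) ∈ gadgetEdges γ c k i j m ++
        Γ.treeEdges (k + 2 * γ + 3) (k + (2 * γ + 4 + m)) := by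
    intro i j m Γ ih c k w h
    simp only [List.mem_append, exists_or]
    by_cases hg : k ≤ w ∧ w < k + (2 * γ + 4 + m)
    · left
      simp only [mem_gadgetEdges]
      by_cases h1 : w = k
      · exact ⟨c, by omega⟩
      by_cases h2 : w < k + γ + 1
      · exact ⟨w - 1, by omega⟩
      by_cases h3 : w < k + γ + 3
      · exact ⟨k + j + 1, by omega⟩
      by_cases h4 : w = k + γ + 3
      · exact ⟨k + γ, by omega⟩
      by_cases h5 : w < k + 2 * γ + 4
      · exact ⟨w - 1, by omega⟩
      · exact ⟨k + γ + i + 4, by omega⟩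
    · exact Or.inr (ih (h.imp_left fun h => by omega))
  induction Γ generalizing c k w with
  | vertex v i =>
    simp only [treeEdges, List.mem_append, mem_chainEdges, List.mem_singleton, Prod.mk.injEq,
      nodeCount] at h ⊢
    rcases h with h | ⟨u, hu, h⟩
    · by_cases h1 : w = k
      · exact ⟨c, by omega⟩
      · exact ⟨w - 1, by omega⟩
    · rw [show u = v from hu] at h
      exact ⟨k + i, by omega⟩
  | union Γ Δ ih1 ih2 =>
    simp only [treeEdges, List.mem_append, nodeCount, exists_or] at h ⊢
    rcases h with h | ⟨u, hu | hu, h⟩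
    · by_cases h1 : w < k + Γ.nodeCount
      · exact Or.inl (ih1 (Or.inl (by omega)))
      · exact Or.inr (ih2 (Or.inl (by omega)))
    · exact Or.inl (ih1 (Or.inr ⟨u, hu, h⟩))
    · exact Or.inr (ih2 (Or.inr ⟨u, hu, h⟩))
  | join i j Γ ih => exact gad ih h
  | relabel i j Γ ih => exact gad ih h

theorem exists_child (Γ : CWExpr γ (Fin n)) (c k : ℕ) : ∃ w, (c, w) ∈ Γ.treeEdges c k := by
  induction Γ generalizing k with
  | vertex v i => exact ⟨k, List.mem_append_left _ (mem_chainEdges.2 (by omega))⟩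
  | union Γ Δ ih1 ih2 => exact (ih1 k).imp fun w hw => List.mem_append_left _ hw
  | join i j Γ ih => exact ⟨k, List.mem_append_left _ (mem_gadgetEdges.2 (by omega))⟩
  | relabel i j Γ ih => exact ⟨k, List.mem_append_left _ (mem_gadgetEdges.2 (by omega))⟩

/-- Nothing that hangs from `c` on behalf of the expression is a leaf, so the number of leaves at
`c` is not disturbed. -/
theorem exists_grandchild (Γ : CWExpr γ (Fin n)) {c k w : ℕ} (hnc : n ≤ c) (hck : c < k)
    (h : (c, w) ∈ Γ.treeEdges c k) : ∃ w', (w, w') ∈ Γ.treeEdges c k := by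
  have gad : ∀ {i j : Fin γ} {m : ℕ} {Γ : CWExpr γ (Fin n)} {c k w : ℕ}, n ≤ c → c < k →
      (c, w) ∈ gadgetEdges γ c k i j m ++ Γ.treeEdges (k + 2 * γ + 3) (k + (2 * γ + 4 + m)) →
      ∃ w', (w, w') ∈ gadgetEdges γ c k i j m ++
        Γ.treeEdges (k + 2 * γ + 3) (k + (2 * γ + 4 + m)) := by
    intro i j m Γ c k w hnc hck h
    have hw : w = k := by
      rcases List.mem_append.1 h with h | h
      · rw [mem_gadgetEdges] at h
        omega
      · have := (Γ.treeEdges_bounds (by omega) (by omega) h).1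
        omega
    subst hw
    have := i.2
    exact ⟨w + 1, List.mem_append_left _ (mem_gadgetEdges.2 (by omega))⟩
  cases Γ with
  | vertex v i =>
    simp only [treeEdges, List.mem_append, mem_chainEdges, List.mem_singleton, Prod.mk.injEq]
      at h ⊢
    -- The spare node separates the vertex from `c` even when the label is `0`.
    by_cases hi : (i : ℕ) = 0
    · exact ⟨v, by omega⟩
    · exact ⟨k + 1, by omega⟩
  | union Γ Δ =>
    rcases List.mem_append.1 h with h | h
    · obtain ⟨w', hw'⟩ := Γ.exists_grandchild hnc hck h
      exact ⟨w', List.mem_append_left _ hw'⟩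
    · obtain ⟨w', hw'⟩ := Δ.exists_grandchild hnc (by omega) h
      exact ⟨w', List.mem_append_right _ hw'⟩
  | join i j Γ => exact gad hnc hck h
  | relabel i j Γ => exact gad hnc hck h

end CWExpr

/-! ### ### Counting leaves at a gadget -/

/-- The number of childless children of `a`. -/
noncomputable def childLeafCount (L : List (ℕ × ℕ)) (a : ℕ) : ℕ :=
  {l | (a, l) ∈ L ∧ ∀ w, (l, w) ∉ L}.ncard

theorem childLeafCount_eq_of_Ico {L : List (ℕ × ℕ)} {a k m : ℕ}
    (h : ∀ l, ((a, l) ∈ L ∧ ∀ w, (l, w) ∉ L) ↔ k ≤ l ∧ l < k + m) : childLeafCount L a = m := by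
  have : {l | (a, l) ∈ L ∧ ∀ w, (l, w) ∉ L} = ((Finset.Ico k (k + m) : Finset ℕ) : Set ℕ) := by
    ext l
    simp [h]
  rw [childLeafCount, this, Set.ncard_coe_finset, Nat.card_Ico, Nat.add_sub_cancel_left]

theorem childLeafCount_eq_zero {L : List (ℕ × ℕ)} {a : ℕ}
    (h : ∀ l, (a, l) ∈ L → ∃ w, (l, w) ∈ L) : childLeafCount L a = 0 :=
  childLeafCount_eq_of_Ico (k := 0) fun l =>
    ⟨fun h1 => ((h l h1.1).elim h1.2).elim, fun h1 => by omega⟩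

/-- A gadget inside a larger tree `L`, where `B` lists what hangs from its bottom node. -/
structure GadgetIn (L B : List (ℕ × ℕ)) (γ c k i j m : ℕ) : Prop where
  sub : ∀ p w, (p, w) ∈ gadgetEdges γ c k i j m → (p, w) ∈ L
  sub' : ∀ p w, (p, w) ∈ B → (p, w) ∈ L
  mem : ∀ p w, k ≤ p → p < k + (2 * γ + 4 + m) → (p, w) ∈ L →
    (p, w) ∈ gadgetEdges γ c k i j m ∨ (p = k + 2 * γ + 3 ∧ (p, w) ∈ B)
  child : ∃ w, (k + 2 * γ + 3, w) ∈ B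
  grandchild : ∀ w, (k + 2 * γ + 3, w) ∈ B → ∃ w', (w, w') ∈ B

/-- The path of a gadget. -/
def gadgetNode (γ c k s : ℕ) : ℕ :=
  if s = 0 then c else if s ≤ γ + 1 then k + s - 1 else k + s + 1

namespace GadgetIn

variable {L B : List (ℕ × ℕ)} {γ c k i j m : ℕ} (h : GadgetIn L B γ c k i j m) (hck : c < k)
  (hi : i < γ) (hj : j < γ)
include h

theorem exists_child_of_node {s : ℕ} (h1 : 1 ≤ s) (h2 : s ≤ 2 * (γ + 1)) :
    ∃ w, (gadgetNode γ c k s, w) ∈ L := by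
  unfold gadgetNode
  rw [if_neg (by omega)]
  by_cases h3 : s ≤ γ
  · rw [if_pos (by omega)]
    exact ⟨k + s, h.sub _ _ (mem_gadgetEdges.2 (by omega))⟩
  by_cases h4 : s = γ + 1
  · rw [if_pos (by omega)]
    exact ⟨k + γ + 3, h.sub _ _ (mem_gadgetEdges.2 (by omega))⟩
  rw [if_neg (by omega)]
  by_cases h5 : s = 2 * (γ + 1)
  · obtain ⟨w, hw⟩ := h.child
    exact ⟨w, h.sub' _ _ (by rwa [show k + s + 1 = k + 2 * γ + 3 by omega])⟩
  · exact ⟨k + s + 2, h.sub _ _ (mem_gadgetEdges.2 (by omega))⟩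

include hck hi hj

theorem not_child_of_leaf {l : ℕ} (hl : (k + γ + 1 ≤ l ∧ l < k + γ + 3) ∨
    (k + 2 * γ + 4 ≤ l ∧ l < k + 2 * γ + 4 + m)) (w : ℕ) : (l, w) ∉ L := by
  intro hw
  rcases h.mem l w (by omega) (by omega) hw with h1 | ⟨h1, _⟩
  · rw [mem_gadgetEdges] at h1
    omega
  · omega

/-- Path nodes have children, and so have the nodes that hang from the bottom of the gadget. Hence
only the leaves added as marks are counted. -/
theorem isGadget : IsGadget (fun p w => (p, w) ∈ L) (childLeafCount L) γ (gadgetNode γ c k)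
    i j m := by
  have hleaf := fun l hl w => h.not_child_of_leaf (l := l) hck hi hj hl w
  refine ⟨fun s hs => h.sub _ _ (mem_gadgetEdges.2 ?_), fun s h1 h2 => ?_⟩
  · unfold gadgetNode
    rw [if_neg (Nat.succ_ne_zero s)]
    split_ifs <;> omega
  have hchain : ∀ l, (∃ t, 1 ≤ t ∧ t ≤ 2 * (γ + 1) ∧ l = gadgetNode γ c k t) ∨
      (k + 2 * γ + 3, l) ∈ B → ∃ w, (l, w) ∈ L := by
    rintro l (⟨t, ht1, ht2, rfl⟩ | hl)
    · exact h.exists_child_of_node ht1 ht2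
    · obtain ⟨w, hw⟩ := h.grandchild l hl
      exact ⟨w, h.sub' _ _ hw⟩
  have hpath : ∀ l, (k ≤ l ∧ l < k + γ + 1) ∨ (k + γ + 3 ≤ l ∧ l < k + 2 * γ + 4) →
      ∃ w, (l, w) ∈ L := by
    intro l hl
    refine hchain l (Or.inl ?_)
    rcases hl with hl | hl
    · refine ⟨l + 1 - k, by omega, by omega, ?_⟩
      rw [gadgetNode, if_neg (by omega), if_pos (by omega)]
      omega
    · refine ⟨l - 1 - k, by omega, by omega, ?_⟩
      rw [gadgetNode, if_neg (by omega), if_neg (by omega)]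
      omega
  have hnode : k ≤ gadgetNode γ c k s ∧ gadgetNode γ c k s < k + (2 * γ + 4 + m) := by
    unfold gadgetNode
    split_ifs <;> omega
  split_ifs with h3 h4
  · have e : gadgetNode γ c k s = k + j + 1 := by
      unfold gadgetNode
      rw [if_neg (by omega), if_pos (by omega)]
      omega
    refine childLeafCount_eq_of_Ico (k := k + γ + 1) fun l => ⟨fun ⟨h5, h6⟩ => ?_, fun h5 =>
      ⟨h.sub _ _ (mem_gadgetEdges.2 (by omega)), hleaf l (Or.inl (by omega))⟩⟩
    rcases h.mem _ l hnode.1 hnode.2 h5 with h7 | ⟨h7, _⟩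
    · rw [mem_gadgetEdges] at h7
      by_contra hl
      obtain ⟨w, hw⟩ := hpath l (by omega)
      exact h6 w hw
    · omega
  · have e : gadgetNode γ c k s = k + γ + i + 4 := by
      unfold gadgetNode
      rw [if_neg (by omega), if_neg (by omega)]
      omega
    refine childLeafCount_eq_of_Ico (k := k + 2 * γ + 4) fun l => ⟨fun ⟨h5, h6⟩ => ?_, fun h5 =>
      ⟨h.sub _ _ (mem_gadgetEdges.2 (by omega)), hleaf l (Or.inr (by omega))⟩⟩
    rcases h.mem _ l hnode.1 hnode.2 h5 with h7 | ⟨h7, h8⟩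
    · rw [mem_gadgetEdges] at h7
      by_contra hl
      obtain ⟨w, hw⟩ := hpath l (by omega)
      exact h6 w hw
    · obtain ⟨w, hw⟩ := hchain l (Or.inr (h7 ▸ h8))
      exact absurd hw (h6 w)
  · refine childLeafCount_eq_zero fun l hl => ?_
    rcases h.mem _ l hnode.1 hnode.2 hl with h7 | ⟨h7, h8⟩
    · refine hpath l ?_
      rw [mem_gadgetEdges] at h7
      unfold gadgetNode at h7
      split_ifs at h7 <;> omega
    · exact hchain l (Or.inr (h7 ▸ h8))

end GadgetIn

/-! ### ### Occurrences of an expression in a larger tree -/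

open Relation

/-- The expression `Γ` occurs in the tree `L` below `c`, with the new nodes `k, k + 1, …`. -/
structure TreeIn {γ n : ℕ} (L : List (ℕ × ℕ)) (Γ : CWExpr γ (Fin n)) (c k : ℕ) : Prop where
  le : n ≤ c
  lt : c < k
  sub : ∀ p w, (p, w) ∈ Γ.treeEdges c k → (p, w) ∈ L
  mem : ∀ p w, k ≤ p → p < k + Γ.nodeCount → (p, w) ∈ L → (p, w) ∈ Γ.treeEdges c k
  low : ∀ p w, (p, w) ∈ L → n ≤ p
  unique : ∀ p p' w, (p, w) ∈ L → (p', w) ∈ L → p = p'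

/-- The numbers of the nodes and vertices below `c` that belong to `Γ`. -/
def CWExpr.region {γ n : ℕ} (Γ : CWExpr γ (Fin n)) (k : ℕ) : Set ℕ :=
  {x | (k ≤ x ∧ x < k + Γ.nodeCount) ∨ ∃ v ∈ Γ.verts, (v : ℕ) = x}

/-- What is known about the leaves near a node `x`. -/
structure NodeFacts (n : ℕ) (L : List (ℕ × ℕ)) (x : ℕ) : Prop where
  count_le : childLeafCount L x ≤ 4
  twin : n ≤ x → (∃ w, (x, w) ∈ L) ∨
    ∃ p y, y ≠ x ∧ (p, x) ∈ L ∧ (p, y) ∈ L ∧ ∀ w, (y, w) ∉ L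
  only : x < n → ∀ p y, (p, x) ∈ L → (p, y) ∈ L → y = x

namespace TreeIn

variable {γ n : ℕ} {L : List (ℕ × ℕ)} {c k : ℕ}

theorem union_left {Γ Δ : CWExpr γ (Fin n)} (h : TreeIn L (.union Γ Δ) c k) : TreeIn L Γ c k := by
  refine ⟨h.le, h.lt, fun p w hp => h.sub p w (List.mem_append_left _ hp), fun p w h1 h2 h3 => ?_,
    h.low, h.unique⟩
  have hlt := h.lt
  rcases List.mem_append.1 (h.mem p w h1 (by simp only [CWExpr.nodeCount]; omega) h3) with h4 | h4
  · exact h4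
  · have := (Δ.treeEdges_bounds h.le (by omega) h4).1
    omega

theorem union_right {Γ Δ : CWExpr γ (Fin n)} (h : TreeIn L (.union Γ Δ) c k) :
    TreeIn L Δ c (k + Γ.nodeCount) := by
  have hlt := h.lt
  refine ⟨h.le, by omega, fun p w hp => h.sub p w (List.mem_append_right _ hp),
    fun p w h1 h2 h3 => ?_, h.low, h.unique⟩
  rcases List.mem_append.1 (h.mem p w (by omega) (by simp only [CWExpr.nodeCount]; omega) h3)
    with h4 | h4
  · have := (Γ.treeEdges_bounds h.le h.lt h4).1
    omega
  · exact h4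

/-- The gadget and what hangs below it. -/
theorem gadget {Γ : CWExpr γ (Fin n)} {i j m : ℕ} (hi : i < γ) (hj : j < γ) (hnc : n ≤ c)
    (hck : c < k) (low : ∀ p w, (p, w) ∈ L → n ≤ p)
    (unique : ∀ p p' w, (p, w) ∈ L → (p', w) ∈ L → p = p')
    (sub : ∀ p w, (p, w) ∈ gadgetEdges γ c k i j m ++
      Γ.treeEdges (k + 2 * γ + 3) (k + (2 * γ + 4 + m)) → (p, w) ∈ L)
    (mem : ∀ p w, k ≤ p → p < k + (2 * γ + 4 + m + Γ.nodeCount) → (p, w) ∈ L →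
      (p, w) ∈ gadgetEdges γ c k i j m ++
      Γ.treeEdges (k + 2 * γ + 3) (k + (2 * γ + 4 + m))) :
    TreeIn L Γ (k + 2 * γ + 3) (k + (2 * γ + 4 + m)) ∧
    GadgetIn L (Γ.treeEdges (k + 2 * γ + 3) (k + (2 * γ + 4 + m))) γ c k i j m := by
  refine ⟨⟨by omega, by omega, fun p w hp => sub p w (List.mem_append_right _ hp),
    fun p w h1 h2 h3 => ?_, low, unique⟩, ⟨fun p w hp => sub p w (List.mem_append_left _ hp),
    fun p w hp => sub p w (List.mem_append_right _ hp), fun p w h1 h2 h3 => ?_, ?_, ?_⟩⟩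
  · rcases List.mem_append.1 (mem p w (by omega) (by omega) h3) with h4 | h4
    · rw [mem_gadgetEdges] at h4
      omega
    · exact h4
  · refine (List.mem_append.1 (mem p w h1 (by omega) h3)).imp_right fun h4 => ⟨?_, ?_⟩
    · have := (Γ.treeEdges_bounds (by omega) (by omega) h4).1
      omega
    · exact h4
  · exact Γ.exists_child _ _
  · exact fun w hw => Γ.exists_grandchild (by omega) (by omega) hw

end TreeIn

theorem GadgetIn.nodeFacts {n : ℕ} {L B : List (ℕ × ℕ)} {γ c k i j m : ℕ}
    (h : GadgetIn L B γ c k i j m) (hnc : n ≤ c) (hck : c < k) (hi : i < γ) (hj : j < γ)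
    (h2m : 2 ≤ m) (hm : m ≤ 4) {x : ℕ} (h1 : k ≤ x) (h2 : x < k + (2 * γ + 4 + m)) :
    NodeFacts n L x := by
  have hg := h.isGadget hck hi hj
  by_cases hl : (k + γ + 1 ≤ x ∧ x < k + γ + 3) ∨ (k + 2 * γ + 4 ≤ x ∧ x < k + 2 * γ + 4 + m)
  · have hx := h.not_child_of_leaf hck hi hj hl
    refine ⟨?_, fun _ => Or.inr ?_, fun h3 => by omega⟩
    · rw [childLeafCount_eq_zero fun l hl => absurd hl (hx l)]
      omega
    · by_cases hu : x < k + γ + 3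
      -- Every mark consists of at least two leaves, so another leaf of the same mark serves as
      -- sibling.
      · refine ⟨k + j + 1, if x = k + γ + 1 then k + γ + 2 else k + γ + 1, ?_,
          h.sub _ _ (mem_gadgetEdges.2 ?_), h.sub _ _ (mem_gadgetEdges.2 ?_),
          h.not_child_of_leaf hck hi hj ?_⟩ <;> (try split_ifs) <;> omega
      · refine ⟨k + γ + i + 4, if x = k + 2 * γ + 4 then k + 2 * γ + 5 else k + 2 * γ + 4, ?_,
          h.sub _ _ (mem_gadgetEdges.2 ?_), h.sub _ _ (mem_gadgetEdges.2 ?_),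
          h.not_child_of_leaf hck hi hj ?_⟩ <;> (try split_ifs) <;> omega
  · obtain ⟨s, hs1, hs2, rfl⟩ : ∃ s, 1 ≤ s ∧ s ≤ 2 * (γ + 1) ∧ x = gadgetNode γ c k s := by
      by_cases hu : x < k + γ + 1
      · refine ⟨x + 1 - k, by omega, by omega, ?_⟩
        rw [gadgetNode, if_neg (by omega), if_pos (by omega)]
        omega
      · refine ⟨x - 1 - k, by omega, by omega, ?_⟩
        rw [gadgetNode, if_neg (by omega), if_neg (by omega)]
        omega
    refine ⟨?_, fun _ => Or.inl (h.exists_child_of_node hs1 hs2), fun h3 => by omega⟩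
    rw [hg.count s hs1 hs2]
    split_ifs <;> omega

namespace TreeIn

variable {γ n : ℕ} {L : List (ℕ × ℕ)} {c k : ℕ}

theorem vertex {v : Fin n} {i : Fin γ} (h : TreeIn L (.vertex v i) c k) :
    (∃ D ⊆ (CWExpr.vertex v i).region k, Represents (fun p w => (p, w) ∈ L) (childLeafCount L)
      (fun u : Fin n => (u : ℕ)) (.vertex v i) c D) ∧
    ∀ x ∈ (CWExpr.vertex v i).region k, NodeFacts n L x := by
  obtain ⟨hnc, hck, sub, mem, low, unique⟩ := h
  simp only [CWExpr.treeEdges, List.mem_append, mem_chainEdges, List.mem_singleton, Prod.mk.injEq,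
    CWExpr.nodeCount] at sub mem
  have hv := v.2
  -- The path to a vertex does not branch, so no node on it can be taken for a mark.
  have hone : ∀ x y, (∀ l, (x, l) ∈ L → l = y) → childLeafCount L x ≤ 1 := fun x y hxy => by
    have h1 := Set.ncard_le_ncard (s := {l | (x, l) ∈ L ∧ ∀ w, (l, w) ∉ L}) (t := {y})
      (fun l hl => hxy l hl.1) (Set.finite_singleton y)
    rwa [Set.ncard_singleton] at h1
  have hvert : ∀ w, ((v : ℕ), w) ∉ L := fun w hw => by have := low _ _ hw; omega
  have hnext : ∀ x l, k ≤ x → x < k + (i + 1) → (x, l) ∈ L →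
      l = if x = k + i then (v : ℕ) else x + 1 := by
    intro x l h1 h2 h3
    have := mem x l h1 h2 h3
    split_ifs <;> omega
  have hle : ∀ x, (k ≤ x ∧ x < k + (i + 1)) ∨ x = v → childLeafCount L x ≤ 1 := by
    rintro x (⟨h1, h2⟩ | rfl)
    · exact hone x _ fun l => hnext x l h1 h2
    · exact hone _ 0 fun l hl => absurd hl (hvert l)
  constructor
  · refine ⟨_, ?_, fun s => if s = 0 then c else if s < i + 2 then k + s - 1 else v, if_pos rfl,
      ?_, ?_, ?_, rfl⟩
    · rintro _ ⟨s, h1, h2, rfl⟩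
      beta_reduce
      rw [if_neg (by omega)]
      split_ifs with h3
      · exact Or.inl ⟨by omega, by simp only [CWExpr.nodeCount]; omega⟩
      · exact Or.inr ⟨v, rfl, rfl⟩
    · beta_reduce
      rw [if_neg (by omega), if_neg (by omega)]
    · intro s hs
      refine sub _ _ ?_
      beta_reduce
      rw [if_neg (Nat.succ_ne_zero s)]
      split_ifs <;> omega
    · intro s h1 h2
      refine hle _ ?_
      beta_reduce
      rw [if_neg (by omega)]
      split_ifs <;> omega
  · rintro x (hx | ⟨u, rfl, rfl⟩)
    · simp only [CWExpr.nodeCount] at hx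
      refine ⟨(hle x (Or.inl hx)).trans (by omega), fun _ => Or.inl ?_, fun h3 => by omega⟩
      by_cases h3 : x = k + i
      · exact ⟨v, sub _ _ (by omega)⟩
      · exact ⟨x + 1, sub _ _ (by omega)⟩
    · refine ⟨(hle _ (Or.inr rfl)).trans (by omega), fun h3 => by omega, fun _ p y hp hy => ?_⟩
      obtain rfl := unique _ _ _ hp (sub (k + i) u (by omega))
      rw [hnext _ y (by omega) (by omega) hy, if_pos rfl]

theorem represents {Γ : CWExpr γ (Fin n)} (hwf : Γ.WellFormed) (h : TreeIn L Γ c k) :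
    (∃ D ⊆ Γ.region k, Represents (fun p w => (p, w) ∈ L) (childLeafCount L)
      (fun u : Fin n => (u : ℕ)) Γ c D) ∧ ∀ x ∈ Γ.region k, NodeFacts n L x := by
  have gad : ∀ {c k : ℕ} {Γ : CWExpr γ (Fin n)} {i j : Fin γ} {m : ℕ}, 2 ≤ m → m ≤ 4 → n ≤ c → c < k →
      GadgetIn L (Γ.treeEdges (k + 2 * γ + 3) (k + (2 * γ + 4 + m))) γ c k i j m →
      ((∃ D ⊆ Γ.region (k + (2 * γ + 4 + m)), Represents (fun p w => (p, w) ∈ L)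
        (childLeafCount L) (fun u : Fin n => (u : ℕ)) Γ (k + 2 * γ + 3) D) ∧
        ∀ x ∈ Γ.region (k + (2 * γ + 4 + m)), NodeFacts n L x) →
      (∃ (e : ℕ → ℕ) (D' : Set ℕ), e 0 = c ∧
        IsGadget (fun p w => (p, w) ∈ L) (childLeafCount L) γ e i j m ∧
        Represents (fun p w => (p, w) ∈ L) (childLeafCount L) (fun u : Fin n => (u : ℕ)) Γ
          (e (2 * (γ + 1))) D' ∧ pathNodes e (2 * (γ + 1)) ∪ D' ⊆
          {x | (k ≤ x ∧ x < k + (2 * γ + 4 + m + Γ.nodeCount)) ∨ ∃ v ∈ Γ.verts, (v : ℕ) = x}) ∧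
        ∀ x, ((k ≤ x ∧ x < k + (2 * γ + 4 + m + Γ.nodeCount)) ∨ ∃ v ∈ Γ.verts, (v : ℕ) = x) →
          NodeFacts n L x := by
    rintro c k Γ i j m h2m hm hnc hck hg ⟨⟨D, hD, hR⟩, hN⟩
    refine ⟨⟨gadgetNode γ c k, D, if_pos rfl, hg.isGadget hck i.2 j.2, ?_, ?_⟩, ?_⟩
    · rwa [gadgetNode, if_neg (by omega), if_neg (by omega),
        show k + 2 * (γ + 1) + 1 = k + 2 * γ + 3 by omega]
    · rintro x (⟨s, h1, h2, rfl⟩ | hx)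
      · left
        unfold gadgetNode
        split_ifs <;> omega
      · exact (hD hx).imp_left fun h1 => by omega
    · intro x hx
      by_cases h1 : k ≤ x ∧ x < k + (2 * γ + 4 + m)
      · exact hg.nodeFacts hnc hck i.2 j.2 h2m hm h1.1 h1.2
      · exact hN x (hx.imp_left fun h2 => by omega)
  induction Γ generalizing c k with
  | vertex v i => exact h.vertex
  | union Γ Δ ih1 ih2 =>
    have hlt := h.lt
    have hle := h.le
    obtain ⟨⟨D₁, hD₁, h1⟩, h3⟩ := ih1 hwf.1 h.union_left
    obtain ⟨⟨D₂, hD₂, h2⟩, h4⟩ := ih2 hwf.2.1 h.union_right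
    refine ⟨⟨D₁ ∪ D₂, ?_, D₁, D₂, h1, h2, ?_, rfl⟩, ?_⟩
    · rintro x (hx | hx)
      · refine (hD₁ hx).imp (fun h5 => ?_) fun ⟨v, hv, e⟩ => ⟨v, Or.inl hv, e⟩
        simp only [CWExpr.nodeCount]
        omega
      · refine (hD₂ hx).imp (fun h5 => ?_) fun ⟨v, hv, e⟩ => ⟨v, Or.inr hv, e⟩
        simp only [CWExpr.nodeCount]
        omega
    · refine Set.disjoint_left.2 fun x hx1 hx2 => ?_
      rcases hD₁ hx1 with h5 | ⟨v, hv, rfl⟩ <;> rcases hD₂ hx2 with h6 | ⟨u, hu, h6⟩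
      · omega
      · omega
      · omega
      · exact Set.disjoint_left.1 hwf.2.2 hv (Fin.ext h6 ▸ hu)
    · rintro x (hx | ⟨v, hv | hv, e⟩)
      · simp only [CWExpr.nodeCount] at hx
        by_cases h5 : x < k + Γ.nodeCount
        · exact h3 x (Or.inl ⟨hx.1, h5⟩)
        · exact h4 x (Or.inl (by omega))
      · exact h3 x (Or.inr ⟨v, hv, e⟩)
      · exact h4 x (Or.inr ⟨v, hv, e⟩)
  | join i j Γ ih =>
    obtain ⟨h1, h2⟩ := gadget i.2 j.2 h.le h.lt h.low h.unique h.sub h.mem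
    obtain ⟨⟨e, D', h3, h4, h5, h6⟩, h7⟩ := gad (by omega) (by omega) h.le h.lt h2 (ih hwf h1)
    exact ⟨⟨_, h6, e, D', h3, h4, h5, rfl⟩, h7⟩
  | relabel i j Γ ih =>
    obtain ⟨h1, h2⟩ := gadget i.2 j.2 h.le h.lt h.low h.unique h.sub h.mem
    obtain ⟨⟨e, D', h3, h4, h5, h6⟩, h7⟩ := gad (by omega) (by omega) h.le h.lt h2 (ih hwf h1)
    exact ⟨⟨_, h6, e, D', h3, h4, h5, rfl⟩, h7⟩

end TreeIn

/-! ### ### From natural numbers to a finite vertex set -/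

open Relation

/-- A representation by natural numbers below `N` is one by elements of `Fin N`. -/
theorem Represents.lift {U : Type*} {γ N : ℕ} {E : ℕ → ℕ → Prop} {lc : ℕ → ℕ} {ι : U → Fin N}
    (hE : ∀ p w, E p w → w < N) {Γ : CWExpr γ U} {c : Fin N} {D : Set ℕ}
    (h : Represents E lc (fun u => (ι u : ℕ)) Γ c D) :
    Represents (fun p w : Fin N => E p w) (fun x => lc x) ι Γ c {x : Fin N | (x : ℕ) ∈ D} := by
  have path : ∀ {e : ℕ → ℕ} {c : Fin N} {m : ℕ}, e 0 = c → (∀ s < m, E (e s) (e (s + 1))) →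
      ∃ e' : ℕ → Fin N, e' 0 = c ∧ (∀ s ≤ m, (e' s : ℕ) = e s) ∧
        pathNodes e' m = {x : Fin N | (x : ℕ) ∈ pathNodes e m} := by
    intro e c m h0 he
    have hlt : ∀ s ≤ m, e s < N := fun s hs => by
      cases s with
      | zero => rw [h0]; exact c.2
      | succ s => exact hE _ _ (he s hs)
    -- Only the values up to `m` matter; beyond them `e` may exceed `N`, and `c` is a harmless
    -- default.
    have hval : ∀ s ≤ m, ((if h : e s < N then (⟨e s, h⟩ : Fin N) else c : Fin N) : ℕ) = e s :=
      fun s hs => by rw [dif_pos (hlt s hs)]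
    refine ⟨fun s => if h : e s < N then ⟨e s, h⟩ else c, ?_, hval, ?_⟩
    · exact Fin.ext ((hval 0 (Nat.zero_le m)).trans h0)
    · ext x
      constructor
      · rintro ⟨s, h1, h2, rfl⟩
        exact ⟨s, h1, h2, hval s h2⟩
      · rintro ⟨s, h1, h2, h3⟩
        exact ⟨s, h1, h2, Fin.ext (h3.trans (hval s h2).symm)⟩
  have gad : ∀ {e : ℕ → ℕ} {c : Fin N} {i j m : ℕ}, e 0 = c → IsGadget E lc γ e i j m →
      ∃ e' : ℕ → Fin N, e' 0 = c ∧ (e' (2 * (γ + 1)) : ℕ) = e (2 * (γ + 1)) ∧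
        IsGadget (fun p w : Fin N => E p w) (fun x => lc x) γ e' i j m ∧
        pathNodes e' (2 * (γ + 1)) = {x : Fin N | (x : ℕ) ∈ pathNodes e (2 * (γ + 1))} := by
    intro e c i j m h0 hg
    obtain ⟨e', h1, h2, h3⟩ := path h0 hg.chain
    refine ⟨e', h1, h2 _ le_rfl, ⟨fun s hs => ?_, fun s hs1 hs2 => ?_⟩, h3⟩
    · rw [h2 s (by omega), h2 (s + 1) (by omega)]
      exact hg.chain s hs
    · rw [h2 s hs2]
      exact hg.count s hs1 hs2
  induction Γ generalizing c D with
  | vertex v i =>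
    obtain ⟨e, h0, hv, he, hlc, rfl⟩ := h
    obtain ⟨e', h1, h2, h3⟩ := path h0 he
    refine ⟨e', h1, Fin.ext ((h2 _ le_rfl).trans hv), fun s hs => ?_, fun s hs1 hs2 => ?_, h3.symm⟩
    · beta_reduce
      rw [h2 s (by omega), h2 (s + 1) (by omega)]
      exact he s hs
    · beta_reduce
      rw [h2 s hs2]
      exact hlc s hs1 hs2
  | union Γ Δ ih1 ih2 =>
    obtain ⟨D₁, D₂, h1, h2, hD, rfl⟩ := h
    exact ⟨_, _, ih1 h1, ih2 h2,
      Set.disjoint_left.2 fun x hx => Set.disjoint_left.1 hD hx, rfl⟩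
  | join i j Γ ih =>
    obtain ⟨e, D', h0, hg, h1, rfl⟩ := h
    obtain ⟨e', h2, h3, h4, h5⟩ := gad h0 hg
    exact ⟨e', {x : Fin N | (x : ℕ) ∈ D'}, h2, h4, ih (h3 ▸ h1), by rw [h5]; rfl⟩
  | relabel i j Γ ih =>
    obtain ⟨e, D', h0, hg, h1, rfl⟩ := h
    obtain ⟨e', h2, h3, h4, h5⟩ := gad h0 hg
    exact ⟨e', {x : Fin N | (x : ℕ) ∈ D'}, h2, h4, ih (h3 ▸ h1), by rw [h5]; rfl⟩

/-! ### ### The tree of an expression -/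

namespace CWExpr

variable {γ n : ℕ}

/-- The number of nodes of the tree of an expression. -/
def treeSize (Γ : CWExpr γ (Fin n)) : ℕ := n + 6 + Γ.nodeCount

/-- The edges of the tree of an expression: the root `n` has five leaves. -/
def allEdges (Γ : CWExpr γ (Fin n)) : List (ℕ × ℕ) :=
  leafEdges n (n + 1) 5 ++ Γ.treeEdges n (n + 6)

variable {Γ : CWExpr γ (Fin n)}

theorem mem_allEdges {p w : ℕ} : (p, w) ∈ Γ.allEdges ↔
    (p = n ∧ n + 1 ≤ w ∧ w < n + 6) ∨ (p, w) ∈ Γ.treeEdges n (n + 6) := by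
  rw [allEdges, List.mem_append, mem_leafEdges, add_assoc n 1 5]

theorem allEdges_bounds {p w : ℕ} (h : (p, w) ∈ Γ.allEdges) :
    n ≤ p ∧ p < Γ.treeSize ∧ w < Γ.treeSize ∧ (w < n ∨ p < w) := by
  unfold treeSize
  rcases mem_allEdges.1 h with h | h
  · omega
  · obtain ⟨h1, h2 | ⟨v, _, h2⟩⟩ := Γ.treeEdges_bounds le_rfl (by omega) h
    · omega
    · have := v.2
      omega

theorem allEdges_unique (hwf : Γ.WellFormed) {p p' w : ℕ} (h : (p, w) ∈ Γ.allEdges)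
    (h' : (p', w) ∈ Γ.allEdges) : p = p' := by
  have key : ∀ {p}, n + 1 ≤ w → w < n + 6 → (p, w) ∉ Γ.treeEdges n (n + 6) := by
    intro p h1 h2 h3
    obtain ⟨_, h4 | ⟨v, _, h4⟩⟩ := Γ.treeEdges_bounds le_rfl (by omega) h3
    · omega
    · have := v.2
      omega
  rcases mem_allEdges.1 h with h | h <;> rcases mem_allEdges.1 h' with h' | h'
  · omega
  · exact (key h.2.1 h.2.2 h').elim
  · exact (key h'.2.1 h'.2.2 h).elim
  · exact Γ.treeEdges_unique hwf le_rfl (by omega) h h'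

theorem exists_parent (hv : Γ.verts = Set.univ) {w : ℕ} (hw : w < Γ.treeSize) (hwn : w ≠ n) :
    ∃ p, (p, w) ∈ Γ.allEdges := by
  simp only [mem_allEdges, exists_or]
  unfold treeSize at hw
  by_cases h1 : n + 1 ≤ w ∧ w < n + 6
  · exact Or.inl ⟨n, by omega⟩
  · refine Or.inr (Γ.exists_treeEdge ?_)
    by_cases h2 : w < n
    · exact Or.inr ⟨⟨w, h2⟩, hv ▸ Set.mem_univ _, rfl⟩
    · exact Or.inl (by omega)

theorem not_mem_allEdges_leaf {l : ℕ} (h1 : n + 1 ≤ l) (h2 : l < n + 6) (w : ℕ) :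
    (l, w) ∉ Γ.allEdges := by
  intro hw
  rcases mem_allEdges.1 hw with h | h
  · omega
  · have := (Γ.treeEdges_bounds le_rfl (by omega) h).1
    omega

theorem treeIn (hwf : Γ.WellFormed) : TreeIn Γ.allEdges Γ n (n + 6) := by
  refine ⟨le_rfl, by omega, fun p w h => mem_allEdges.2 (Or.inr h), fun p w h1 h2 h3 => ?_,
    fun p w h => (allEdges_bounds h).1, fun p p' w => allEdges_unique hwf⟩
  exact (mem_allEdges.1 h3).resolve_left (by omega)

theorem childLeafCount_root : childLeafCount Γ.allEdges n = 5 := by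
  refine childLeafCount_eq_of_Ico (k := n + 1) fun l => ⟨fun ⟨h1, h2⟩ => ?_, fun h =>
    ⟨mem_allEdges.2 (Or.inl (by omega)), not_mem_allEdges_leaf h.1 (by omega)⟩⟩
  rcases mem_allEdges.1 h1 with h | h
  · omega
  · obtain ⟨w, hw⟩ := Γ.exists_grandchild le_rfl (by omega) h
    exact absurd (mem_allEdges.2 (Or.inr hw)) (h2 w)

theorem nodeFacts (hwf : Γ.WellFormed) (hv : Γ.verts = Set.univ) {x : ℕ} (hx : x < Γ.treeSize)
    (hxn : x ≠ n) : NodeFacts n Γ.allEdges x := by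
  unfold treeSize at hx
  by_cases h1 : n + 1 ≤ x ∧ x < n + 6
  · have h2 := fun w => not_mem_allEdges_leaf (Γ := Γ) h1.1 h1.2 w
    refine ⟨?_, fun _ => Or.inr ⟨n, if x = n + 1 then n + 2 else n + 1, ?_,
      mem_allEdges.2 (Or.inl ?_), mem_allEdges.2 (Or.inl ?_), not_mem_allEdges_leaf ?_ ?_⟩,
      fun h => by omega⟩
    · rw [childLeafCount_eq_zero fun l hl => absurd hl (h2 l)]
      omega
    all_goals (try split_ifs) <;> omega
  · refine ((treeIn hwf).represents hwf).2 x ?_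
    by_cases h2 : x < n
    · exact Or.inr ⟨⟨x, h2⟩, hv ▸ Set.mem_univ _, rfl⟩
    · exact Or.inl (by omega)

/-- The tree of an expression. -/
def tree (Γ : CWExpr γ (Fin n)) : SimpleGraph (Fin Γ.treeSize) where
  Adj u v := ((u : ℕ), (v : ℕ)) ∈ Γ.allEdges ∨ ((v : ℕ), (u : ℕ)) ∈ Γ.allEdges
  symm := ⟨fun _ _ h => h.symm⟩
  loopless := ⟨fun u h => by have := allEdges_bounds (h.elim id id); omega⟩

/-- The root of the tree. -/
def root (Γ : CWExpr γ (Fin n)) : Fin Γ.treeSize := ⟨n, by unfold treeSize; omega⟩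

/-- `p` is the parent of `w`. -/
def Parent (Γ : CWExpr γ (Fin n)) (p w : Fin Γ.treeSize) : Prop :=
  ((p : ℕ), (w : ℕ)) ∈ Γ.allEdges

theorem isRootedTree (hwf : Γ.WellFormed) (hv : Γ.verts = Set.univ) :
    IsRootedTree Γ.tree Γ.Parent Γ.root := by
  refine ⟨fun u v => Iff.rfl, fun p p' w h h' => Fin.ext (allEdges_unique hwf h h'),
    fun p h => ?_, fun w hw => ?_, ?_⟩
  · have := allEdges_bounds h
    have e : (Γ.root : ℕ) = n := rfl
    omega
  · obtain ⟨p, hp⟩ := exists_parent hv w.2 fun e => hw (Fin.ext e)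
    exact ⟨⟨p, (allEdges_bounds hp).2.1⟩, hp⟩
  -- Numbers increase from parent to child except at the vertices, which have small numbers but no
  -- children; they are moved to the top of the order.
  · refine Subrelation.wf (r := InvImage (· < ·) fun w : Fin Γ.treeSize =>
      if (w : ℕ) < n then Γ.treeSize else w) (fun {p w} h => ?_) (InvImage.wf _ wellFounded_lt)
    have := allEdges_bounds h
    simp only [InvImage]
    rw [if_neg (by omega)]
    split_ifs <;> omega

theorem not_isLeaf_root : ¬ Γ.tree.IsLeaf Γ.root := by
  intro h
  have e := h ⟨n + 1, by unfold treeSize; omega⟩ ⟨n + 2, by unfold treeSize; omega⟩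
    (Or.inl (mem_allEdges.2 (Or.inl ⟨rfl, by simp, by simp⟩)))
    (Or.inl (mem_allEdges.2 (Or.inl ⟨rfl, by simp, by simp⟩)))
  have := congrArg Fin.val e
  simp at this

theorem leafCount_tree (hwf : Γ.WellFormed) (hv : Γ.verts = Set.univ) (x : Fin Γ.treeSize) :
    Γ.tree.leafCount x = childLeafCount Γ.allEdges x := by
  rw [(isRootedTree hwf hv).leafCount_eq not_isLeaf_root, childLeafCount,
    ← Set.ncard_image_of_injective _ Fin.val_injective]
  congr 1
  ext l
  constructor
  · rintro ⟨l, ⟨h1, h2⟩, rfl⟩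
    exact ⟨h1, fun w hw => h2 ⟨w, (allEdges_bounds hw).2.2.1⟩ hw⟩
  · rintro ⟨h1, h2⟩
    exact ⟨⟨l, (allEdges_bounds h1).2.2.1⟩, ⟨h1, fun w => h2 w⟩, rfl⟩

theorem five_le_leafCount_iff (hwf : Γ.WellFormed) (hv : Γ.verts = Set.univ)
    (x : Fin Γ.treeSize) : 5 ≤ Γ.tree.leafCount x ↔ x = Γ.root := by
  rw [leafCount_tree hwf hv]
  constructor
  · intro h
    by_contra hx
    have := (nodeFacts hwf hv x.2 fun e => hx (Fin.ext e)).count_le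
    omega
  · rintro rfl
    exact childLeafCount_root.ge

theorem le_treeSize (Γ : CWExpr γ (Fin n)) : n ≤ Γ.treeSize := by unfold treeSize; omega

/-- Leaves used as marks have sibling leaves, by `twin`; vertices of the graph have none, by `only`.
-/
theorem dom_iff (hwf : Γ.WellFormed) (hv : Γ.verts = Set.univ) (x : Fin Γ.treeSize) :
    (Γ.tree.IsLeaf x ∧ ∀ z y, Γ.tree.Adj x z → Γ.tree.Adj z y → Γ.tree.IsLeaf y → y = x) ↔
      (x : ℕ) < n := by
  have ht := isRootedTree hwf hv
  simp only [ht.isLeaf_iff not_isLeaf_root]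
  constructor
  · rintro ⟨h1, h2⟩
    by_contra hx
    have hxr : (x : ℕ) ≠ n := fun e => h1 ⟨n + 1, by unfold treeSize; omega⟩
      (mem_allEdges.2 (Or.inl ⟨e, by simp, by simp⟩))
    rcases (nodeFacts hwf hv x.2 hxr).twin (by omega) with ⟨w, hw⟩ | ⟨p, y, hne, hp, hy, h3⟩
    · exact h1 ⟨w, (allEdges_bounds hw).2.2.1⟩ hw
    · exact hne (congrArg Fin.val (h2 ⟨p, (allEdges_bounds hp).2.1⟩
        ⟨y, (allEdges_bounds hy).2.2.1⟩ (Or.inr hp) (Or.inl hy) fun w => h3 w))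
  · intro hx
    have h1 : ∀ w, ¬ Γ.Parent x w := fun w hw => by have := allEdges_bounds hw; omega
    refine ⟨h1, fun z y hz hy hl => ?_⟩
    have hz' := hz.resolve_left (h1 z)
    exact Fin.ext ((nodeFacts hwf hv x.2 (by omega)).only hx z y hz' (hy.resolve_right (hl z)))

/-- Tokens in the tree detect the adjacency. -/
theorem adj_iff_tree (hwf : Γ.WellFormed) (hv : Γ.verts = Set.univ) (u v : Fin n) :
    Γ.Adj u v ↔ Fin.castLE Γ.le_treeSize u ≠ Fin.castLE Γ.le_treeSize v ∧
      ∃ a b, Γ.tree.leafCount a = 3 ∧ Near Γ.Parent Γ.tree.leafCount a b ∧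
      ((ReflTransGen (TokenStep Γ.Parent Γ.tree.leafCount (γ + 1)) (Fin.castLE Γ.le_treeSize u) a ∧
        ReflTransGen (TokenStep Γ.Parent Γ.tree.leafCount (γ + 1)) (Fin.castLE Γ.le_treeSize v) b) ∨
      (ReflTransGen (TokenStep Γ.Parent Γ.tree.leafCount (γ + 1)) (Fin.castLE Γ.le_treeSize v) a ∧
        ReflTransGen (TokenStep Γ.Parent Γ.tree.leafCount (γ + 1))
          (Fin.castLE Γ.le_treeSize u) b)) := by
  obtain ⟨D, _, hD⟩ := ((treeIn hwf).represents hwf).1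
  have h1 := Represents.lift (N := Γ.treeSize) (ι := Fin.castLE Γ.le_treeSize) (c := Γ.root)
    (fun p w h => (allEdges_bounds h).2.2.1) hD
  rw [funext (leafCount_tree hwf hv)]
  rw [h1.adj_iff (isRootedTree hwf hv) (hv ▸ Set.mem_univ u) (hv ▸ Set.mem_univ v),
    Ne, Ne, Fin.castLE_inj]

end CWExpr

/-! ### ### The words of the formulas -/

open Relation

namespace MSO1

@[simp] theorem liftVar_zero {p p' : ℕ} (ρ : Fin p → Fin p') : liftVar ρ 0 = 0 := rfl

@[simp] theorem liftVar_succ {p p' : ℕ} (ρ : Fin p → Fin p') (x : Fin p) :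
    liftVar ρ x.succ = (ρ x).succ := rfl

@[simp] theorem liftVar_liftVar_one {p p' : ℕ} (ρ : Fin p → Fin p') :
    liftVar (liftVar ρ) 1 = 1 := rfl

theorem val_liftVar {p p' : ℕ} {ρ : Fin p → Fin p'} (h : ∀ x, (ρ x : ℕ) = x) (x : Fin (p + 1)) :
    (liftVar ρ x : ℕ) = x := by
  cases x using Fin.cases with
  | zero => rfl
  | succ x => simp [h]

/-- A word records only the numerical values of the indices, so enlarging the context leaves it
unchanged. This is why a machine can write these subformulas as fixed words, whatever the context.
-/
theorem code_rename {p q p' q' : ℕ} {ρ : Fin p → Fin p'} {σ : Fin q → Fin q'} (φ : MSO1 p q)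
    (hρ : ∀ x, (ρ x : ℕ) = x) (hσ : ∀ x, (σ x : ℕ) = x) : (φ.rename ρ σ).code = φ.code := by
  induction φ generalizing p' q' with
  | eq x y => simp [rename, code, hρ]
  | edge x y => simp [rename, code, hρ]
  | mem x X => simp [rename, code, hρ, hσ]
  | not φ ih => simp [rename, code, ih hρ hσ]
  | and φ χ ih1 ih2 => simp [rename, code, ih1 hρ hσ, ih2 hρ hσ]
  | or φ χ ih1 ih2 => simp [rename, code, ih1 hρ hσ, ih2 hρ hσ]
  | imp φ χ ih1 ih2 => simp [rename, code, ih1 hρ hσ, ih2 hρ hσ]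
  | iff φ χ ih1 ih2 => simp [rename, code, ih1 hρ hσ, ih2 hρ hσ]
  | exV φ ih => simp [rename, code, ih (val_liftVar hρ) hσ]
  | allV φ ih => simp [rename, code, ih (val_liftVar hρ) hσ]
  | exS φ ih => simp [rename, code, ih hρ (val_liftVar hσ)]
  | allS φ ih => simp [rename, code, ih hρ (val_liftVar hσ)]

section rename

variable {p q p' q' : ℕ} (ρ : Fin p → Fin p') (σ : Fin q → Fin q')

@[simp] theorem rename_leafF (x : Fin p) : (leafF x).rename ρ σ = leafF (ρ x) := by
  simp [leafF, rename]

@[simp] theorem rename_geF (k : ℕ) (x : Fin p) (xs : List (Fin p)) :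
    (geF k x xs).rename ρ σ = geF k (ρ x) (xs.map ρ) := by
  have fold : ∀ {p q p' q' : ℕ} (ρ : Fin p → Fin p') (σ : Fin q → Fin q') (xs : List (Fin p))
      (φ : MSO1 (p + 1) q),
      (xs.foldr (fun z φ => .and (.not (.eq 0 z.succ)) φ) φ).rename (liftVar ρ) σ =
        (xs.map ρ).foldr (fun z φ => .and (.not (.eq 0 z.succ)) φ) (φ.rename (liftVar ρ) σ) := by
    intro p q p' q' ρ σ xs φ
    induction xs with
    | nil => rfl
    | cons z xs ih => simp [rename, ih]
  induction k generalizing p q p' q' with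
  | zero => simp [geF, rename]
  | succ k ih => simp [geF, rename, fold, ih, Function.comp_def]

@[simp] theorem rename_ancF (x y : Fin p) : (ancF x y).rename ρ σ = ancF (ρ x) (ρ y) := by
  simp [ancF, rename]

@[simp] theorem rename_parF (x y : Fin p) : (parF x y).rename ρ σ = parF (ρ x) (ρ y) := by
  simp [parF, rename]

@[simp] theorem rename_nearF (x y : Fin p) : (nearF x y).rename ρ σ = nearF (ρ x) (ρ y) := by
  simp [nearF, rename]

@[simp] theorem rename_climbF (k : ℕ) :
    (climbF k p q).rename (liftVar ρ) (liftVar σ) = climbF k p' q' := by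
  induction k generalizing p p' with
  | zero => simp [climbF, rename]
  | succ k ih => simp [climbF, rename, ih]

@[simp] theorem rename_closedF (M : ℕ) :
    (closedF M p q).rename ρ (liftVar σ) = closedF M p' q' := by
  simp [closedF, rename]

@[simp] theorem rename_meetF (M : ℕ) (x y : Fin p) :
    (meetF M x y).rename ρ σ = meetF M (ρ x) (ρ y) := by
  simp [meetF, rename]

@[simp] theorem rename_etaF (M : ℕ) (x y : Fin p) :
    (etaF M x y).rename ρ σ = etaF M (ρ x) (ρ y) := by
  simp [etaF, rename]

@[simp] theorem rename_domF (x : Fin p) : (domF x).rename ρ σ = domF (ρ x) := by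
  simp [domF, rename]

end rename

/-- The word of `domF 0`. -/
def domWord : List ℕ := (domF 0 : MSO1 1 0).code

theorem code_domF {p q : ℕ} : (domF 0 : MSO1 (p + 1) q).code = domWord := by
  rw [domWord, ← code_rename (p' := p + 1) (q' := q) (ρ := fun _ => 0) (σ := Fin.elim0) (domF 0)
    (fun x => by rw [Subsingleton.elim x 0]; rfl) (fun x => x.elim0), rename_domF]

/-- The repeated part of the word of `climbF`. -/
def climbWord : List ℕ := 9 :: 6 :: (parF (Fin.succ 0) 0 : MSO1 2 0).code

/-- At every level the formula speaks about the indices `1` and `0`, so the same word is repeated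
`k` times; a counting loop can write it. -/
theorem code_climbF {k p q : ℕ} :
    (climbF k p q).code = (List.replicate k climbWord).flatten ++ [2, 0, 0] := by
  induction k generalizing p with
  | zero => simp [climbF, code]
  | succ k ih =>
    have h : (parF (Fin.succ 0) 0 : MSO1 (p + 2) (q + 1)).code =
        (parF (Fin.succ 0) 0 : MSO1 2 0).code := by
      rw [← code_rename (p' := p + 2) (q' := q + 1) (ρ := Fin.castLE (by omega)) (σ := Fin.elim0)
        (parF (Fin.succ 0) 0 : MSO1 2 0) (fun x => rfl) (fun x => x.elim0), rename_parF]
      rfl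
    simp [climbF, code, ih, List.replicate_succ, climbWord, h, -Fin.succ_zero_eq_one, -Fin.succ_zero_eq_one']

/-- The part of the word of `meetF` before the word of `climbF`. -/
def preWord : List ℕ :=
  8 :: 8 :: 4 :: ((.and (geF 3 (Fin.succ 0) []) (.not (geF 4 (Fin.succ 0) [])) : MSO1 4 0).code ++
    4 :: ((nearF (Fin.succ 0) 0 : MSO1 4 0).code ++
      11 :: 6 :: 4 :: 9 :: 6 :: (.and (.mem 0 0) (.not (geF 4 0 [])) : MSO1 5 1).code))

/-- The part of the word of `meetF` after the word of `climbF`. -/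
def postWord : List ℕ :=
  (.allV (.allV (.imp (.and (.mem (Fin.succ 0) 0) (.and (geF 4 (Fin.succ 0) [])
      (nearF (Fin.succ 0) 0))) (.mem 0 0))) : MSO1 4 1).code ++
    (.and (.imp (.mem (Fin.succ 0).succ.succ 0) (.mem (Fin.succ 0) 0))
        (.imp (.mem (Fin.succ (Fin.succ 0)) 0) (.mem 0 0)) : MSO1 4 1).code

theorem code_meetF {M p q : ℕ} : (meetF M (Fin.succ 0) 0 : MSO1 (p + 2) q).code =
    preWord ++ (List.replicate M climbWord).flatten ++ 2 :: 0 :: 0 :: postWord := by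
  have h : (meetF M (Fin.succ 0) 0 : MSO1 (p + 2) q).code =
      (meetF M (Fin.succ 0) 0 : MSO1 2 0).code := by
    rw [← code_rename (p' := p + 2) (q' := q) (ρ := Fin.castLE (by omega)) (σ := Fin.elim0)
      (meetF M (Fin.succ 0) 0 : MSO1 2 0) (fun x => rfl) (fun x => x.elim0), rename_meetF]
    rfl
  rw [h]
  simp only [meetF, closedF, code, code_climbF, preWord, postWord, List.append_assoc,
    List.cons_append, List.nil_append]

/-- The word of `etaF (γ + 1) x y`. -/
def etaWord (γ x y : ℕ) : List ℕ :=
  [4, 3, 0, x, y, 8, 8, 4, 5, 4, 0, 1, x + 2, 0, 0, y + 2, 4, 0, 1, y + 2, 0, 0, x + 2] ++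
    (preWord ++ (List.replicate (γ + 1) climbWord).flatten ++ 2 :: 0 :: 0 :: postWord)

/-- Only a prefix of bounded length depends on `x` and `y`. Their indices grow by two under the two
quantifiers. -/
theorem code_etaF {γ p q : ℕ} (x y : Fin p) :
    (etaF (γ + 1) x y : MSO1 p q).code = etaWord γ x y := by
  simp [etaF, code, code_meetF, etaWord, -Fin.succ_zero_eq_one, -Fin.succ_zero_eq_one']

end MSO1

/-! ### ### The interpretation and the translation of formulas -/

open MSO1

/-- The interpretation of graphs of clique-width at most `γ` in trees. -/
def cliqueWidthInterpretation (γ : ℕ) : GraphInterpretation := ⟨domF 0, etaF (γ + 1) 0 (Fin.succ 0)⟩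

namespace GraphInterpretation

theorem domAt_cliqueWidth {γ p q : ℕ} (x : Fin p) :
    ((cliqueWidthInterpretation γ).domAt x : MSO1 p q) = domF x := by
  simp [cliqueWidthInterpretation, domAt]

theorem edgeAt_cliqueWidth {γ p q : ℕ} (x y : Fin p) :
    ((cliqueWidthInterpretation γ).edgeAt x y : MSO1 p q) = etaF (γ + 1) x y := by
  simp [cliqueWidthInterpretation, edgeAt]

variable {V W : Type*} {T : SimpleGraph W} {G : SimpleGraph V} {I : GraphInterpretation}
  {ι : V ↪ W}
  (hdom : ∀ {p q : ℕ} (x : Fin p) (a : Fin p → W) (A : Fin q → Set W),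
    (I.domAt x).Sat T a A ↔ a x ∈ Set.range ι)
include hdom

theorem sat_setInDom {p q : ℕ} (X : Fin q) (a : Fin p → W) (A : Fin q → Set W) :
    (I.setInDom X).Sat T a A ↔ A X ⊆ Set.range ι := by
  simp only [setInDom, Sat, hdom, Fin.cons_zero]
  rfl

/-- Relativized quantifiers range over the elements `ι v` and over the subsets of the range of `ι`,
which are exactly the images `ι '' S`. Quantifiers over `V` and their translations thus correspond.
-/
theorem sat_translate (hedge : ∀ {p q : ℕ} (x y : Fin p) (a : Fin p → V) (A : Fin q → Set W),
    (I.edgeAt x y).Sat T (ι ∘ a) A ↔ G.Adj (a x) (a y)) {p q : ℕ} (φ : MSO1 p q) (a : Fin p → V)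
    (A : Fin q → Set V) :
    (I.translate φ).Sat T (ι ∘ a) (fun X => ι '' A X) ↔ φ.Sat G a A := by
  have consV : ∀ {p : ℕ} (v : V) (a : Fin p → V), (Fin.cons (ι v) (ι ∘ a) : Fin (p + 1) → W) =
      ι ∘ (Fin.cons v a : Fin (p + 1) → V) := by
    intro p v a
    ext x
    cases x using Fin.cases <;> rfl
  have consS : ∀ {q : ℕ} (S : Set V) (A : Fin q → Set V),
      (Fin.cons (ι '' S) (fun X => ι '' A X) : Fin (q + 1) → Set W) =
      fun X => ι '' (Fin.cons S A : Fin (q + 1) → Set V) X := by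
    intro q S A
    ext X
    cases X using Fin.cases <;> rfl
  induction φ with
  | eq x y => simp [translate, Sat]
  | edge x y => simp [translate, Sat, hedge]
  | mem x X => simp [translate, Sat]
  | not φ ih => simp [translate, Sat, ih]
  | and φ χ ih1 ih2 => simp [translate, Sat, ih1, ih2]
  | or φ χ ih1 ih2 => simp [translate, Sat, ih1, ih2]
  | imp φ χ ih1 ih2 => simp [translate, Sat, ih1, ih2]
  | iff φ χ ih1 ih2 => simp [translate, Sat, ih1, ih2]
  | exV φ ih =>
    simp only [translate, Sat, hdom, Fin.cons_zero, ← ih]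
    constructor
    · rintro ⟨_, ⟨v, rfl⟩, h⟩
      exact ⟨v, by rwa [consV] at h⟩
    · rintro ⟨v, h⟩
      exact ⟨ι v, ⟨v, rfl⟩, by rwa [consV]⟩
  | allV φ ih =>
    simp only [translate, Sat, hdom, Fin.cons_zero, ← ih]
    constructor
    · intro h v
      have := h (ι v) ⟨v, rfl⟩
      rwa [consV] at this
    · rintro h _ ⟨v, rfl⟩
      rw [consV]
      exact h v
  | exS φ ih =>
    simp only [translate, Sat, sat_setInDom hdom, Fin.cons_zero, ← ih]
    constructor
    · rintro ⟨S, hS, h⟩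
      obtain ⟨S, rfl⟩ := Set.subset_range_iff_exists_image_eq.1 hS
      exact ⟨S, by rwa [consS] at h⟩
    · rintro ⟨S, h⟩
      exact ⟨ι '' S, Set.image_subset_range _ _, by rwa [consS]⟩
  | allS φ ih =>
    simp only [translate, Sat, sat_setInDom hdom, Fin.cons_zero, ← ih]
    constructor
    · intro h S
      have := h (ι '' S) (Set.image_subset_range _ _)
      rwa [consS] at this
    · intro h S hS
      obtain ⟨S, rfl⟩ := Set.subset_range_iff_exists_image_eq.1 hS
      rw [consS]
      exact h S

end GraphInterpretation

namespace CWExpr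

variable {γ n : ℕ} {Γ : CWExpr γ (Fin n)} {G : SimpleGraph (Fin n)} (hG : Γ.Constructs G)
include hG

theorem sat_domF_tree {p q : ℕ} (x : Fin p) (a : Fin p → Fin Γ.treeSize)
    (A : Fin q → Set (Fin Γ.treeSize)) :
    (domF x).Sat Γ.tree a A ↔ a x ∈ Set.range (Fin.castLEEmb Γ.le_treeSize) := by
  rw [sat_domF, dom_iff hG.1 hG.2.1]
  constructor
  · exact fun h => ⟨⟨a x, h⟩, rfl⟩
  · rintro ⟨v, hv⟩
    rw [← hv]
    exact v.2

theorem sat_etaF_tree {p q : ℕ} (x y : Fin p) (a : Fin p → Fin Γ.treeSize)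
    (A : Fin q → Set (Fin Γ.treeSize)) {u v : Fin n} (hu : a x = Fin.castLEEmb Γ.le_treeSize u)
    (hv : a y = Fin.castLEEmb Γ.le_treeSize v) :
    (etaF (γ + 1) x y).Sat Γ.tree a A ↔ G.Adj u v := by
  rw [(isRootedTree hG.1 hG.2.1).sat_etaF (five_le_leafCount_iff hG.1 hG.2.1), hG.2.2,
    adj_iff_tree hG.1 hG.2.1, hu, hv]
  rfl

theorem interprets_tree : (cliqueWidthInterpretation γ).Interprets Γ.tree G
    (Fin.castLEEmb Γ.le_treeSize) := by
  refine ⟨?_, fun u v => sat_etaF_tree hG _ _ _ _ rfl rfl⟩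
  ext w
  exact sat_domF_tree hG 0 ![w] _

theorem models_translate (ψ : MSO1 0 1) (X : Set (Fin Γ.treeSize)) :
    (MSO1.and ((cliqueWidthInterpretation γ).setInDom 0)
      ((cliqueWidthInterpretation γ).translate ψ)).Models Γ.tree X ↔
      X ⊆ Set.range (Fin.castLE Γ.le_treeSize) ∧
        ψ.Models G (Fin.castLE Γ.le_treeSize ⁻¹' X) := by
  have hdom : ∀ {p q : ℕ} (x : Fin p) (a : Fin p → Fin Γ.treeSize)
      (A : Fin q → Set (Fin Γ.treeSize)),
      ((cliqueWidthInterpretation γ).domAt x).Sat Γ.tree a A ↔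
        a x ∈ Set.range (Fin.castLEEmb Γ.le_treeSize) := fun x a A => by
    rw [GraphInterpretation.domAt_cliqueWidth, sat_domF_tree hG]
  rw [Models, Sat, GraphInterpretation.sat_setInDom hdom]
  refine and_congr_right fun hX => ?_
  rw [Models, ← GraphInterpretation.sat_translate hdom (G := G) (fun x y a A => by
    rw [GraphInterpretation.edgeAt_cliqueWidth]
    exact sat_etaF_tree hG x y _ A rfl rfl)]
  refine iff_of_eq ?_
  congr 1
  · exact Subsingleton.elim _ _
  · funext _
    exact (Set.image_preimage_eq_of_subset hX).symm

end CWExpr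

/-! ### ### Running times of programs -/

namespace RAM

/-- `P`, started in `s`, halts in `s'` after at most `b` steps. -/
def Runs (P : Prog) (s : State) (b : ℕ) (s' : State) : Prop := ∃ t ≤ b, Exec P s t s'

theorem Runs.mono {P : Prog} {s s' : State} {b b' : ℕ} (h : Runs P s b s') (hb : b ≤ b') :
    Runs P s b' s' := h.imp fun _ ht => ⟨ht.1.trans hb, ht.2⟩

theorem Runs.seq {P Q : Prog} {s s' s'' : State} {b b' : ℕ} (h : Runs P s b s')
    (h' : Runs Q s' b' s'') : Runs (.seq P Q) s (b + b') s'' := by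
  obtain ⟨t, ht, h⟩ := h
  obtain ⟨t', ht', h'⟩ := h'
  exact ⟨t + t', Nat.add_le_add ht ht', Exec.seq h h'⟩

theorem Runs.whileDone {P : Prog} {s : State} {a : ℕ} (h : s.mem a = 0) :
    Runs (.whileNZ a P) s 1 s := ⟨1, le_rfl, Exec.whileDone h⟩

theorem Runs.whileStep {P : Prog} {s s' s'' : State} {a b b' : ℕ} (h0 : s.mem a ≠ 0)
    (h : Runs P s b s') (h' : Runs (.whileNZ a P) s' b' s'') :
    Runs (.whileNZ a P) s (b + 1 + b') s'' := by
  obtain ⟨t, ht, h⟩ := h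
  obtain ⟨t', ht', h'⟩ := h'
  exact ⟨t + 1 + t', by omega, Exec.whileStep h0 h h'⟩

/-- Programs without tests. -/
def Prog.Straight : Prog → Prop
  | .seq P Q => P.Straight ∧ Q.Straight
  | .ifNZ _ _ _ => False
  | .whileNZ _ _ => False
  | _ => True

/-- The number of steps of a straight-line program. -/
def Prog.cost : Prog → ℕ
  | .seq P Q => P.cost + Q.cost
  | _ => 1

/-- The effect of a straight-line program. -/
def Prog.eff : Prog → State → State
  | .const a c, s => s.set a c
  | .copy a b, s => s.set a (s.mem b)
  | .inc a, s => s.set a (s.mem a + 1)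
  | .dec a, s => s.set a (s.mem a - 1)
  | .load a b, s => s.set a (s.mem (s.mem b))
  | .store a b, s => s.set (s.mem a) (s.mem b)
  | .read a, s => { s.set a (s.inp.headD 0) with inp := s.inp.tail }
  | .write a, s => { s with out := s.out ++ [s.mem a] }
  | .seq P Q, s => Q.eff (P.eff s)
  | .ifNZ _ _ _, s => s
  | .whileNZ _ _, s => s

/-- Code without tests has a computable effect, so `simp` can execute it; only loops and case
distinctions need separate arguments. -/
theorem runs_eff {P : Prog} (h : P.Straight) (s : State) : Runs P s P.cost (P.eff s) := by
  induction P generalizing s with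
  | seq P Q ih1 ih2 => exact (ih1 h.1 s).seq (ih2 h.2 _)
  | ifNZ => exact h.elim
  | whileNZ => exact h.elim
  | const a c => exact ⟨1, le_rfl, .const a c s⟩
  | copy a c => exact ⟨1, le_rfl, .copy a c s⟩
  | inc a => exact ⟨1, le_rfl, .inc a s⟩
  | dec a => exact ⟨1, le_rfl, .dec a s⟩
  | load a c => exact ⟨1, le_rfl, .load a c s⟩
  | store a c => exact ⟨1, le_rfl, .store a c s⟩
  | read a => exact ⟨1, le_rfl, .read a s⟩
  | write a => exact ⟨1, le_rfl, .write a s⟩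

/-- Programs in sequence. -/
def block : List Prog → Prog
  | [] => .copy 9 9
  | [P] => P
  | P :: Q :: Ps => .seq P (block (Q :: Ps))

/-- Do the `m`-th program if the cell `a` contains `m`. -/
def switch (a : ℕ) : List Prog → Prog
  | [] => .copy 9 9
  | P :: Ps => .ifNZ a (.seq (.dec a) (switch a Ps)) P

/-- Each skipped case costs a test and a decrement. The cell has been counted down to `0` when the
selected program starts. -/
theorem Runs.switch {a b : ℕ} {Ps : List Prog} {m : ℕ} {P : Prog} {s s' : State}
    (hP : Ps[m]? = some P) (hm : s.mem a = m) (h : Runs P (s.set a 0) b s') :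
    Runs (switch a Ps) s (2 * m + 1 + b) s' := by
  induction m generalizing Ps s with
  | zero =>
    cases Ps with
    | nil => simp at hP
    | cons Q Ps =>
      obtain rfl : Q = P := by simpa using hP
      have : s.set a 0 = s := by
        rw [State.set, ← hm, Function.update_eq_self]
      rw [this] at h
      obtain ⟨t, ht, h⟩ := h
      exact ⟨t + 1, by omega, Exec.ifFalse hm h⟩
  | succ m ih =>
    cases Ps with
    | nil => simp at hP
    | cons Q Ps =>
      have h1 : (s.set a m).set a 0 = s.set a 0 := by simp [State.set]
      obtain ⟨t, ht, h2⟩ := ih (Ps := Ps) (s := s.set a m) (by simpa using hP) (by simp [State.set])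
        (h1 ▸ h)
      refine ⟨1 + t + 1, by omega, Exec.ifTrue (by omega) (Exec.seq (Exec.dec a s) ?_)⟩
      rw [hm]
      exact h2

/-- The two states agree on the cells outside `R`. -/
def Same (R : List ℕ) (s s' : State) : Prop := ∀ a, a ∉ R → s'.mem a = s.mem a

/-- Write the numbers in `l`. -/
def emit : List ℕ → Prog
  | [] => .const 9 0
  | c :: l => .seq (.seq (.const 9 c) (.write 9)) (emit l)

theorem straight_emit (l : List ℕ) : (emit l).Straight := by
  induction l with
  | nil => trivial
  | cons c l ih => exact ⟨⟨trivial, trivial⟩, ih⟩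

theorem cost_emit (l : List ℕ) : (emit l).cost = 2 * l.length + 1 := by
  induction l with
  | nil => rfl
  | cons c l ih => simp [emit, Prog.cost, ih]; omega

theorem eff_emit (l : List ℕ) (s : State) :
    (emit l).eff s = ⟨Function.update s.mem 9 0, s.inp, s.out ++ l⟩ := by
  induction l generalizing s with
  | nil => simp [emit, Prog.eff, State.set]
  | cons c l ih => simp [emit, Prog.eff, State.set, ih]

/-! ### ### Programs that write paths and leaves -/

/-- The records of a list of edges. -/
def records (L : List (ℕ × ℕ)) : List ℕ := L.flatMap fun e => [1, e.1, e.2]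

theorem records_append (L L' : List (ℕ × ℕ)) : records (L ++ L') = records L ++ records L' := by
  simp [records]

theorem records_cons (e : ℕ × ℕ) (L : List (ℕ × ℕ)) :
    records (e :: L) = 1 :: e.1 :: e.2 :: records L := by
  simp [records]

/-- The bottom node of a path of `t` new nodes. -/
def chainEnd (c k t : ℕ) : ℕ := if t = 0 then c else k + t - 1

theorem chainEnd_succ (c k t : ℕ) : chainEnd k (k + 1) t = chainEnd c k (t + 1) := by
  unfold chainEnd
  rw [if_neg (Nat.succ_ne_zero t)]
  split_ifs <;> omega

theorem chainEdges_add (c k s t : ℕ) :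
    chainEdges c k (s + t) = chainEdges c k s ++ chainEdges (chainEnd c k s) (k + s) t := by
  induction s generalizing c k with
  | zero => simp [chainEdges, chainEnd]
  | succ s ih =>
    rw [Nat.succ_add]
    simp only [chainEdges, ih, List.cons_append, chainEnd_succ c]
    rw [show k + 1 + s = k + (s + 1) by omega]

/-- Add a child of the node in cell `3`, and move there. The next new node is in cell `0`. -/
def addChild : Prog :=
  block [.const 9 1, .write 9, .write 3, .write 0, .copy 3 0, .inc 0]

/-- Add a path whose length is in the cell `a`; the cell `b` is decreased, too. -/
def addChain (a b : ℕ) : Prog := .whileNZ a (block [addChild, .dec a, .dec b])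

/-- The second cell makes the loop perform a subtraction, for which the machine has no instruction.
-/
theorem runs_addChain {a b : ℕ} (ha : a ∉ [0, 3, 9]) (hb : b ∉ [0, 3, 9, a]) {t : ℕ} {s : State}
    (ht : s.mem a = t) : ∃ s', Runs (addChain a b) s (11 * t + 1) s' ∧ s'.inp = s.inp ∧
      s'.out = s.out ++ records (chainEdges (s.mem 3) (s.mem 0) t) ∧ s'.mem 0 = s.mem 0 + t ∧
      s'.mem 3 = chainEnd (s.mem 3) (s.mem 0) t ∧ s'.mem a = 0 ∧ s'.mem b = s.mem b - t ∧
      Same [0, 3, 9, a, b] s s' := by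
  simp only [List.mem_cons, List.not_mem_nil, or_false, not_or] at ha hb
  obtain ⟨ha0, ha3, ha9⟩ := ha
  obtain ⟨hb0, hb3, hb9, hba⟩ := hb
  induction t generalizing s with
  | zero =>
    exact ⟨s, Runs.whileDone ht, rfl, by simp [chainEdges, records], rfl, by simp [chainEnd], ht,
      rfl, fun _ _ => rfl⟩
  | succ t ih =>
    have h1 := runs_eff (P := block [addChild, .dec a, .dec b])
      (by simp [block, addChild, Prog.Straight]) s
    have hc : (block [addChild, .dec a, .dec b]).cost ≤ 10 := by
      simp [block, addChild, Prog.cost]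
    obtain ⟨s', h2, h3, h4, h5, h6, h7, h8, h9⟩ := ih (s := (block [addChild, .dec a, .dec b]).eff s)
      (by simp [block, addChild, Prog.eff, State.set, Function.update_apply, ht, ha0, ha3, ha9,
        Ne.symm hba])
    refine ⟨s', (h1.whileStep (by omega) h2).mono (by omega), ?_, ?_, ?_, ?_, h7, ?_, ?_⟩
    · rw [h3]
      simp [block, addChild, Prog.eff, State.set]
    · rw [h4]
      simp [block, addChild, Prog.eff, State.set, Function.update_apply, chainEdges, records_cons,
        Ne.symm ha0, Ne.symm ha3, Ne.symm hb0, Ne.symm hb3]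
    · rw [h5]
      simp [block, addChild, Prog.eff, State.set, Function.update_apply, Ne.symm ha0, Ne.symm hb0]
      omega
    · rw [h6, ← chainEnd_succ]
      simp [block, addChild, Prog.eff, State.set, Function.update_apply, Ne.symm ha0, Ne.symm hb0,
        Ne.symm ha3, Ne.symm hb3]
    · rw [h8]
      simp [block, addChild, Prog.eff, State.set, Function.update_apply, hb0, hb3, hb9, hba]
      omega
    · intro d hd
      rw [h9 d hd]
      simp only [List.mem_cons, List.not_mem_nil, or_false, not_or] at hd
      simp [block, addChild, Prog.eff, State.set, Function.update_apply, hd]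

/-- Add `m` leaves to the node in the cell `a`. -/
def addLeaves (a : ℕ) : ℕ → Prog
  | 0 => .copy a a
  | m + 1 => .seq (block [.const 9 1, .write 9, .write a, .write 0, .inc 0]) (addLeaves a m)

theorem runs_addLeaves {a : ℕ} (ha : a ∉ [0, 9]) (m : ℕ) (s : State) :
    ∃ s', Runs (addLeaves a m) s (6 * m + 1) s' ∧ s'.inp = s.inp ∧
      s'.out = s.out ++ records (leafEdges (s.mem a) (s.mem 0) m) ∧ s'.mem 0 = s.mem 0 + m ∧
      Same [0, 9] s s' := by
  simp only [List.mem_cons, List.not_mem_nil, or_false, not_or] at ha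
  induction m generalizing s with
  | zero =>
    refine ⟨s, ?_, rfl, by simp [leafEdges, records], rfl, fun _ _ => rfl⟩
    have h1 := runs_eff (P := .copy a a) trivial s
    rwa [show Prog.eff (.copy a a) s = s by simp [Prog.eff, State.set]] at h1
  | succ m ih =>
    have h1 := runs_eff (P := block [.const 9 1, .write 9, .write a, .write 0, .inc 0])
      (by simp [block, Prog.Straight]) s
    obtain ⟨s', h2, h3, h4, h5, h6⟩ :=
      ih ((block [.const 9 1, .write 9, .write a, .write 0, .inc 0]).eff s)
    refine ⟨s', (h1.seq h2).mono ?_, ?_, ?_, ?_, ?_⟩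
    · simp [block, Prog.cost]
      omega
    · rw [h3]
      simp [block, Prog.eff, State.set]
    · rw [h4]
      simp [block, Prog.eff, State.set, leafEdges, records_cons, ha]
    · rw [h5]
      simp [block, Prog.eff, State.set]
      omega
    · intro d hd
      rw [h6 d hd]
      simp only [List.mem_cons, List.not_mem_nil, or_false, not_or] at hd
      simp [block, Prog.eff, State.set, Function.update_apply, hd]

/-- Add a block with `m` leaves for the label in cell `4`. The number of labels is in cell `1`. -/
def addBlock (m : ℕ) : Prog :=
  .seq (block [.copy 5 1, addChild, .inc 4]) (.seq (addChain 4 5)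
    (.seq (.copy 6 3) (.seq (addChain 5 4) (addLeaves 6 m))))

/-- After the spare node, `j + 1` nodes end at the node to be marked, which is saved in cell `6`.
The same loop leaves in cell `5` the number `γ - (j + 1)` of nodes still missing. -/
theorem runs_addBlock {m γ j c k : ℕ} {s : State} (hγ : s.mem 1 = γ) (hj : s.mem 4 = j)
    (hjγ : j < γ) (hc : s.mem 3 = c) (hk : s.mem 0 = k) :
    ∃ s', Runs (addBlock m) s (11 * γ + 6 * m + 40) s' ∧ s'.inp = s.inp ∧
      s'.out = s.out ++ records (blockEdges γ c k j m) ∧ s'.mem 0 = k + γ + 1 + m ∧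
      s'.mem 3 = k + γ ∧ Same [0, 3, 4, 5, 6, 9] s s' := by
  have h1 := runs_eff (P := block [.copy 5 1, addChild, .inc 4])
      (by simp [block, addChild, Prog.Straight]) s
  set s₁ := (block [.copy 5 1, addChild, .inc 4]).eff s with hs₁
  have e1 : s₁.inp = s.inp := by simp [hs₁, block, addChild, Prog.eff, State.set]
  have e2 : s₁.out = s.out ++ [1, c, k] := by
    simp [hs₁, block, addChild, Prog.eff, State.set, hc, hk]
  have e3 : s₁.mem 0 = k + 1 ∧ s₁.mem 3 = k ∧ s₁.mem 4 = j + 1 ∧ s₁.mem 5 = γ := by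
    simp [hs₁, block, addChild, Prog.eff, State.set, hk, hj, hγ]
  have e4 : Same [0, 3, 4, 5, 9] s s₁ := by
    intro d hd
    simp only [List.mem_cons, List.not_mem_nil, or_false, not_or] at hd
    simp [hs₁, block, addChild, Prog.eff, State.set, hd]
  obtain ⟨s₂, h2, f1, f2, f3, f4, f5, f6, f7⟩ :=
    runs_addChain (a := 4) (b := 5) (by simp) (by simp) e3.2.2.1
  rw [e3.1, e3.2.1] at f2 f4
  rw [e3.1] at f3
  rw [e3.2.2.2] at f6
  have f4' : s₂.mem 3 = k + j + 1 := by
    rw [f4, chainEnd, if_neg (by omega)]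
    omega
  have h3 := runs_eff (P := .copy 6 3) trivial s₂
  set s₃ := (Prog.copy 6 3).eff s₂ with hs₃
  have g : ∀ d, s₃.mem d = if d = 6 then k + j + 1 else s₂.mem d := by
    intro d
    simp [hs₃, Prog.eff, State.set, Function.update_apply, f4']
  obtain ⟨s₄, h4, g1, g2, g3, g4, g5, g6, g7⟩ :=
    runs_addChain (a := 5) (b := 4) (s := s₃) (t := γ - (j + 1)) (by simp) (by simp)
      (by rw [g, if_neg (by omega), f6])
  rw [g, g, if_neg (by omega), if_neg (by omega)] at g2 g4
  rw [g, if_neg (by omega)] at g3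
  obtain ⟨s₅, h5, k1, k2, k3, k4⟩ := runs_addLeaves (a := 6) (by simp) m s₄
  have k6 : s₄.mem 6 = k + j + 1 := by
    rw [g7 6 (by simp), g, if_pos rfl]
  have k0 : s₄.mem 0 = k + γ + 1 := by rw [g3, f3]; omega
  refine ⟨s₅, (h1.seq (h2.seq (h3.seq (h4.seq h5)))).mono ?_, ?_, ?_, ?_, ?_, ?_⟩
  · simp [block, addChild, Prog.cost]
    omega
  · rw [k1, g1, show s₃.inp = s₂.inp from rfl, f1, e1]
  -- The path is cut after the spare node and after the marked node, as the program writes it.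
  · rw [k2, g2, show s₃.out = s₂.out from rfl, f2, e2, k6, k0, blockEdges, records_append,
      show γ + 1 = (j + 1 + (γ - (j + 1))) + 1 by omega]
    rw [show chainEdges c k (j + 1 + (γ - (j + 1)) + 1) =
      (c, k) :: chainEdges k (k + 1) (j + 1 + (γ - (j + 1))) from rfl, chainEdges_add k (k + 1) (j + 1),
      records_cons, records_append, ← f4, ← f3]
    simp
  · rw [k3, k0]
  · rw [k4 3 (by simp), g4, f4', f3, chainEnd]
    split_ifs <;> omega
  · intro d hd
    simp only [List.mem_cons, List.not_mem_nil, or_false, not_or] at hd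
    rw [k4 d (by simp [hd]), g7 d (by simp [hd]), g, if_neg (by simp [hd]), f7 d (by simp [hd]),
      e4 d (by simp [hd])]

end RAM

/-! ### ### Writing the tree of an expression -/

namespace RAM

/-- Process the creation of a vertex. -/
def vertexProg : Prog :=
  .seq (block [.read 6, .read 4, .inc 4]) (.seq (addChain 4 5)
    (block [.const 9 1, .write 9, .write 3, .write 6, .dec 7, .dec 8]))

/-- Process a disjoint union. -/
def unionProg : Prog := block [.inc 7, .store 7 3, .inc 8]

/-- Process a join (`m = 3`) or a relabeling (`m = 4`). -/
def gadgetProg (m : ℕ) : Prog :=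
  .seq (block [.read 10, .read 4]) (.seq (addBlock 2) (.seq (.copy 4 10)
    (.seq (addBlock m) (.store 7 3))))

/-- Process one operation of an expression. -/
def treeBody : Prog :=
  .seq (block [.load 3 7, .read 2]) (switch 2 [vertexProg, unionProg, gadgetProg 3, gadgetProg 4])

/-- The state in which an expression is to be read that is represented below `c`, with new nodes
`k, k + 1, …`, when `m` more expressions follow. The stack has its top in cell `sp`. -/
structure TreeState (s : State) (γ k sp c m : ℕ) : Prop where
  labels : s.mem 1 = γ
  next : s.mem 0 = k
  ptr : s.mem 7 = sp
  le : 20 ≤ sp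
  top : s.mem sp = c
  pending : s.mem 8 = m + 1

theorem runs_treeBody {s s' : State} {γ k sp c m op b : ℕ} {rest : List ℕ} {P : Prog}
    (h : TreeState s γ k sp c m) (hi : s.inp = op :: rest)
    (hP : [vertexProg, unionProg, gadgetProg 3, gadgetProg 4][op]? = some P)
    (hr : Runs P ⟨Function.update (Function.update s.mem 3 c) 2 0, rest, s.out⟩ b s') :
    Runs treeBody s (b + 2 * op + 5) s' := by
  have h1 := runs_eff (P := block [.load 3 7, .read 2]) (by simp [block, Prog.Straight]) s
  refine (h1.seq (Runs.switch hP ?_ (b := b) ?_)).mono ?_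
  · simp [block, Prog.eff, State.set, hi]
  · have : ((block [.load 3 7, .read 2]).eff s).set 2 0 =
        ⟨Function.update (Function.update s.mem 3 c) 2 0, rest, s.out⟩ := by
      simp [block, Prog.eff, State.set, hi, h.ptr, h.top]
    rwa [this]
  · simp [block, Prog.cost]
    omega

theorem runs_treeBody_vertex {s : State} {γ k sp c m v i : ℕ} {rest : List ℕ}
    (h : TreeState s γ k sp c m) (hi : s.inp = 0 :: v :: i :: rest) (hγ : i < γ) :
    ∃ s', Runs treeBody s (22 * γ + 200) s' ∧ s'.inp = rest ∧
      s'.out = s.out ++ records (chainEdges c k (i + 1) ++ [(k + i, v)]) ∧ s'.mem 0 = k + (i + 1) ∧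
      s'.mem 1 = γ ∧ s'.mem 7 = sp - 1 ∧ s'.mem 8 = m ∧ ∀ a, 20 ≤ a → s'.mem a = s.mem a := by
  obtain ⟨h1, h0, h7, hsp, htop, h8⟩ := id h
  set s₀ : State := ⟨Function.update (Function.update s.mem 3 c) 2 0, v :: i :: rest, s.out⟩
    with hs₀
  have r1 := runs_eff (P := block [.read 6, .read 4, .inc 4]) (by simp [block, Prog.Straight]) s₀
  set s₁ := (block [.read 6, .read 4, .inc 4]).eff s₀ with hs₁
  have m1 : s₁.mem 0 = k ∧ s₁.mem 3 = c ∧ s₁.mem 4 = i + 1 ∧ s₁.mem 6 = v ∧ s₁.mem 1 = γ ∧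
      s₁.mem 7 = sp ∧ s₁.mem 8 = m + 1 ∧ s₁.inp = rest ∧ s₁.out = s.out := by
    simp [hs₁, hs₀, block, Prog.eff, State.set, h0, h1, h7, h8]
  have m1' : ∀ a, 20 ≤ a → s₁.mem a = s.mem a := by
    intro a ha
    simp [hs₁, hs₀, block, Prog.eff, State.set,
      show a ≠ 2 by omega, show a ≠ 3 by omega, show a ≠ 4 by omega, show a ≠ 6 by omega]
  obtain ⟨s₂, r2, f1, f2, f3, f4, -, -, f7⟩ :=
    runs_addChain (a := 4) (b := 5) (by simp) (by simp) m1.2.2.1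
  rw [m1.1, m1.2.1] at f2 f4
  rw [m1.1] at f3
  have r3 := runs_eff (P := block [.const 9 1, .write 9, .write 3, .write 6, .dec 7, .dec 8])
    (by simp [block, Prog.Straight]) s₂
  refine ⟨_, (runs_treeBody h hi rfl (r1.seq (r2.seq r3))).mono ?_, ?_, ?_, ?_, ?_, ?_, ?_, ?_⟩
  · simp [block, Prog.cost]
    omega
  · simp [block, Prog.eff, State.set, f1, m1]
  · have e : chainEnd c k (i + 1) = k + i := by
      rw [chainEnd, if_neg (Nat.succ_ne_zero i)]
      omega
    simp [block, Prog.eff, State.set, f2, f4, e, f7 6, m1, records]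
  · simp [block, Prog.eff, State.set, f3]
  · simp [block, Prog.eff, State.set, f7 1, m1]
  · simp [block, Prog.eff, State.set, f7 7, m1]
  · simp [block, Prog.eff, State.set, f7 8, m1]
  · intro a ha
    rw [← m1' a ha, ← f7 a (by simp; omega)]
    simp [block, Prog.eff, State.set,
      show a ≠ 7 by omega, show a ≠ 8 by omega, show a ≠ 9 by omega]

/-- The attachment point is duplicated on the stack, one copy for each operand; no edge is written.
-/
theorem runs_treeBody_union {s : State} {γ k sp c m : ℕ} {rest : List ℕ}
    (h : TreeState s γ k sp c m) (hi : s.inp = 1 :: rest) :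
    ∃ s', Runs treeBody s (22 * γ + 200) s' ∧ s'.inp = rest ∧ s'.out = s.out ∧
      TreeState s' γ k (sp + 1) c (m + 1) ∧ ∀ a, 20 ≤ a → a ≤ sp → s'.mem a = s.mem a := by
  obtain ⟨h1, h0, h7, hsp, htop, h8⟩ := id h
  have r1 := runs_eff (P := unionProg) (by simp [unionProg, block, Prog.Straight])
    ⟨Function.update (Function.update s.mem 3 c) 2 0, rest, s.out⟩
  refine ⟨_, (runs_treeBody h hi rfl r1).mono ?_, ?_, ?_, ⟨?_, ?_, ?_, by omega, ?_, ?_⟩, ?_⟩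
  · simp [unionProg, block, Prog.cost]
  · simp [unionProg, block, Prog.eff, State.set]
  · simp [unionProg, block, Prog.eff, State.set]
  · simp [unionProg, block, Prog.eff, State.set, Function.update_apply, h1, h7]
    omega
  · simp [unionProg, block, Prog.eff, State.set, Function.update_apply, h0, h7]
  · simp [unionProg, block, Prog.eff, State.set, Function.update_apply, h7]
    omega
  · simp [unionProg, block, Prog.eff, State.set, h7,
      show sp ≠ 7 by omega]
  · simp [unionProg, block, Prog.eff, State.set, Function.update_apply, h7, h8]
    omega
  · intro a ha ha'
    simp [unionProg, block, Prog.eff, State.set, Function.update_apply, h7,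
      show a ≠ 2 by omega, show a ≠ 3 by omega, show a ≠ 7 by omega, show a ≠ 8 by omega,
      show a ≠ sp + 1 by omega]

/-- The top of the stack is replaced by the bottom node of the new gadget, where the operand is to
hang. -/
theorem runs_treeBody_gadget {s : State} {γ k sp c m l op i j : ℕ} {rest : List ℕ}
    (h : TreeState s γ k sp c m) (hi : s.inp = op :: i :: j :: rest) (hop : op ≤ 3) (hl : l ≤ 4)
    (hP : [vertexProg, unionProg, gadgetProg 3, gadgetProg 4][op]? = some (gadgetProg l))
    (hiγ : i < γ) (hjγ : j < γ) :
    ∃ s', Runs treeBody s (22 * γ + 200) s' ∧ s'.inp = rest ∧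
      s'.out = s.out ++ records (gadgetEdges γ c k i j l) ∧
      TreeState s' γ (k + (2 * γ + 4 + l)) sp (k + 2 * γ + 3) m ∧
      ∀ a, 20 ≤ a → a < sp → s'.mem a = s.mem a := by
  obtain ⟨h1, h0, h7, hsp, htop, h8⟩ := id h
  set s₀ : State := ⟨Function.update (Function.update s.mem 3 c) 2 0, i :: j :: rest, s.out⟩
    with hs₀
  have r1 := runs_eff (P := block [.read 10, .read 4]) (by simp [block, Prog.Straight]) s₀
  set s₁ := (block [.read 10, .read 4]).eff s₀ with hs₁
  have m1 : s₁.mem 0 = k ∧ s₁.mem 3 = c ∧ s₁.mem 4 = j ∧ s₁.mem 10 = i ∧ s₁.mem 1 = γ ∧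
      s₁.mem 7 = sp ∧ s₁.mem 8 = m + 1 ∧ s₁.inp = rest ∧ s₁.out = s.out := by
    simp [hs₁, hs₀, block, Prog.eff, State.set, h0, h1, h7, h8]
  have m1' : ∀ a, 20 ≤ a → s₁.mem a = s.mem a := by
    intro a ha
    simp [hs₁, hs₀, block, Prog.eff, State.set,
      show a ≠ 2 by omega, show a ≠ 3 by omega, show a ≠ 4 by omega, show a ≠ 10 by omega]
  obtain ⟨c0, c3, c4, c10, c1, c7, c8, ci, co⟩ := m1
  obtain ⟨s₂, r2, f1, f2, f3, f4, f5⟩ := runs_addBlock (m := 2) c1 c4 hjγ c3 c0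
  have r3 := runs_eff (P := .copy 4 10) trivial s₂
  set s₃ := (Prog.copy 4 10).eff s₂ with hs₃
  have g : ∀ d, s₃.mem d = if d = 4 then i else s₂.mem d := by
    intro d
    simp [hs₃, Prog.eff, State.set, Function.update_apply, f5 10, c10]
  obtain ⟨s₄, r4, g1, g2, g3, g4, g5⟩ := runs_addBlock (m := l) (s := s₃) (γ := γ) (j := i)
    (c := k + γ) (k := k + γ + 3) (by simp [g, f5 1, c1]) (by simp [g]) hiγ (by simp [g, f4])
    (by simp [g, f3])
  have r5 := runs_eff (P := .store 7 3) trivial s₄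
  have q : ∀ a, (1 ≤ a ∧ a ≤ 2) ∨ 7 ≤ a ∧ a ≤ 8 ∨ 10 ≤ a → s₄.mem a = s₁.mem a := by
    intro a ha
    rw [g5 a (by simp; omega), g, if_neg (by omega), f5 a (by simp; omega)]
  have q7 : s₄.mem 7 = sp := by rw [q 7 (by simp), c7]
  refine ⟨_, (runs_treeBody h hi hP (r1.seq (r2.seq (r3.seq (r4.seq r5))))).mono ?_, ?_, ?_,
    ⟨?_, ?_, ?_, hsp, ?_, ?_⟩, ?_⟩
  · simp [block, Prog.cost]
    omega
  · simp [Prog.eff, State.set, g1, hs₃, f1, ci]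
  · simp [Prog.eff, State.set, g2, hs₃, f2, co, gadgetEdges, records_append]
  · simp [Prog.eff, State.set, q7, show 1 ≠ sp by omega, q 1, c1]
  · simp only [Prog.eff, State.set, q7, Function.update_apply, if_neg (show 0 ≠ sp by omega), g3]
    omega
  · simp [Prog.eff, State.set, q7, Function.update_apply]
    omega
  · simp only [Prog.eff, State.set, q7, Function.update_self, g4]
    omega
  · simp [Prog.eff, State.set, q7, show 8 ≠ sp by omega, q 8, c8]
  · intro a ha ha'
    rw [← m1' a ha, ← q a (by omega)]
    simp [Prog.eff, State.set, q7, show a ≠ sp by omega]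

/-- One loop handles all nested subexpressions, so none of them has a run of its own. The time bound
is therefore stated for continuations: every run of the loop from the state after `Γ` extends to one
from the state before it. The steps for `Γ` are charged to its symbols. -/
theorem runs_tree {γ n : ℕ} (Γ : CWExpr γ (Fin n)) {s : State} {k sp c m : ℕ} {rest : List ℕ}
    (h : TreeState s γ k sp c m) (hi : s.inp = Γ.code ++ rest) :
    ∃ s', (s'.inp = rest ∧ s'.out = s.out ++ records (Γ.treeEdges c k) ∧
      s'.mem 0 = k + Γ.nodeCount ∧ s'.mem 1 = γ ∧ s'.mem 7 = sp - 1 ∧ s'.mem 8 = m ∧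
      ∀ a, 20 ≤ a → a < sp → s'.mem a = s.mem a) ∧
      ∀ b s'', Runs (.whileNZ 8 treeBody) s' b s'' →
        Runs (.whileNZ 8 treeBody) s (b + (22 * γ + 201) * Γ.code.length) s'' := by
  have step : ∀ {s s' s'' : State} {k sp c m b : ℕ}, TreeState s γ k sp c m →
      Runs treeBody s (22 * γ + 200) s' → Runs (.whileNZ 8 treeBody) s' b s'' →
      Runs (.whileNZ 8 treeBody) s (b + (22 * γ + 201)) s'' := fun h h1 h2 =>
    (Runs.whileStep (by rw [h.pending]; omega) h1 h2).mono (by omega)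
  have gad : ∀ {Γ : CWExpr γ (Fin n)} {s : State} {k sp c m op l : ℕ} {i j : Fin γ}
      {w rest : List ℕ},
      (∀ {s : State} {k sp c m : ℕ}, TreeState s γ k sp c m → s.inp = Γ.code ++ rest →
        ∃ s', (s'.inp = rest ∧ s'.out = s.out ++ records (Γ.treeEdges c k) ∧
        s'.mem 0 = k + Γ.nodeCount ∧ s'.mem 1 = γ ∧ s'.mem 7 = sp - 1 ∧ s'.mem 8 = m ∧
        ∀ a, 20 ≤ a → a < sp → s'.mem a = s.mem a) ∧
        ∀ b s'', Runs (.whileNZ 8 treeBody) s' b s'' →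
          Runs (.whileNZ 8 treeBody) s (b + (22 * γ + 201) * Γ.code.length) s'') →
      TreeState s γ k sp c m → w = op :: i :: j :: Γ.code → s.inp = w ++ rest →
      op ≤ 3 → l ≤ 4 →
      [vertexProg, unionProg, gadgetProg 3, gadgetProg 4][op]? = some (gadgetProg l) →
      ∃ s', (s'.inp = rest ∧ s'.out = s.out ++ records (gadgetEdges γ c k i j l ++
          Γ.treeEdges (k + 2 * γ + 3) (k + (2 * γ + 4 + l))) ∧
        s'.mem 0 = k + (2 * γ + 4 + l + Γ.nodeCount) ∧ s'.mem 1 = γ ∧ s'.mem 7 = sp - 1 ∧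
        s'.mem 8 = m ∧ ∀ a, 20 ≤ a → a < sp → s'.mem a = s.mem a) ∧
        ∀ b s'', Runs (.whileNZ 8 treeBody) s' b s'' →
          Runs (.whileNZ 8 treeBody) s (b + (22 * γ + 201) * w.length) s'' := by
    rintro Γ s k sp c m op l i j w rest ih h rfl hi hop hl hP
    obtain ⟨s₁, r1, i1, o1, h1, e1⟩ := runs_treeBody_gadget h hi hop hl hP i.2 j.2
    obtain ⟨s₂, ⟨i2, o2, f0, f1, f7, f8, e2⟩, r2⟩ := ih h1 i1
    refine ⟨s₂, ⟨i2, ?_, by omega, f1, f7, f8, fun a ha ha' => (e2 a ha ha').trans (e1 a ha ha')⟩,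
      fun b s'' hb => (step h r1 (r2 b s'' hb)).mono ?_⟩
    · rw [o2, o1, records_append, List.append_assoc]
    · simp only [List.length_cons, Nat.mul_add]
      omega
  induction Γ generalizing s k sp c m rest with
  | vertex v i =>
    obtain ⟨s₁, r1, i1, o1, f0, f1, f7, f8, e1⟩ := runs_treeBody_vertex h hi i.2
    refine ⟨s₁, ⟨i1, o1, f0, f1, f7, f8, fun a ha _ => e1 a ha⟩,
      fun b s'' hb => (step h r1 hb).mono ?_⟩
    simp only [CWExpr.code, List.length_cons, Nat.mul_add]
    omega
  | union Γ Δ ih1 ih2 =>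
    rw [CWExpr.code, List.cons_append, List.append_assoc] at hi
    obtain ⟨s₁, r1, i1, o1, h1, e1⟩ := runs_treeBody_union h hi
    obtain ⟨s₂, ⟨i2, o2, f0, f1, f7, f8, e2⟩, r2⟩ := ih1 h1 i1
    -- Processing the first operand, whose stack starts at `sp + 1`, leaves the copy of `c` at `sp`
    -- intact.
    have h2 : TreeState s₂ γ (k + Γ.nodeCount) sp c m :=
      ⟨f1, f0, by omega, h.le, by rw [e2 sp h.le (by omega), e1 sp h.le le_rfl, h.top], f8⟩
    obtain ⟨s₃, ⟨i3, o3, g0, g1, g7, g8, e3⟩, r3⟩ := ih2 h2 i2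
    refine ⟨s₃, ⟨i3, ?_, ?_, g1, g7, g8, fun a ha ha' => ?_⟩,
      fun b s'' hb => (step h r1 (r2 _ _ (r3 b s'' hb))).mono ?_⟩
    · rw [o3, o2, o1, CWExpr.treeEdges, records_append, List.append_assoc]
    · rw [g0, CWExpr.nodeCount]
      omega
    · rw [e3 a ha ha', e2 a ha (by omega), e1 a ha (by omega)]
    · simp only [CWExpr.code, List.length_cons, List.length_append, Nat.mul_add]
      omega
  | join i j Γ ih =>
    exact gad (fun h hi => ih h hi) h rfl hi (by omega) (by omega) rfl
  | relabel i j Γ ih =>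
    exact gad (fun h hi => ih h hi) h rfl hi (by omega) (by omega) rfl

/-- Write the edge list of the tree of the expression in the input. -/
def treeProg : Prog :=
  .seq (block [.read 0, .read 1, .copy 3 0, .inc 0]) (.seq (addLeaves 3 5)
    (.seq (block [.const 7 20, .store 7 3, .const 8 1]) (.seq (.whileNZ 8 treeBody)
      (block [.const 9 0, .write 9, .write 0]))))

theorem runs_treeProg {γ n : ℕ} (Γ : CWExpr γ (Fin n)) (rest : List ℕ) :
    ∃ s', Runs treeProg ⟨fun _ => 0, n :: γ :: (Γ.code ++ rest), []⟩
      (60 + (22 * γ + 201) * Γ.code.length) s' ∧ s'.inp = rest ∧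
      s'.out = records Γ.allEdges ++ [0, Γ.treeSize] ∧ s'.mem 1 = γ := by
  have r1 := runs_eff (P := block [.read 0, .read 1, .copy 3 0, .inc 0])
    (by simp [block, Prog.Straight]) ⟨fun _ => 0, n :: γ :: (Γ.code ++ rest), []⟩
  set s₁ := (block [.read 0, .read 1, .copy 3 0, .inc 0]).eff
    ⟨fun _ => 0, n :: γ :: (Γ.code ++ rest), []⟩ with hs₁
  have m1 : s₁.mem 0 = n + 1 ∧ s₁.mem 3 = n ∧ s₁.mem 1 = γ ∧ s₁.inp = Γ.code ++ rest ∧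
      s₁.out = [] := by
    simp [hs₁, block, Prog.eff, State.set]
  obtain ⟨c0, c3, c1, ci, co⟩ := m1
  obtain ⟨s₂, r2, f1, f2, f3, f4⟩ := runs_addLeaves (a := 3) (by simp) 5 s₁
  have r3 := runs_eff (P := block [.const 7 20, .store 7 3, .const 8 1])
    (by simp [block, Prog.Straight]) s₂
  set s₃ := (block [.const 7 20, .store 7 3, .const 8 1]).eff s₂ with hs₃
  have h3 : TreeState s₃ γ (n + 6) 20 n 0 := by
    refine ⟨?_, ?_, ?_, le_rfl, ?_, ?_⟩
    · simp [hs₃, block, Prog.eff, State.set, f4 1, c1]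
    · simp [hs₃, block, Prog.eff, State.set, f3, c0]
    · simp [hs₃, block, Prog.eff, State.set]
    · simp [hs₃, block, Prog.eff, State.set, f4 3, c3]
    · simp [hs₃, block, Prog.eff, State.set]
  have i3 : s₃.inp = Γ.code ++ rest := by simp [hs₃, block, Prog.eff, State.set, f1, ci]
  obtain ⟨s₄, ⟨i4, o4, g0, g1, g7, g8, -⟩, r4⟩ := runs_tree Γ h3 i3
  have r5 := runs_eff (P := block [.const 9 0, .write 9, .write 0])
    (by simp [block, Prog.Straight]) s₄
  refine ⟨_, (r1.seq (r2.seq (r3.seq ((r4 1 s₄ (Runs.whileDone g8)).seq r5)))).mono ?_, ?_, ?_, ?_⟩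
  · simp [block, Prog.cost]
    omega
  · simp [block, Prog.eff, State.set, i4]
  · simp [block, Prog.eff, State.set, o4, hs₃, f2, co, c3, c0, g0, CWExpr.allEdges,
      records_append, CWExpr.treeSize]
  · simp [block, Prog.eff, State.set, g1]

end RAM

/-! ### ### Translating the formula -/

namespace RAM

open MSO1

/-- Write the word of the formula of bounded depth, whose bound is in cell `6`. -/
def climbProg : Prog := .whileNZ 6 (.seq (emit climbWord) (.dec 6))

theorem runs_climbProg {t : ℕ} {s : State} (ht : s.mem 6 = t) :
    ∃ s', Runs climbProg s ((2 * climbWord.length + 3) * t + 1) s' ∧ s'.inp = s.inp ∧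
      s'.out = s.out ++ (List.replicate t climbWord).flatten ∧ Same [6, 9] s s' := by
  induction t generalizing s with
  | zero => exact ⟨s, (Runs.whileDone ht).mono (by omega), rfl, by simp, fun _ _ => rfl⟩
  | succ t ih =>
    have h1 := runs_eff (P := .seq (emit climbWord) (.dec 6)) ⟨straight_emit _, trivial⟩ s
    obtain ⟨s', h2, h3, h4, h5⟩ := ih (s := Prog.eff (.seq (emit climbWord) (.dec 6)) s)
      (by simp [Prog.eff, eff_emit, State.set, ht])
    refine ⟨s', (h1.whileStep (by omega) h2).mono ?_, ?_, ?_, ?_⟩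
    · simp only [Prog.cost, cost_emit, Nat.mul_add]
      omega
    · simp [h3, Prog.eff, eff_emit, State.set]
    · simp [h4, Prog.eff, eff_emit, State.set, List.replicate_succ]
    · intro a ha
      rw [h5 a ha]
      simp only [List.mem_cons, List.not_mem_nil, or_false, not_or] at ha
      simp [Prog.eff, eff_emit, State.set, ha]

/-- Copy an atom other than an edge atom. -/
def atomProg (op : ℕ) : Prog :=
  .seq (emit [op]) (block [.read 4, .write 4, .read 4, .write 4, .dec 8])

/-- The first part of the translation of an edge atom. -/
def edgeProgHead : Prog :=
  block [.read 4, .read 5, emit [4, 3, 0], .write 4, .write 5, emit [8, 8, 4, 5, 4, 0, 1],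
    .inc 4, .inc 4, .write 4, emit [0, 0], .inc 5, .inc 5, .write 5, emit [4, 0, 1], .write 5,
    emit [0, 0], .write 4, emit preWord, .copy 6 1, .inc 6]

/-- Translate an edge atom. -/
def edgeProg : Prog :=
  .seq edgeProgHead (.seq climbProg (.seq (emit (2 :: 0 :: 0 :: postWord)) (.dec 8)))

/-- The word of `∀ y (y ∈ X → ν(y))` for the set `X` that has been bound last. -/
def setInDomWord : List ℕ := 9 :: 6 :: 2 :: 0 :: 0 :: domWord

/-- The programs for the twelve operations of formulas. -/
def transProgs : List Prog :=
  [atomProg 0, edgeProg, atomProg 2, emit [3], .seq (emit [4]) (.inc 8), .seq (emit [5]) (.inc 8),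
    .seq (emit [6]) (.inc 8), .seq (emit [7]) (.inc 8), emit (8 :: 4 :: domWord),
    emit (9 :: 6 :: domWord), emit (10 :: 4 :: setInDomWord), emit (11 :: 6 :: setInDomWord)]

/-- Translate one symbol of a formula. -/
def transBody : Prog := .seq (.read 2) (switch 2 transProgs)

/-- A bound for the steps spent on one symbol of a formula. -/
def transCost (γ : ℕ) : ℕ :=
  (2 * climbWord.length + 3) * (γ + 1) + 2 * (preWord.length + postWord.length + domWord.length) +
    100

theorem runs_transBody {s s' : State} {op b : ℕ} {rest : List ℕ} {P : Prog}
    (hi : s.inp = op :: rest) (hP : transProgs[op]? = some P)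
    (hr : Runs P ⟨Function.update s.mem 2 0, rest, s.out⟩ b s') :
    Runs transBody s (b + 24) s' := by
  have h1 := runs_eff (P := .read 2) trivial s
  have hop : op < 12 := by
    have := (List.getElem?_eq_some_iff.1 hP).1
    simpa [transProgs] using this
  refine (h1.seq (Runs.switch hP ?_ (b := b) ?_)).mono ?_
  · simp [Prog.eff, State.set, hi]
  · simpa [Prog.eff, State.set, hi] using hr
  · simp only [Prog.cost]
    omega

/-- If the input starts with `v` and a formula is expected, then the loop of the translation reads
`v` and writes `w`, and one formula less is expected. -/
def Translates (γ : ℕ) (v w : List ℕ) : Prop :=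
  ∀ ⦃s : State⦄ ⦃m : ℕ⦄ ⦃rest : List ℕ⦄, s.mem 1 = γ → s.mem 8 = m + 1 → s.inp = v ++ rest →
    ∃ s', (s'.inp = rest ∧ s'.out = s.out ++ w ∧ s'.mem 1 = γ ∧ s'.mem 8 = m) ∧
      ∀ b s'', Runs (.whileNZ 8 transBody) s' b s'' →
        Runs (.whileNZ 8 transBody) s (b + transCost γ * v.length) s''

theorem runs_transStep {γ m b : ℕ} {s s' s'' : State} (h8 : s.mem 8 = m + 1)
    (h : Runs transBody s (transCost γ - 1) s') (h' : Runs (.whileNZ 8 transBody) s' b s'') :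
    Runs (.whileNZ 8 transBody) s (b + transCost γ) s'' :=
  (Runs.whileStep (by omega) h h').mono (by unfold transCost; omega)

/-- For negation and quantifiers: one expected formula is replaced by another, so the counter in
cell `8` does not change. -/
theorem Translates.prefix {γ op : ℕ} {u v w : List ℕ} (h : Translates γ v w)
    (hP : transProgs[op]? = some (emit u)) (hu : u.length ≤ domWord.length + 7) :
    Translates γ (op :: v) (u ++ w) := by
  intro s m rest h1 h8 hi
  have r1 := runs_transBody hi hP (runs_eff (straight_emit u) _)
  obtain ⟨s', ⟨i1, o1, f1, f8⟩, r2⟩ := h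
    (s := (emit u).eff ⟨Function.update s.mem 2 0, v ++ rest, s.out⟩) (m := m) (rest := rest)
    (by simp [eff_emit, h1]) (by simp [eff_emit, h8]) (by simp [eff_emit])
  refine ⟨s', ⟨i1, by simp [o1, eff_emit], f1, f8⟩, fun b s'' hb =>
    (runs_transStep (γ := γ) h8 (r1.mono ?_) (r2 b s'' hb)).mono ?_⟩
  · rw [cost_emit, transCost]
    omega
  · rw [List.length_cons, Nat.mul_add]
    omega

/-- A connective replaces one expected formula by two, whence the increment of the counter. -/
theorem Translates.binary {γ op : ℕ} {v w v' w' : List ℕ} (h : Translates γ v w)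
    (h' : Translates γ v' w') (hP : transProgs[op]? = some (.seq (emit [op]) (.inc 8))) :
    Translates γ (op :: (v ++ v')) (op :: (w ++ w')) := by
  intro s m rest h1 h8 hi
  rw [List.cons_append, List.append_assoc] at hi
  have r1 := runs_transBody hi hP (runs_eff (P := .seq (emit [op]) (.inc 8)) ⟨straight_emit _, trivial⟩ _)
  obtain ⟨s', ⟨i1, o1, f1, f8⟩, r2⟩ := h
    (s := Prog.eff (.seq (emit [op]) (.inc 8))
      ⟨Function.update s.mem 2 0, v ++ (v' ++ rest), s.out⟩) (m := m + 1) (rest := v' ++ rest)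
    (by simp [Prog.eff, State.set, eff_emit, h1]) (by simp [Prog.eff, State.set, eff_emit, h8])
    (by simp [Prog.eff, State.set, eff_emit])
  obtain ⟨s'', ⟨i2, o2, g1, g8⟩, r3⟩ := h' f1 f8 i1
  refine ⟨s'', ⟨i2, by simp [o2, o1, Prog.eff, State.set, eff_emit], g1, g8⟩, fun b s'' hb =>
    (runs_transStep (γ := γ) h8 (r1.mono ?_) (r2 _ _ (r3 b s'' hb))).mono ?_⟩
  · simp [Prog.cost, cost_emit, transCost]
  · rw [List.length_cons, List.length_append, Nat.mul_add, Nat.mul_add]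
    omega

theorem Translates.of_runs {γ op x y : ℕ} {w : List ℕ} {P : Prog} (hP : transProgs[op]? = some P)
    (h : ∀ (s : State) (rest : List ℕ), s.mem 1 = γ → s.inp = x :: y :: rest →
      ∃ s', Runs P s (transCost γ - 25) s' ∧ s'.inp = rest ∧ s'.out = s.out ++ w ∧ s'.mem 1 = γ ∧
        s'.mem 8 = s.mem 8 - 1) : Translates γ [op, x, y] w := by
  intro s m rest h1 h8 hi
  obtain ⟨s', r, i1, o1, f1, f8⟩ := h ⟨Function.update s.mem 2 0, x :: y :: rest, s.out⟩ rest
    (by simp [h1]) rfl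
  refine ⟨s', ⟨i1, o1, f1, by simp [f8, h8]⟩, fun b s'' hb =>
    (runs_transStep (γ := γ) h8 ((runs_transBody hi hP r).mono ?_) hb).mono ?_⟩
  · unfold transCost
    omega
  · simp only [List.length_cons, List.length_nil]
    omega

theorem translates_atom {γ op x y : ℕ} (hP : transProgs[op]? = some (atomProg op)) :
    Translates γ [op, x, y] [op, x, y] := by
  refine Translates.of_runs hP fun s rest h1 hi => ?_
  have r := runs_eff (P := atomProg op) ⟨straight_emit _, by simp [block, Prog.Straight]⟩ s
  refine ⟨_, r.mono ?_, ?_⟩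
  · simp [atomProg, block, Prog.cost, cost_emit, transCost]
  · simp [atomProg, block, Prog.eff, State.set, eff_emit, hi, h1]

theorem translates_edge {γ x y : ℕ} : Translates γ [1, x, y] (etaWord γ x y) := by
  refine Translates.of_runs (P := edgeProg) rfl fun s rest h1 hi => ?_
  have r1 := runs_eff (P := edgeProgHead)
    (by simp [edgeProgHead, block, Prog.Straight, straight_emit]) s
  set s₁ := edgeProgHead.eff s with hs₁
  have m1 : s₁.mem 6 = γ + 1 ∧ s₁.mem 1 = γ ∧ s₁.mem 8 = s.mem 8 ∧ s₁.inp = rest ∧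
      s₁.out = s.out ++ ([4, 3, 0, x, y, 8, 8, 4, 5, 4, 0, 1, x + 2, 0, 0, y + 2, 4, 0, 1, y + 2,
        0, 0, x + 2] ++ preWord) := by
    simp [hs₁, edgeProgHead, block, Prog.eff, State.set, eff_emit, hi, h1]
  obtain ⟨c6, c1, c8, ci, co⟩ := m1
  obtain ⟨s₂, r2, i2, o2, e2⟩ := runs_climbProg c6
  have r3 := runs_eff (P := .seq (emit (2 :: 0 :: 0 :: postWord)) (.dec 8))
    ⟨straight_emit _, trivial⟩ s₂
  refine ⟨_, (r1.seq (r2.seq r3)).mono ?_, ?_, ?_, ?_, ?_⟩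
  · simp only [edgeProgHead, block, Prog.cost, cost_emit, transCost, List.length_cons,
      List.length_nil]
    omega
  · simp [Prog.eff, State.set, eff_emit, i2, ci]
  · simp [Prog.eff, State.set, eff_emit, o2, co, etaWord]
  · simp [Prog.eff, State.set, eff_emit, e2 1, c1]
  · simp [Prog.eff, State.set, eff_emit, e2 8, c8]

theorem code_setInDom {γ p q : ℕ} :
    ((cliqueWidthInterpretation γ).setInDom 0 : MSO1 p (q + 1)).code = setInDomWord := by
  rw [GraphInterpretation.setInDom, GraphInterpretation.domAt_cliqueWidth, code, code, code,
    code_domF]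
  rfl

/-- In Polish notation a relativized quantifier merely inserts a fixed word after the quantifier
symbol, and an edge atom is expanded in place. Nothing has to be remembered for later, so a counter
replaces the stack. -/
theorem translates_code {γ p q : ℕ} (ψ : MSO1 p q) :
    Translates γ ψ.code ((cliqueWidthInterpretation γ).translate ψ).code := by
  induction ψ with
  | eq x y => exact translates_atom rfl
  | edge x y =>
    rw [GraphInterpretation.translate, GraphInterpretation.edgeAt_cliqueWidth, code_etaF]
    exact translates_edge
  | mem x X => exact translates_atom rfl
  | not φ ih => exact ih.prefix (u := [3]) rfl (by simp)
  | and φ χ ih1 ih2 => exact ih1.binary ih2 rfl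
  | or φ χ ih1 ih2 => exact ih1.binary ih2 rfl
  | imp φ χ ih1 ih2 => exact ih1.binary ih2 rfl
  | iff φ χ ih1 ih2 => exact ih1.binary ih2 rfl
  | exV φ ih =>
    rw [GraphInterpretation.translate, GraphInterpretation.domAt_cliqueWidth, code, code, code, code_domF]
    exact ih.prefix (op := 8) (u := 8 :: 4 :: domWord) rfl (by simp)
  | allV φ ih =>
    rw [GraphInterpretation.translate, GraphInterpretation.domAt_cliqueWidth, code, code, code, code_domF]
    exact ih.prefix (op := 9) (u := 9 :: 6 :: domWord) rfl (by simp)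
  | exS φ ih =>
    rw [GraphInterpretation.translate, code, code, code, code_setInDom]
    exact ih.prefix (op := 10) (u := 10 :: 4 :: setInDomWord) rfl (by simp [setInDomWord])
  | allS φ ih =>
    rw [GraphInterpretation.translate, code, code, code, code_setInDom]
    exact ih.prefix (op := 11) (u := 11 :: 6 :: setInDomWord) rfl (by simp [setInDomWord])

/-- Translate a formula `ψ` into the conjunction of `∀ y (y ∈ X → ν(y))` and `ψ^I`. -/
def formulaProg : Prog :=
  .seq (.seq (emit (4 :: setInDomWord)) (.const 8 1)) (.whileNZ 8 transBody)

theorem runs_formulaProg {γ : ℕ} {s : State} (ψ : MSO1 0 1) (hγ : s.mem 1 = γ)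
    (hi : s.inp = ψ.code) :
    ∃ s', Runs formulaProg s (2 * domWord.length + 20 + transCost γ * ψ.code.length) s' ∧
      s'.out = s.out ++ (MSO1.and ((cliqueWidthInterpretation γ).setInDom 0)
        ((cliqueWidthInterpretation γ).translate ψ)).code := by
  have r1 := runs_eff (P := .seq (emit (4 :: setInDomWord)) (.const 8 1))
    ⟨straight_emit _, trivial⟩ s
  obtain ⟨s', ⟨-, o1, -, f8⟩, r2⟩ := translates_code (γ := γ) ψ
    (s := Prog.eff (.seq (emit (4 :: setInDomWord)) (.const 8 1)) s) (m := 0) (rest := [])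
    (by simp [Prog.eff, State.set, eff_emit, hγ]) (by simp [Prog.eff, State.set, eff_emit])
    (by simp [Prog.eff, State.set, eff_emit, hi])
  refine ⟨s', (r1.seq (r2 1 s' (Runs.whileDone f8))).mono ?_, ?_⟩
  · simp [Prog.cost, cost_emit, setInDomWord]
    omega
  · rw [o1, code, code_setInDom]
    simp [Prog.eff, State.set, eff_emit]

end RAM

/-! ### ### The algorithm as a whole -/

namespace CWExpr

variable {γ n : ℕ} (Γ : CWExpr γ (Fin n))

theorem code_length_pos : 0 < Γ.code.length := by
  cases Γ <;> simp [code]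

theorem exists_isEdgeList : ∃ L : List (Fin Γ.treeSize × Fin Γ.treeSize),
    IsEdgeList Γ.tree L ∧ edgeListCode Γ.treeSize L = RAM.records Γ.allEdges ++ [0, Γ.treeSize] := by
  obtain ⟨L, hL⟩ : ∃ L : List (Fin Γ.treeSize × Fin Γ.treeSize),
      L.map (fun e => ((e.1 : ℕ), (e.2 : ℕ))) = Γ.allEdges := by
    refine ⟨Γ.allEdges.pmap (fun e he => (⟨e.1, he.1⟩, ⟨e.2, he.2⟩)) (P := fun e =>
      e.1 < Γ.treeSize ∧ e.2 < Γ.treeSize) fun e he => ?_, ?_⟩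
    · exact ⟨(allEdges_bounds he).2.1, (allEdges_bounds he).2.2.1⟩
    · simp [List.map_pmap]
  have hmem : ∀ u v, (u, v) ∈ L ↔ ((u : ℕ), (v : ℕ)) ∈ Γ.allEdges := by
    intro u v
    rw [← hL, List.mem_map]
    constructor
    · exact fun h => ⟨_, h, rfl⟩
    · rintro ⟨⟨a, b⟩, h, he⟩
      obtain ⟨h1, h2⟩ := Prod.mk.inj he
      rwa [← Fin.ext h1, ← Fin.ext h2]
  refine ⟨L, fun u v => ?_, ?_⟩
  · rw [hmem, hmem]
    rfl
  · rw [edgeListCode, ← hL, RAM.records, List.flatMap_map]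

end CWExpr

theorem lemma3p7 :
    -- one algorithm `P`, which runs in linear time for every fixed number `γ` of labels
    ∃ (P : RAM.Prog) (f : ℕ → ℕ), ∀ γ : ℕ, ∃ I : GraphInterpretation,
      ∀ (n : ℕ) (G : SimpleGraph (Fin n)) (Γ : CWExpr γ (Fin n)), Γ.Constructs G →
        ∃ (N : ℕ) (hN : n ≤ N) (T : SimpleGraph (Fin N)),
          T.IsTree ∧ I.Interprets T G (Fin.castLEEmb hN) ∧
          ∀ ψ : MSO1 0 1, ∃ φ : MSO1 0 1,
            -- `φ(X)` is the formula `X ⊆ ν ∧ ψ^I(X)`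
            φ = MSO1.and (I.setInDom 0) (I.translate ψ) ∧
            (∃ L : List (Fin N × Fin N), IsEdgeList T L ∧
              RAM.ComputesWithin P (n :: γ :: (Γ.code ++ ψ.code)) (edgeListCode N L ++ φ.code)
                (f γ * (n + Γ.code.length + ψ.code.length))) ∧
            ∀ X : Set (Fin N), φ.Models T X ↔
              X ⊆ Set.range (Fin.castLE hN) ∧ ψ.Models G (Fin.castLE hN ⁻¹' X) := by
  refine ⟨.seq RAM.treeProg RAM.formulaProg,
    fun γ => 60 + (22 * γ + 201) + (2 * MSO1.domWord.length + 20) + RAM.transCost γ,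
    fun γ => ⟨cliqueWidthInterpretation γ, fun n G Γ hG => ?_⟩⟩
  refine ⟨Γ.treeSize, Γ.le_treeSize, Γ.tree, (CWExpr.isRootedTree hG.1 hG.2.1).isTree,
    CWExpr.interprets_tree hG, fun ψ => ⟨_, rfl, ?_, CWExpr.models_translate hG ψ⟩⟩
  obtain ⟨L, hL, hc⟩ := Γ.exists_isEdgeList
  obtain ⟨s₁, r1, i1, o1, h1⟩ := RAM.runs_treeProg Γ ψ.code
  obtain ⟨s₂, r2, o2⟩ := RAM.runs_formulaProg ψ h1 i1
  obtain ⟨t, ht, he⟩ := r1.seq r2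
  refine ⟨L, hL, t, s₂, he, by rw [o2, o1, hc], ht.trans ?_⟩
  -- The word of the expression is nonempty, which absorbs the additive constants into the linear
  -- bound.
  have hpos := Γ.code_length_pos
  nlinarith [Nat.zero_le (RAM.transCost γ), Nat.zero_le n, Nat.zero_le γ]
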